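/- **Setting.** Let $n\ge 0$, $[n]=\{1,\dots,n\}$ and $\pm[n]=\{i\in\mathbb Z: |i|\in[n]\}$. Let $B_n$ be the set of signed permutations, i.e. permutations $w$ of $\pm[n]$ with $w(-i)=-w(i)$, written $w_i=w(i)$, with the weak order: $v\le w$ iff $I(v)\subseteq I(w)$, where $I(w)=\{(w_j,w_i): i,j\in\pm[n],\ i<j,\ w_i>w_j\}$. This is a lattice. An element of a finite lattice is *join-irreducible* if it belongs to every set whose join it is. $\mathrm{Con}(B_n)$ is the set of lattice congruences of the weak order, ordered by refinement (finer is smaller), and $\mathrm{Irr}(\mathrm{Con}(B_n))$ is its subposet of join-irreducible elements. **Arrangement and shards.** Let $V=\{x\in\mathbb R^{\pm[n]}: x_{-i}=-x_i \text{ for all } i\}$ (so $\dim V=n$), let $\mathcal A$ be the set of hyperplanes $\{x\in V: x_a=x_b\}$ for $a>b$ in $\pm[n]$, and let $B=\{x\in V: x_a\le x_b \text{ for all } a>b\}$. *Regions* of an arrangement are the closures of the connected components of its complement. The separating set $S(R)$ of a region $R$ is the set of $H\in\mathcal A$ that strictly separate the interiors of $R$ and $B$; regions are ordered by containment of separating sets.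 A signed permutation $w$ corresponds to the region $R_w=\{x\in V: x_{w_j}\le x_{w_i}\text{ for all } i<j\}$. A *rank-two subarrangement* $\mathcal A'$ consists of all hyperplanes of $\mathcal A$ containing some fixed subspace of codimension $2$, and has at least two elements; its *basic* hyperplanes are the facet hyperplanes of the region of $\mathcal A'$ containing $B$. Write $H_1\to H_2$ if $H_1$ is basic and $H_2$ is not basic in the rank-two subarrangement of all $H\in\mathcal A$ containing $H_1\cap H_2$. The *shards* are obtained by removing from each $H\in\mathcal A$ the subspaces $\bigcap\mathcal A'$, for all rank-two subarrangements $\mathcal A'$ containing $H$ as a non-basic hyperplane, and taking the closures of the connected components of what is left. For a shard $\Sigma$, let $H_\Sigma$ be the hyperplane containing it. The *shard digraph* $\mathrm{Sh}(B_n)$ has the shards as its vertices, and $\Sigma_1\to\Sigma_2$ iff $H_{\Sigma_1}\to H_{\Sigma_2}$ and $\dim(\Sigma_1\cap\Sigma_2)=n-2$. An *upper region* of $\Sigma$ is a region $R$ with $\dim(R\cap\Sigma)=n-1$ and $H_\Sigma\in S(R)$. **Signed subsets.** A *signed subset* of $[n]$ is a set $A\subseteq\pm[n]$ that contains no pair $\{i,-i\}$.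 Put $-A=\{-a:a\in A\}$ and $\pm A=A\cup -A$, and let ${}^c$ denote complement in $\pm[n]$. For nonempty $A$ let $m=\min A$, and let $M=-m$ if $|A|=n$ and $M=\max\,(\pm A)^c$ otherwise. Call $A$ admissible if it is nonempty and $M>m$. For signed subsets $A_1,A_2$ with data $m_1,M_1,m_2,M_2$, consider the conditions (intervals are in $\pm[n]$): * (q1) $-m_1=M_1<M_2=-m_2$; * (q2) $-m_2=M_2=M_1>m_1>0$; * (q3) $M_2=M_1>m_1>m_2\ne -M_2$; * (q4) $M_2>M_1>m_1=m_2\neq -M_2$; * (q5) $-m_2=M_1>m_1>-M_2\neq m_2$; * (q6) $-m_2>M_1>m_1=-M_2\neq m_2$; * (f : $a$), for $a\in\pm[n]$: either $a\in A_2$; or $a\in A_2^c\setminus\{-M_2,-m_2\}$ and $-a\notin A_2\cap(m_2,M_2)$; or $a\in\{-M_2,-m_2\}$ and $(\pm A_2)^c\cap(m_2,M_2)\cap(-M_2,-m_2)=\emptyset$; * (r1) $A_1\cap(m_1,M_1)=A_2\cap(m_1,M_1)$; * (r2) $A_1\cap(m_1,M_1)=-A_2^c\cap(m_1,M_1)$.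 **Theorem.** (a) Sending an admissible $A$ to the signed permutation whose full notation $w_{-n}\cdots w_{-1}w_1\cdots w_n$ lists the elements of $-A$ in ascending order, then those of $(\pm A)^c$ in ascending order, then those of $A$ in ascending order, is a bijection from the admissible signed subsets of $[n]$ to the join-irreducible elements of the weak order on $B_n$. For each join-irreducible $w$ there is exactly one shard $\Sigma_w$ such that $R_w$ is minimal among the upper regions of $\Sigma_w$, and $w\mapsto\Sigma_w$ is a bijection from the join-irreducibles to the shards. (b) Let $A_1,A_2$ be admissible, with associated shards $\Sigma_1,\Sigma_2$. Then $\Sigma_1\to\Sigma_2$ in $\mathrm{Sh}(B_n)$ if and only if one of the following holds: 1. (q1) and (r1); 2. (q2) and (r1); 3. (q3), (f : $m_1$) and (r1); 4. (q4), (f : $M_1$) and (r1); 5. (q5), (f : $-m_1$) and (r2); 6. (q6), (f : $-M_1$) and (r2). (c) The transitive closure of $\mathrm{Sh}(B_n)$ is $\mathrm{Irr}(\mathrm{Con}(B_n))$: there is a bijection $\Phi$ from the shards to $\mathrm{Irr}(\mathrm{Con}(B_n))$ such that, for each join-irreducible $w$, $\Phi(\Sigma_w)$ is the smallest congruence identifying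 $w$ with the unique element it covers, and for all shards $\Sigma,\Sigma'$ one has $\Phi(\Sigma)>\Phi(\Sigma')$ if and only if there is a directed path of positive length from $\Sigma$ to $\Sigma'$. -/

import Mathlib

open scoped Topology

namespace ShardB

/-! ### Lattice congruences and join-irreducible elements -/

section Order

variable {L : Type*} [PartialOrder L]

/-- `a` is join-irreducible: whenever `a` is the join of a set `S`, already `a ∈ S`. -/
def IsJoinIrr (a : L) : Prop :=
  ∀ S : Set L, IsLUB S a → a ∈ S

/-- For an order in which all pairs have joins and meets: the equivalence relation `r` respects
joins and meets. -/
def IsCongruence (r : Setoid L) : Prop :=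
  (∀ a₁ a₂ b₁ b₂ c₁ c₂ : L, r a₁ a₂ → r b₁ b₂ →
    IsLUB {a₁, b₁} c₁ → IsLUB {a₂, b₂} c₂ → r c₁ c₂) ∧
  (∀ a₁ a₂ b₁ b₂ c₁ c₂ : L, r a₁ a₂ → r b₁ b₂ →
    IsGLB {a₁, b₁} c₁ → IsGLB {a₂, b₂} c₂ → r c₁ c₂)

variable (L) in
/-- The congruences of `L`, ordered by refinement: `r ≤ s` iff `r` is contained in `s`. -/
abbrev Con : Type _ := {r : Setoid L // IsCongruence r}

/-- The congruence `Θ` contracts some edge `v ⋖ w` down from `w`. -/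
def Contracts (Θ : Con L) (w : L) : Prop :=
  ∃ v, v ⋖ w ∧ Θ.1 v w

end Order

/-! ### Central hyperplane arrangements, regions and shards -/

section Arrangement

variable {V : Type*} [NormedAddCommGroup V] [NormedSpace ℝ V]

/-- The dimension of (the linear span of) a set. It is only used for cones with apex `0`,
where it agrees with the dimension of the affine hull. -/
noncomputable def dim (X : Set V) : ℕ :=
  Module.finrank ℝ (Submodule.span ℝ X)

/-- The complement of the union of the hyperplanes of the arrangement `𝒜`. -/
def arrCompl (𝒜 : Set (Submodule ℝ V)) : Set V :=
  {x | ∀ H ∈ 𝒜, x ∉ H}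

/-- Regions are the closures of the connected components of the complement. -/
def IsRegion (𝒜 : Set (Submodule ℝ V)) (R : Set V) : Prop :=
  ∃ x ∈ arrCompl 𝒜, R = closure (connectedComponentIn (arrCompl 𝒜) x)

/-- The separating set of the region `R` with respect to the base region `B`: the hyperplanes
with a linear functional that is negative inside `B` and positive inside `R`. -/
def sepSet (𝒜 : Set (Submodule ℝ V)) (B R : Set V) : Set (Submodule ℝ V) :=
  {H ∈ 𝒜 | ∃ f : V →ₗ[ℝ] ℝ, LinearMap.ker f = H ∧
    (∀ x ∈ interior B, f x < 0) ∧ ∀ x ∈ interior R, 0 < f x}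

/-- `𝒜'` consists of all hyperplanes of `𝒜` containing some fixed subspace of codimension two,
and has at least two elements. -/
def IsRankTwo (𝒜 𝒜' : Set (Submodule ℝ V)) : Prop :=
  (∃ U : Submodule ℝ V, Module.finrank ℝ U + 2 = Module.finrank ℝ V ∧ 𝒜' = {H ∈ 𝒜 | U ≤ H}) ∧
  𝒜'.Nontrivial

/-- `H` is basic in `𝒜'`: it is a facet hyperplane of the region of `𝒜'` that contains `B`. -/
def IsBasic (𝒜' : Set (Submodule ℝ V)) (B : Set V) (H : Submodule ℝ V) : Prop :=
  H ∈ 𝒜' ∧ ∃ B', IsRegion 𝒜' B' ∧ B ⊆ B' ∧ dim (B' ∩ H) + 1 = Module.finrank ℝ V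

/-- The arrow `H₁ → H₂` of the digraph `𝒬(𝒜, B)` on the hyperplanes. -/
def QArrow (𝒜 : Set (Submodule ℝ V)) (B : Set V) (H₁ H₂ : Submodule ℝ V) : Prop :=
  IsBasic {H ∈ 𝒜 | H₁ ⊓ H₂ ≤ H} B H₁ ∧
    H₂ ∈ 𝒜 ∧ ¬ IsBasic {H ∈ 𝒜 | H₁ ⊓ H₂ ≤ H} B H₂

/-- What remains of the hyperplane `H` after removing `⋂ 𝒜'` for every rank-two subarrangement
`𝒜'` in which `H` is a non-basic member. -/
def cutHyperplane (𝒜 : Set (Submodule ℝ V)) (B : Set V) (H : Submodule ℝ V) : Set V :=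
  {x | x ∈ H ∧ ∀ 𝒜', IsRankTwo 𝒜 𝒜' → H ∈ 𝒜' → ¬ IsBasic 𝒜' B H → x ∉ sInf 𝒜'}

/-- `T` is a shard contained in the hyperplane `H`. -/
def IsShardIn (𝒜 : Set (Submodule ℝ V)) (B : Set V) (H : Submodule ℝ V) (T : Set V) : Prop :=
  H ∈ 𝒜 ∧ ∃ x ∈ cutHyperplane 𝒜 B H,
    T = closure (connectedComponentIn (cutHyperplane 𝒜 B H) x)

/-- `T` is a shard of `(𝒜, B)`. -/
def IsShard (𝒜 : Set (Submodule ℝ V)) (B T : Set V) : Prop :=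
  ∃ H, IsShardIn 𝒜 B H T

/-- The arrow `T₁ → T₂` of the shard digraph `Sh(𝒜, B)`. -/
def ShArrow (𝒜 : Set (Submodule ℝ V)) (B T₁ T₂ : Set V) : Prop :=
  ∃ H₁ H₂, IsShardIn 𝒜 B H₁ T₁ ∧ IsShardIn 𝒜 B H₂ T₂ ∧ QArrow 𝒜 B H₁ H₂ ∧
    dim (T₁ ∩ T₂) + 2 = Module.finrank ℝ V

/-- `R` is an upper region of the shard `T`. -/
def IsUpperRegion (𝒜 : Set (Submodule ℝ V)) (B T R : Set V) : Prop :=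
  IsRegion 𝒜 R ∧ dim (R ∩ T) + 1 = Module.finrank ℝ V ∧
    ∃ H, IsShardIn 𝒜 B H T ∧ H ∈ sepSet 𝒜 B R

/-- `R` is a minimal upper region of the shard `T`, in the poset of regions (containment of
separating sets). -/
def IsMinUpperRegion (𝒜 : Set (Submodule ℝ V)) (B T R : Set V) : Prop :=
  IsUpperRegion 𝒜 B T R ∧
    ∀ R', IsUpperRegion 𝒜 B T R' → sepSet 𝒜 B R' ⊆ sepSet 𝒜 B R → R' = R

end Arrangement

/-! ### Signed permutations and the weak order on `B_n` -/

/-- The set `±[n]`. -/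
abbrev PM (n : ℕ) : Type := {i : ℤ // i ∈ (Finset.Icc (-(n : ℤ)) n).erase 0}

instance (n : ℕ) : Neg (PM n) :=
  ⟨fun i => ⟨-i.1, by
    have h := i.2
    simp only [Finset.mem_erase, Finset.mem_Icc] at h ⊢
    omega⟩⟩

/-- Signed permutations: the permutations `w` of `±[n]` with `w (-i) = - w i`. -/
def SignedPerm (n : ℕ) : Type := {w : Equiv.Perm (PM n) // ∀ i, w (-i) = -w i}

/-- The (left) inversion set `{(w_j, w_i) : i < j, w_i > w_j}`. -/
def invSet {n : ℕ} (w : SignedPerm n) : Set (PM n × PM n) :=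
  {p | ∃ i j, i < j ∧ w.1 j < w.1 i ∧ p = (w.1 j, w.1 i)}

theorem invSet_injective (n : ℕ) : Function.Injective (invSet (n := n)) := by
  have key : ∀ (w : SignedPerm n) (a b : PM n),
      (a, b) ∈ invSet w ↔ a < b ∧ w.1.symm b < w.1.symm a := by
    intro w a b
    constructor
    · rintro ⟨i, j, hij, h, hp⟩
      obtain ⟨rfl, rfl⟩ := Prod.mk.inj hp
      simpa using ⟨h, hij⟩
    · rintro ⟨h1, h2⟩
      exact ⟨_, _, h2, by simpa using h1, by simp⟩
  intro w v h
  have hlt : ∀ a b : PM n, a < b → (w.1.symm b < w.1.symm a ↔ v.1.symm b < v.1.symm a) := by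
    intro a b hab
    have := Set.ext_iff.mp h (a, b)
    rw [key, key] at this
    tauto
  have hlt' : ∀ a b : PM n, v.1.symm a < v.1.symm b → w.1.symm a < w.1.symm b := by
    intro a b hab
    rcases lt_trichotomy a b with h1 | h1 | h1
    · have h2 := (hlt a b h1).not.mpr (not_lt.mpr hab.le)
      exact lt_of_le_of_ne (not_lt.mp h2) (fun h3 => h1.ne (w.1.symm.injective h3))
    · exact absurd (h1 ▸ hab) (lt_irrefl _)
    · exact (hlt b a h1).mpr hab
  have hmono : StrictMono (v.1.trans w.1.symm) := by
    intro i j hij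
    exact hlt' (v.1 i) (v.1 j) (by simpa using hij)
  have hid := Subsingleton.elim
    (hmono.orderIsoOfSurjective _ (v.1.trans w.1.symm).surjective) (OrderIso.refl _)
  apply Subtype.ext
  ext1 i
  have h2 : w.1.symm (v.1 i) = i := congrArg (fun f : PM n ≃o PM n => f i) hid
  rw [Equiv.symm_apply_eq] at h2
  exact h2.symm

/-- The weak order on `B_n`: containment of inversion sets. -/
instance (n : ℕ) : PartialOrder (SignedPerm n) :=
  PartialOrder.lift invSet (invSet_injective n)

/-! ### The Coxeter arrangement of type `B_n` -/

/-- The `n`-dimensional space of all `x : ±[n] → ℝ` with `x_{-i} = -x_i`. -/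
def BSpace (n : ℕ) : Submodule ℝ (PM n → ℝ) where
  carrier := {x | ∀ i, x (-i) = -x i}
  add_mem' := by
    intro x y hx hy i
    simp only [Pi.add_apply, hx i, hy i]
    ring
  zero_mem' := by intro i; simp
  smul_mem' := by
    intro c x hx i
    simp [hx i]

/-- The hyperplane named `e_a - e_b` of the arrangement, given by `x_a = x_b`. -/
def hyp {n : ℕ} (a b : PM n) : Submodule ℝ (BSpace n) where
  carrier := {x | x.1 a = x.1 b}
  add_mem' := by
    intro x y hx hy
    exact congrArg₂ (· + ·) hx hy
  zero_mem' := rfl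
  smul_mem' := by
    intro c x hx
    exact congrArg (c * ·) hx

/-- The Coxeter arrangement of `B_n`. -/
def arrB (n : ℕ) : Set (Submodule ℝ (BSpace n)) :=
  {H | ∃ a b : PM n, b < a ∧ H = hyp a b}

/-- The base region: `e_a - e_b` is nonpositive for all `a > b`. -/
def baseB (n : ℕ) : Set (BSpace n) :=
  {x | ∀ a b : PM n, b < a → x.1 a ≤ x.1 b}

/-- The region `w B` of the signed permutation `w` (where `w` permutes coordinates). Its interior
consists of the `x` with `x_{w_i} > x_{w_j}` for `i < j`, so `e_a - e_b` with `a > b` is in its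
separating set iff `(b, a)` is an inversion of `w`. -/
def regionB {n : ℕ} (w : SignedPerm n) : Set (BSpace n) :=
  {x | ∀ i j : PM n, i < j → x.1 (w.1 j) ≤ x.1 (w.1 i)}

/-- The shards of `B_n`. -/
abbrev ShardsB (n : ℕ) : Type := {T : Set (BSpace n) // IsShard (arrB n) (baseB n) T}

/-- The arrows of the shard digraph `Sh(B_n)`. -/
def ShArrowB {n : ℕ} (T₁ T₂ : ShardsB n) : Prop :=
  ShArrow (arrB n) (baseB n) T₁.1 T₂.1

/-! ### Signed subsets -/

/-- Nonempty signed subsets of `[n]`. -/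
structure SignedSubset (n : ℕ) where
  carrier : Finset (PM n)
  nonempty : carrier.Nonempty
  signed : ∀ i ∈ carrier, -i ∉ carrier

namespace SignedSubset

variable {n : ℕ} (A : SignedSubset n)

/-- `(±A)ᶜ`, the complement in `±[n]` of `A ∪ -A`. -/
noncomputable def pmCompl : Finset (PM n) :=
  Finset.univ.filter fun a => a ∉ A.carrier ∧ -a ∉ A.carrier

/-- `m = min A`. -/
noncomputable def m : PM n := A.carrier.min' A.nonempty

/-- `M = -m` if `|A| = n`, that is, if `(±A)ᶜ` is empty; otherwise `M = max (±A)ᶜ`. -/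
noncomputable def M : PM n := if h : A.pmCompl.Nonempty then A.pmCompl.max' h else -A.m

/-- The position of `a` among the blocks `-A`, `(±A)ᶜ`, `A`. -/
def block (a : PM n) : ℕ := if -a ∈ A.carrier then 0 else if a ∈ A.carrier then 2 else 1

/-- The full notation of `w` lists the elements of `-A` in ascending order, followed by `(±A)ᶜ` in
ascending order, then `A` in ascending order. -/
def Lists (w : SignedPerm n) : Prop :=
  ∀ i j : PM n, i < j →
    A.block (w.1 i) < A.block (w.1 j) ∨ (A.block (w.1 i) = A.block (w.1 j) ∧ w.1 i < w.1 j)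

end SignedSubset

section Conditions

variable {n : ℕ} (A₁ A₂ : SignedSubset n)

def q1 : Prop := -A₁.m = A₁.M ∧ A₁.M < A₂.M ∧ A₂.M = -A₂.m

def q2 : Prop := -A₂.m = A₂.M ∧ A₂.M = A₁.M ∧ A₁.m < A₁.M ∧ 0 < A₁.m.1

def q3 : Prop := A₂.M = A₁.M ∧ A₁.m < A₁.M ∧ A₂.m < A₁.m ∧ A₂.m ≠ -A₂.M

def q4 : Prop := A₁.M < A₂.M ∧ A₁.m < A₁.M ∧ A₁.m = A₂.m ∧ A₂.m ≠ -A₂.M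

def q5 : Prop := -A₂.m = A₁.M ∧ A₁.m < A₁.M ∧ -A₂.M < A₁.m ∧ -A₂.M ≠ A₂.m

def q6 : Prop := A₁.M < -A₂.m ∧ A₁.m < A₁.M ∧ A₁.m = -A₂.M ∧ -A₂.M ≠ A₂.m

/-- Condition (f : a) on the signed subset `A`, the disjunction of (f1 : a), (f2 : a), (f3 : a). -/
def condF (A : SignedSubset n) (a : PM n) : Prop :=
  a ∈ A.carrier ∨
  (a ∉ A.carrier ∧ a ≠ -A.M ∧ a ≠ -A.m ∧ ¬ (-a ∈ A.carrier ∧ -a ∈ Set.Ioo A.m A.M)) ∨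
  ((a = -A.M ∨ a = -A.m) ∧
    (A.pmCompl : Set (PM n)) ∩ Set.Ioo A.m A.M ∩ Set.Ioo (-A.M) (-A.m) = ∅)

/-- `A₁ ∩ (m₁, M₁) = A₂ ∩ (m₁, M₁)`. -/
def r1 : Prop :=
  (A₁.carrier : Set (PM n)) ∩ Set.Ioo A₁.m A₁.M = (A₂.carrier : Set (PM n)) ∩ Set.Ioo A₁.m A₁.M

/-- `A₁ ∩ (m₁, M₁) = -A₂ᶜ ∩ (m₁, M₁)`. -/
def r2 : Prop :=
  (A₁.carrier : Set (PM n)) ∩ Set.Ioo A₁.m A₁.M = {a | -a ∉ A₂.carrier} ∩ Set.Ioo A₁.m A₁.M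

end Conditions

end ShardB

/-! A signed permutation is handled through the linear order `pos` that it puts on its values, and a
point x of the space through the order obtained by sorting its coordinates decreasingly. Breaking
ties by ascending or descending index gives `botP x` and `topP x`, the ends of the interval of
permutations whose regions contain x. A point on a single hyperplane (`Wall`) thus stands for a
cover of the weak order, a generic point of codimension two for a polygon, and x ↦ -x for reversing
the notation, which reverses the order (`negP`).

Encoding. For b < a the hyperplane x_a = x_b is cut exactly along x_c = x_a with b < c < a
(`isBasic_iff`, `cutHyperplane_hyp`), so a shard is a choice of side for each such c. The hyperplane
has two names, (a, b) and (-b, -a); a sign normalization selects one of them, and the recorded sides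
then extend uniquely to an admissible signed subset A with (M, m) as that name (`exists_inner`,
`eq_of_inner`). The permutation `gamma` of A lies below `topP p` for every p in the shard
(`gamma_le_topP`), and up to negation its only descent is at M, m. Hence it is join-irreducible and
is the least upper region of its shard; conversely a join-irreducible element equals the `gamma` of
the label of any of its lower walls.

Arrows. An arrow means that some point interior to the first shard lies in the second one, on a cut
of the second hyperplane, with no ties in the second cut interval beyond those forced by the
intersection of the two hyperplanes (`Arr`, `shArrow_iff`). That intersection is x_M = x_m = x_e,
with M, m from the second subset and e the cut. Listing the hyperplanes through it gives (q1)-(q6);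
condition (f) says that such a point of the second shard exists, and (r1), (r2) say that it is
interior to the first.

Congruences. Every cover is labelled by the shard that it crosses and is perspective to the cover
below the join-irreducible element of that label, so a congruence is determined by the labels it
contracts. Arrows force (`inverted_or`, `forces_of_inverted`), and conversely all forcing follows
arrow paths (`reach_of_wall`, an induction through polygons). For a set of labels closed under
arrows, having the same remaining join-irreducible elements below is equivalent to having the same
remaining meet-irreducible elements above (`EdgeSystem.rel_iff`), hence is a congruence. So
congruences are the closed sets of labels and the join-irreducible ones are the principal ones.
Since M - m increases along arrows, there are no cycles, and strict order is reachability by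
nonempty paths. -/

namespace ShardB

/-! ### Signed permutations as linear orders -/

section SignedOrder

variable {n : ℕ}

@[simp] theorem PM.coe_neg (a : PM n) : ((-a : PM n) : ℤ) = -a.1 := rfl

theorem PM.coe_ne_zero (a : PM n) : a.1 ≠ 0 := by
  have := a.2
  simp only [Finset.mem_erase] at this
  exact this.1

@[simp] theorem PM.neg_neg (a : PM n) : - -a = a := Subtype.ext (by simp)

theorem PM.lt_iff {a b : PM n} : a < b ↔ a.1 < b.1 := Iff.rfl

theorem PM.le_iff {a b : PM n} : a ≤ b ↔ a.1 ≤ b.1 := Iff.rfl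

theorem PM.eq_iff {a b : PM n} : a = b ↔ a.1 = b.1 := Subtype.ext_iff

theorem PM.neg_lt_neg {a b : PM n} : -a < -b ↔ b < a := by
  simp only [PM.lt_iff, PM.coe_neg]; omega

theorem PM.neg_inj {a b : PM n} : -a = -b ↔ a = b := by
  simp only [PM.eq_iff, PM.coe_neg]; omega

theorem PM.neg_ne_self (a : PM n) : -a ≠ a := by
  have := a.coe_ne_zero
  simp only [ne_eq, PM.eq_iff, PM.coe_neg]; omega

theorem PM.eq_neg_comm {a b : PM n} : a = -b ↔ b = -a := by
  simp only [PM.eq_iff, PM.coe_neg]; omega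

/-- The position of the value `a` in the full notation of `w`. -/
def pos (w : SignedPerm n) (a : PM n) : PM n := w.1.symm a

theorem pos_apply (w : SignedPerm n) (i : PM n) : pos w (w.1 i) = i := by simp [pos]

theorem apply_pos (w : SignedPerm n) (a : PM n) : w.1 (pos w a) = a := by simp [pos]

theorem pos_injective (w : SignedPerm n) : Function.Injective (pos w) := w.1.symm.injective

theorem pos_neg (w : SignedPerm n) (a : PM n) : pos w (-a) = -pos w a := by
  rw [pos, Equiv.symm_apply_eq, w.2, apply_pos]

theorem pos_lt_neg {w : SignedPerm n} {a b : PM n} :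
    pos w (-a) < pos w (-b) ↔ pos w b < pos w a := by
  rw [pos_neg, pos_neg, PM.neg_lt_neg]

theorem mem_invSet {w : SignedPerm n} {a b : PM n} :
    (a, b) ∈ invSet w ↔ a < b ∧ pos w b < pos w a := by
  constructor
  · rintro ⟨i, j, hij, h, hp⟩
    obtain ⟨rfl, rfl⟩ := Prod.mk.inj hp
    simpa [pos] using ⟨h, hij⟩
  · rintro ⟨h1, h2⟩
    exact ⟨_, _, h2, by simpa [pos] using h1, by simp [pos]⟩

theorem weak_le_iff {v w : SignedPerm n} :
    v ≤ w ↔ ∀ a b : PM n, a < b → pos v b < pos v a → pos w b < pos w a := by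
  change invSet v ⊆ invSet w ↔ _
  constructor
  · intro h a b hab h1
    exact (mem_invSet.mp (h (mem_invSet.mpr ⟨hab, h1⟩))).2
  · rintro h ⟨a, b⟩ hab
    rw [mem_invSet] at hab ⊢
    exact ⟨hab.1, h a b hab.1 hab.2⟩

theorem pos_lt_or {w : SignedPerm n} {a b : PM n} (h : a ≠ b) : pos w a < pos w b ∨
    pos w b < pos w a :=
  lt_or_gt_of_ne fun h1 => h (pos_injective w h1)

/-- Noninversions are inherited downwards. -/
theorem noninv_of_le {v w : SignedPerm n} (h : v ≤ w) {a b : PM n} (hab : a < b)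
    (h1 : pos w a < pos w b) : pos v a < pos v b := by
  rcases pos_lt_or (w := v) hab.ne with h2 | h2
  · exact h2
  · exact absurd (weak_le_iff.mp h a b hab h2) h1.asymm

theorem strictMono_eq_id {f : PM n → PM n} (hf : StrictMono f) (a : PM n) : f a = a := by
  have hb : Function.Surjective f := Finite.surjective_of_injective hf.injective
  have hid := Subsingleton.elim (hf.orderIsoOfSurjective _ hb) (OrderIso.refl _)
  exact congrArg (fun f : PM n ≃o PM n => f a) hid

theorem signedPerm_ext {v w : SignedPerm n}
    (h : ∀ a b, pos v a < pos v b → pos w a < pos w b) : v = w := by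
  apply Subtype.ext
  ext1 i
  have : StrictMono fun i => pos w (v.1 i) := by
    intro i j hij
    exact h _ _ (by simpa [pos_apply] using hij)
  have h2 : pos w (v.1 i) = i := strictMono_eq_id this i
  rw [← apply_pos w (v.1 i), h2]

/-- The position of a is its number of predecessors, transported to ±[n]. The symmetry of r makes i
↦ -E(-E⁻¹ i) strictly monotone; a finite linear order has no other automorphism than the identity,
so E commutes with negation. -/
theorem exists_sort (r : PM n → PM n → Prop) (irr : ∀ a, ¬ r a a)
    (tr : ∀ a b c, r a b → r b c → r a c) (tot : ∀ a b, a ≠ b → r a b ∨ r b a)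
    (sym : ∀ a b, r a b → r (-b) (-a)) :
    ∃ w : SignedPerm n, ∀ a b, pos w a < pos w b ↔ r a b := by
  classical
  let N : PM n → ℕ := fun a => (Finset.univ.filter fun b => r b a).card
  have hN : ∀ a b, r a b → N a < N b := by
    intro a b hab
    apply Finset.card_lt_card
    rw [Finset.ssubset_iff_of_subset]
    · exact ⟨a, by simp [hab], by simp [irr]⟩
    · intro c hc
      simp only [Finset.mem_filter, Finset.mem_univ, true_and] at hc ⊢
      exact tr _ _ _ hc hab
  have hlt : ∀ a, N a < Fintype.card (PM n) := by
    intro a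
    rw [← Finset.card_univ]
    apply Finset.card_lt_card
    rw [Finset.ssubset_iff_of_subset (Finset.subset_univ _)]
    exact ⟨a, by simp, by simp [irr]⟩
  let o := Fintype.orderIsoFinOfCardEq (PM n) rfl
  let e : PM n → PM n := fun a => o ⟨N a, hlt a⟩
  have he : ∀ a b, r a b → e a < e b := fun a b hab => o.lt_iff_lt.mpr (hN a b hab)
  have he' : ∀ a b, e a < e b ↔ r a b := by
    intro a b
    refine ⟨fun h => ?_, he a b⟩
    by_contra h1
    by_cases hab : a = b
    · subst hab; exact lt_irrefl _ h
    · rcases tot a b hab with h2 | h2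
      · exact h1 h2
      · exact h.asymm (he _ _ h2)
  have hinj : Function.Injective e := by
    intro a b hab
    by_contra h
    rcases tot a b h with h2 | h2
    · exact (he _ _ h2).ne hab
    · exact (he _ _ h2).ne hab.symm
  let E : PM n ≃ PM n := Equiv.ofBijective e ⟨hinj, Finite.surjective_of_injective hinj⟩
  have hE : ∀ a, E a = e a := fun a => rfl
  have hmono : StrictMono fun i => -E (-E.symm i) := by
    intro i j hij
    rw [PM.neg_lt_neg, hE, hE, he']
    apply sym
    rw [← he', ← hE, ← hE]
    simpa using hij
  have hneg : ∀ a, E (-a) = -E a := by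
    intro a
    have := strictMono_eq_id hmono (E a)
    simp only [Equiv.symm_apply_apply] at this
    rw [PM.eq_neg_comm, this]
  refine ⟨⟨E.symm, fun i => ?_⟩, fun a b => ?_⟩
  · rw [Equiv.symm_apply_eq, hneg, Equiv.apply_symm_apply]
  · exact he' a b

theorem coord_neg (x : BSpace n) (a : PM n) : x.1 (-a) = -x.1 a := x.2 a

theorem exists_topP (x : BSpace n) : ∃ w : SignedPerm n, ∀ a b,
    pos w a < pos w b ↔ x.1 b < x.1 a ∨ (x.1 a = x.1 b ∧ b < a) := by
  apply exists_sort
  · intro a; simp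
  · intro a b c h1 h2
    rcases h1 with h1 | h1 <;> rcases h2 with h2 | h2
    · left; linarith
    · left; linarith [h2.1]
    · left; linarith [h1.1]
    · right; exact ⟨h1.1.trans h2.1, h2.2.trans h1.2⟩
  · intro a b hab
    rcases lt_trichotomy (x.1 a) (x.1 b) with h | h | h
    · exact Or.inr (Or.inl h)
    · rcases lt_or_gt_of_ne hab with h1 | h1
      · exact Or.inr (Or.inr ⟨h.symm, h1⟩)
      · exact Or.inl (Or.inr ⟨h, h1⟩)
    · exact Or.inl (Or.inl h)
  · intro a b h
    simp only [coord_neg, PM.neg_lt_neg]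
    rcases h with h | h
    · left; linarith
    · right; exact ⟨by linarith [h.1], h.2⟩

/-- The largest signed permutation whose region contains `x`. -/
noncomputable def topP (x : BSpace n) : SignedPerm n := (exists_topP x).choose

theorem topP_lt {x : BSpace n} {a b : PM n} :
    pos (topP x) a < pos (topP x) b ↔ x.1 b < x.1 a ∨ (x.1 a = x.1 b ∧ b < a) :=
  (exists_topP x).choose_spec a b

theorem exists_negP (w : SignedPerm n) : ∃ v : SignedPerm n, ∀ a b,
    pos v a < pos v b ↔ pos w b < pos w a := by
  apply exists_sort
  · intro a; simp
  · intro a b c h1 h2; exact h2.trans h1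
  · intro a b hab; exact (pos_lt_or hab).symm
  · intro a b h; exact pos_lt_neg.mpr h

/-- The signed permutation whose full notation is the reverse of that of `w`. -/
noncomputable def negP (w : SignedPerm n) : SignedPerm n := (exists_negP w).choose

theorem negP_lt {w : SignedPerm n} {a b : PM n} :
    pos (negP w) a < pos (negP w) b ↔ pos w b < pos w a :=
  (exists_negP w).choose_spec a b

theorem negP_negP (w : SignedPerm n) : negP (negP w) = w :=
  signedPerm_ext fun a b h => by rwa [negP_lt, negP_lt] at h

theorem negP_le_negP {v w : SignedPerm n} (h : v ≤ w) : negP w ≤ negP v := by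
  rw [weak_le_iff]
  intro a b hab h1
  rw [negP_lt] at h1 ⊢
  exact noninv_of_le h hab h1

theorem negP_le_iff {v w : SignedPerm n} : negP v ≤ w ↔ negP w ≤ v :=
  ⟨fun h => by simpa [negP_negP] using negP_le_negP h,
    fun h => by simpa [negP_negP] using negP_le_negP h⟩

theorem le_negP_iff {v w : SignedPerm n} : v ≤ negP w ↔ w ≤ negP v :=
  ⟨fun h => by simpa [negP_negP] using negP_le_negP h,
    fun h => by simpa [negP_negP] using negP_le_negP h⟩

/-- The smallest signed permutation whose region contains `x`. -/
noncomputable def botP (x : BSpace n) : SignedPerm n := negP (topP (-x))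

theorem botP_lt {x : BSpace n} {a b : PM n} :
    pos (botP x) a < pos (botP x) b ↔ x.1 b < x.1 a ∨ (x.1 a = x.1 b ∧ a < b) := by
  rw [botP, negP_lt, topP_lt]
  simp [eq_comm]

theorem botP_neg (x : BSpace n) : botP (-x) = negP (topP x) := by rw [botP, neg_neg]

theorem topP_neg (x : BSpace n) : topP (-x) = negP (botP x) := by rw [botP, negP_negP]

instance : Finite (SignedPerm n) :=
  inferInstanceAs (Finite {w : Equiv.Perm (PM n) // ∀ i, w (-i) = -w i})

/-- The noninversions of the meet are the transitive closure `T` of the union of the two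
noninversion sets. `T` is also cotransitive (`hco`), which is what makes it the noninversion set of
a linear order, and it is stable under negation. -/
theorem exists_isGLB (v w : SignedPerm n) : ∃ u, IsGLB {v, w} u := by
  let R : PM n → PM n → Prop := fun a b => a < b ∧ (pos v a < pos v b ∨ pos w a < pos w b)
  let T : PM n → PM n → Prop := Relation.TransGen R
  have hT : ∀ {a b}, T a b → a < b := by
    intro a b h
    induction h with
    | single h => exact h.1
    | tail _ h ih => exact ih.trans h.1
  have hR : ∀ {a b c}, R a c → a < b → b < c → R a b ∨ R b c := by
    intro a b c h hab hbc
    rcases h.2 with h1 | h1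
    · rcases pos_lt_or (w := v) hab.ne with h2 | h2
      · exact Or.inl ⟨hab, Or.inl h2⟩
      · exact Or.inr ⟨hbc, Or.inl (h2.trans h1)⟩
    · rcases pos_lt_or (w := w) hab.ne with h2 | h2
      · exact Or.inl ⟨hab, Or.inr h2⟩
      · exact Or.inr ⟨hbc, Or.inr (h2.trans h1)⟩
  have hco : ∀ {a b c}, T a c → a < b → b < c → T a b ∨ T b c := by
    intro a b c h
    induction h with
    | single h =>
      intro hab hbc
      exact (hR h hab hbc).imp .single .single
    | @tail d c h1 h2 ih =>
      intro hab hbc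
      rcases lt_trichotomy b d with h3 | h3 | h3
      · exact (ih hab h3).imp id fun h => h.tail h2
      · subst h3; exact Or.inl h1
      · exact (hR h2 h3 hbc).imp (fun h => h1.tail h) .single
  have hneg : ∀ {a b}, T a b → T (-b) (-a) := by
    intro a b h
    have hs : ∀ {a b}, R a b → R (-b) (-a) := by
      intro a b h
      exact ⟨PM.neg_lt_neg.mpr h.1, h.2.imp pos_lt_neg.mpr pos_lt_neg.mpr⟩
    induction h with
    | single h => exact .single (hs h)
    | tail _ h ih => exact .head (hs h) ih
  have hnegi : ∀ {a b}, T (-b) (-a) → T a b := fun h => by simpa using hneg h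
  obtain ⟨u, hu⟩ := exists_sort (fun a b => (a < b ∧ T a b) ∨ (b < a ∧ ¬ T b a))
    (by simp)
    (by
      intro a b c h1 h2
      rcases h1 with ⟨h1, h1'⟩ | ⟨h1, h1'⟩ <;> rcases h2 with ⟨h2, h2'⟩ | ⟨h2, h2'⟩
      · exact Or.inl ⟨h1.trans h2, h1'.trans h2'⟩
      · rcases lt_trichotomy a c with h | h | h
        · exact Or.inl ⟨h, (hco h1' h h2).resolve_right h2'⟩
        · exact absurd (h ▸ h1') h2'
        · exact Or.inr ⟨h, fun h3 => h2' (h3.trans h1')⟩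
      · rcases lt_trichotomy a c with h | h | h
        · exact Or.inl ⟨h, (hco h2' h1 h).resolve_left h1'⟩
        · exact absurd (h ▸ h2') h1'
        · exact Or.inr ⟨h, fun h3 => h1' (h2'.trans h3)⟩
      · refine Or.inr ⟨h2.trans h1, fun h3 => ?_⟩
        exact (hco h3 h2 h1).elim h2' h1')
    (by
      intro a b hab
      rcases lt_or_gt_of_ne hab with h | h <;> by_cases h1 : T a b <;> by_cases h2 : T b a <;>
        simp [h, h.asymm, h1, h2])
    (by
      intro a b h
      simp only [PM.neg_lt_neg]
      exact h.imp (fun h => ⟨h.1, hneg h.2⟩) (fun h => ⟨h.1, fun h3 => h.2 (hnegi h3)⟩))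
  have hle : ∀ x, (∀ a b, R a b → pos x a < pos x b) → x ≤ u := by
    intro x hx
    rw [weak_le_iff]
    intro a b hab h1
    rw [hu]
    refine Or.inr ⟨hab, fun h => ?_⟩
    have : ∀ {a b}, T a b → pos x a < pos x b := by
      intro a b h
      induction h with
      | single h => exact hx _ _ h
      | tail _ h ih => exact ih.trans (hx _ _ h)
    exact (this h).asymm h1
  have hge : ∀ x, (∀ a b, a < b → pos x a < pos x b → R a b) → u ≤ x := by
    intro x hx
    rw [weak_le_iff]
    intro a b hab h1
    rw [hu] at h1
    rcases h1 with h1 | h1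
    · exact absurd h1.1 hab.asymm
    · exact (pos_lt_or hab.ne).resolve_left fun h => h1.2 (.single (hx _ _ hab h))
  refine ⟨u, ?_, fun x hx => ?_⟩
  · simp only [mem_lowerBounds, Set.mem_insert_iff, Set.mem_singleton_iff, forall_eq_or_imp,
      forall_eq]
    exact ⟨hge v fun a b hab h => ⟨hab, Or.inl h⟩, hge w fun a b hab h => ⟨hab, Or.inr h⟩⟩
  · simp only [mem_lowerBounds, Set.mem_insert_iff, Set.mem_singleton_iff, forall_eq_or_imp,
      forall_eq] at hx
    exact hle x fun a b h => h.2.elim (noninv_of_le hx.1 h.1) (noninv_of_le hx.2 h.1)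

theorem exists_isLUB (v w : SignedPerm n) : ∃ u, IsLUB {v, w} u := by
  obtain ⟨u, hu⟩ := exists_isGLB (negP v) (negP w)
  refine ⟨negP u, ?_, fun x hx => ?_⟩
  · have h := hu.1
    simp only [mem_lowerBounds, mem_upperBounds, Set.mem_insert_iff, Set.mem_singleton_iff,
      forall_eq_or_imp, forall_eq] at h ⊢
    exact ⟨le_negP_iff.mpr h.1, le_negP_iff.mpr h.2⟩
  · simp only [mem_upperBounds, Set.mem_insert_iff, Set.mem_singleton_iff, forall_eq_or_imp,
      forall_eq] at hx
    rw [negP_le_iff]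
    apply hu.2
    simp only [mem_lowerBounds, Set.mem_insert_iff, Set.mem_singleton_iff, forall_eq_or_imp,
      forall_eq]
    exact ⟨negP_le_negP hx.1, negP_le_negP hx.2⟩

end SignedOrder

/-! ### Faces of regions -/

section Faces

variable {n : ℕ}

/-- `a` immediately precedes `b` in the full notation of `v`. -/
def Step (v : SignedPerm n) (a b : PM n) : Prop :=
  pos v a < pos v b ∧ ∀ c, pos v a < pos v c → pos v b ≤ pos v c

theorem Step.neg {v : SignedPerm n} {a b : PM n} (h : Step v a b) : Step v (-b) (-a) := by
  refine ⟨pos_lt_neg.mpr h.1, fun c hc => ?_⟩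
  by_contra h1
  have h2 : pos v a < pos v (-c) := by
    rw [← pos_lt_neg, PM.neg_neg]; exact not_le.mp h1
  have h3 := h.2 _ h2
  rw [← not_lt] at h3
  apply h3
  rw [← pos_lt_neg, PM.neg_neg]
  exact hc

theorem Step.unique {v : SignedPerm n} {c d k l : PM n} (hcd : Step v c d) (hkl : Step v k l)
    (h1 : pos v c ≤ pos v k) (h2 : pos v l ≤ pos v d) : k = c ∧ l = d := by
  have h3 : k = c := by
    by_contra h3
    have h4 : pos v c < pos v k := lt_of_le_of_ne h1 fun h => h3 (pos_injective v h.symm)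
    exact absurd (hcd.2 _ h4) (not_le.mpr (lt_of_lt_of_le hkl.1 h2))
  subst h3
  exact ⟨rfl, pos_injective v (le_antisymm h2 (hcd.2 _ hkl.1))⟩

theorem exists_step {v : SignedPerm n} {c d : PM n} (h : pos v c < pos v d) :
    ∃ b, Step v c b ∧ pos v b ≤ pos v d := by
  classical
  obtain ⟨b, hb, hmin⟩ := Finset.exists_min_image
    (Finset.univ.filter fun b => pos v c < pos v b) (pos v) ⟨d, by simp [h]⟩
  simp only [Finset.mem_filter, Finset.mem_univ, true_and] at hb hmin
  exact ⟨b, ⟨hb, hmin⟩, hmin d h⟩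

theorem step_chain {v : SignedPerm n} {c d : PM n} (h : pos v c < pos v d) :
    Relation.TransGen
      (fun k l => Step v k l ∧ pos v c ≤ pos v k ∧ pos v l ≤ pos v d) c d := by
  obtain ⟨i, hi⟩ : ∃ i, i = pos v c := ⟨_, rfl⟩
  induction i using (Finite.wellFounded_of_trans_of_irrefl (α := PM n) (· > ·)).induction
    generalizing c with
  | _ i ih =>
    subst hi
    obtain ⟨b, hb, hbd⟩ := exists_step h
    rcases hbd.eq_or_lt with h1 | h1
    · have := pos_injective v h1
      subst this
      exact .single ⟨hb, le_rfl, le_rfl⟩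
    · refine .head ⟨hb, le_rfl, hbd⟩ ?_
      refine Relation.TransGen.mono (fun k l hkl => ?_) _ _ (ih _ hb.1 h1 rfl)
      exact ⟨hkl.1, hb.1.le.trans hkl.2.1, hkl.2.2⟩

/-- `p` is a sum, over the steps outside `J`, of functions equal to 1 up to the step and to -1 after
it. Two coordinates therefore agree iff every step between them lies in `J`, and the symmetry of `J`
makes the sum odd. -/
theorem exists_facePoint (v : SignedPerm n) (J : PM n → PM n → Prop)
    (hJ : ∀ a b, J a b → J (-b) (-a)) :
    ∃ p : BSpace n, (∀ c d, pos v c < pos v d → p.1 d ≤ p.1 c) ∧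
      ∀ c d, pos v c < pos v d → (p.1 c = p.1 d ↔
        ∀ k l, Step v k l → pos v c ≤ pos v k → pos v l ≤ pos v d → J k l) := by
  classical
  let S : Finset (PM n × PM n) := Finset.univ.filter fun q => Step v q.1 q.2 ∧ ¬ J q.1 q.2
  let g : PM n → PM n × PM n → ℝ := fun c q => if pos v c ≤ pos v q.1 then 1 else -1
  have hS : ∀ q, q ∈ S ↔ Step v q.1 q.2 ∧ ¬ J q.1 q.2 := fun q => by simp [S]
  have hmono : ∀ c d, pos v c < pos v d → ∀ q, g d q ≤ g c q := by
    intro c d h q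
    simp only [g]
    split_ifs with h1 h2
    · exact le_rfl
    · exact absurd (h.le.trans h1) h2
    · norm_num
    · exact le_rfl
  refine ⟨⟨fun c => ∑ q ∈ S, g c q, fun c => ?_⟩, fun c d h => ?_, fun c d h => ?_⟩
  · rw [← Finset.sum_neg_distrib]
    refine Finset.sum_nbij' (fun q => (-q.2, -q.1)) (fun q => (-q.2, -q.1)) ?_ ?_ ?_ ?_ ?_
    · intro q hq
      rw [hS] at hq ⊢
      exact ⟨hq.1.neg, fun h => hq.2 (by simpa using hJ _ _ h)⟩
    · intro q hq
      rw [hS] at hq ⊢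
      exact ⟨hq.1.neg, fun h => hq.2 (by simpa using hJ _ _ h)⟩
    · intro q _; simp
    · intro q _; simp
    · intro q hq
      rw [hS] at hq
      have : pos v (-c) ≤ pos v q.1 ↔ ¬ pos v c ≤ pos v (-q.2) := by
        rw [← not_lt, not_iff_not, ← pos_lt_neg, PM.neg_neg]
        constructor
        · intro h
          by_contra h2
          have h3 := hq.1.neg.2 c (not_le.mp h2)
          exact absurd h (not_lt.mpr h3)
        · intro h
          exact lt_of_le_of_lt h hq.1.neg.1
      simp only [g]
      by_cases h : pos v c ≤ pos v (-q.2)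
      · have h1 := this.not.mpr (not_not.mpr h)
        simp [h, h1]
      · simp [h, this.mpr h]
  · exact Finset.sum_le_sum fun q _ => hmono c d h q
  · have h1 : (∑ q ∈ S, g c q = ∑ q ∈ S, g d q) ↔ ∀ q ∈ S, g c q = g d q := by
      rw [eq_comm, Finset.sum_eq_sum_iff_of_le fun q _ => hmono c d h q]
      simp only [eq_comm]
    change (∑ q ∈ S, g c q = ∑ q ∈ S, g d q) ↔ _
    rw [h1]
    constructor
    · intro h2 k l hkl h3 h4
      by_contra h5
      have := h2 (k, l) ((hS _).mpr ⟨hkl, h5⟩)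
      simp only [g, h3, if_true, if_neg (not_le.mpr (lt_of_lt_of_le hkl.1 h4))] at this
      norm_num at this
    · intro h2 q hq
      rw [hS] at hq
      simp only [g]
      by_cases h3 : pos v c ≤ pos v q.1
      · by_cases h4 : pos v d ≤ pos v q.1
        · simp [h3, h4]
        · exact absurd (h2 _ _ hq.1 h3 (hq.1.2 d (not_le.mp h4))) hq.2
      · have h4 : ¬ pos v d ≤ pos v q.1 := fun h5 => h3 (h.le.trans h5)
        simp [h3, h4]

/-- `p` lies on the wall `x_a = x_b` and on no other hyperplane. -/
def Wall (a b : PM n) (p : BSpace n) : Prop :=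
  b < a ∧ ∀ c d, p.1 c = p.1 d ↔ c = d ∨ (c = a ∧ d = b) ∨ (c = b ∧ d = a) ∨
    (c = -a ∧ d = -b) ∨ (c = -b ∧ d = -a)

theorem Wall.eq {a b : PM n} {p : BSpace n} (h : Wall a b p) : p.1 a = p.1 b :=
  (h.2 a b).mpr (by simp)

theorem Wall.swap {a b : PM n} {p : BSpace n} (h : Wall a b p) : Wall (-b) (-a) p := by
  refine ⟨PM.neg_lt_neg.mpr h.1, fun c d => ?_⟩
  rw [h.2]; simp only [PM.neg_neg]; tauto

theorem Wall.neg {a b : PM n} {p : BSpace n} (h : Wall a b p) : Wall a b (-p) := by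
  refine ⟨h.1, fun c d => ?_⟩
  rw [← h.2]
  simp

theorem refines_topP {v : SignedPerm n} {p : BSpace n} (h : v ≤ topP p) {c d : PM n}
    (hcd : d < c) (h1 : pos v c < pos v d) : p.1 d ≤ p.1 c := by
  have := weak_le_iff.mp h d c hcd h1
  rw [topP_lt] at this
  rcases this with h | h
  · exact h.le
  · exact h.1.ge

theorem refines_botP {v : SignedPerm n} {p : BSpace n} (h : botP p ≤ v) {c d : PM n}
    (hcd : c < d) (h1 : pos v c < pos v d) : p.1 d ≤ p.1 c := by
  have := noninv_of_le h hcd h1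
  rw [botP_lt] at this
  rcases this with h | h
  · exact h.le
  · exact h.1.ge

theorem refines {v : SignedPerm n} {p : BSpace n} (h : v ≤ topP p) (h' : botP p ≤ v) {c d : PM n}
    (h1 : pos v c < pos v d) : p.1 d ≤ p.1 c := by
  rcases lt_trichotomy c d with h2 | h2 | h2
  · exact refines_botP h' h2 h1
  · rw [h2]
  · exact refines_topP h h2 h1

theorem refines_lt {v : SignedPerm n} {p : BSpace n} (h : v ≤ topP p) (h' : botP p ≤ v) {c d : PM n}
    (h1 : p.1 d < p.1 c) : pos v c < pos v d := by
  rcases pos_lt_or (w := v) (a := c) (b := d) (by rintro rfl; exact lt_irrefl _ h1) with h2 | h2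
  · exact h2
  · exact absurd (refines h h' h2) (not_le.mpr h1)

theorem le_topP_of {v : SignedPerm n} {p : BSpace n}
    (h : ∀ c d, d < c → pos v c < pos v d → p.1 d ≤ p.1 c) : v ≤ topP p := by
  rw [weak_le_iff]
  intro a b hab h1
  rw [topP_lt]
  rcases (h b a hab h1).lt_or_eq with h2 | h2
  · exact Or.inl h2
  · exact Or.inr ⟨h2.symm, hab⟩

theorem botP_le_of {v : SignedPerm n} {p : BSpace n}
    (h : ∀ c d, c < d → pos v c < pos v d → p.1 d ≤ p.1 c) : botP p ≤ v := by
  rw [weak_le_iff]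
  intro a b hab h1
  rw [botP_lt] at h1
  rcases h1 with h1 | h1
  · rcases pos_lt_or (w := v) hab.ne with h2 | h2
    · exact absurd (h a b hab h2) (not_le.mpr h1)
    · exact h2
  · exact absurd h1.2 hab.asymm

theorem botP_le_topP (p : BSpace n) : botP p ≤ topP p := by
  apply botP_le_of
  intro c d hcd h
  rw [topP_lt] at h
  rcases h with h | h
  · exact h.le
  · exact h.1.ge

theorem Wall.botP_lt_topP {a b : PM n} {p : BSpace n} (h : Wall a b p) : botP p < topP p := by
  refine lt_of_le_of_ne (botP_le_topP p) fun h1 => ?_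
  have h2 : pos (topP p) a < pos (topP p) b := topP_lt.mpr (Or.inr ⟨h.eq, h.1⟩)
  rw [← h1, botP_lt] at h2
  rcases h2 with h2 | h2
  · exact h2.ne h.eq.symm
  · exact h2.2.asymm h.1

/-- An element below the top of a wall is below its bottom unless it is inverted at the wall. -/
theorem Wall.le_botP {a b : PM n} {p : BSpace n} (h : Wall a b p) {u : SignedPerm n}
    (hu : u ≤ topP p) (hab : pos u b < pos u a) : u ≤ botP p := by
  rw [weak_le_iff]
  intro c d hcd h1
  rw [botP_lt]
  have := refines_topP hu hcd h1
  rcases this.lt_or_eq with h2 | h2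
  · exact Or.inl h2
  · rw [h.2] at h2
    have h3 : pos u (-a) < pos u (-b) := pos_lt_neg.mpr hab
    have hba := h.1
    rcases h2 with rfl | ⟨rfl, rfl⟩ | ⟨rfl, rfl⟩ | ⟨rfl, rfl⟩ | ⟨rfl, rfl⟩
    · exact absurd hcd (lt_irrefl _)
    · exact absurd hcd hba.asymm
    · exact absurd h1 hab.asymm
    · exact absurd h1 h3.asymm
    · exact absurd (PM.neg_lt_neg.mp hcd) hba.asymm

theorem Wall.not_le_botP {a b : PM n} {p : BSpace n} (h : Wall a b p) {u : SignedPerm n}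
    (hab : pos u a < pos u b) : ¬ u ≤ botP p := by
  intro h1
  have := weak_le_iff.mp h1 b a h.1 hab
  rw [botP_lt] at this
  rcases this with h2 | h2
  · exact h2.ne h.eq.symm
  · exact h2.2.asymm h.1

theorem Wall.topP_le {a b : PM n} {p : BSpace n} (h : Wall a b p) {u : SignedPerm n}
    (hu : botP p ≤ u) (hab : pos u a < pos u b) : topP p ≤ u := by
  have h1 := h.neg.le_botP (u := negP u) (by rw [topP_neg]; exact negP_le_negP hu)
    (negP_lt.mpr hab)
  rw [botP_neg] at h1
  simpa [negP_negP] using negP_le_negP h1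

theorem exists_wall {v : SignedPerm n} {a b : PM n} (hs : Step v a b) (hab : b < a) :
    ∃ p, Wall a b p ∧ topP p = v := by
  obtain ⟨p, hp, hp'⟩ := exists_facePoint v (fun c d => (c = a ∧ d = b) ∨ (c = -b ∧ d = -a)) (by
    rintro c d (⟨rfl, rfl⟩ | ⟨rfl, rfl⟩) <;> simp)
  have key : ∀ c d, pos v c < pos v d →
      (p.1 c = p.1 d ↔ (c = a ∧ d = b) ∨ (c = -b ∧ d = -a)) := by
    intro c d hcd
    rw [hp' c d hcd]
    constructor
    · intro h
      obtain ⟨k, hk, hkd⟩ := exists_step hcd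
      rcases hkd.eq_or_lt with h1 | h1
      · have := pos_injective v h1
        subst this
        exact h _ _ hk le_rfl le_rfl
      -- Two consecutive steps cannot both be among a, b and -b, -a: no index equals its own
      -- negative, and a ≠ b.
      · exfalso
        obtain ⟨l, hl, hld⟩ := exists_step h1
        have h2 := h _ _ hk le_rfl hkd
        have h3 := h _ _ hl hk.1.le hld
        have := b.coe_ne_zero
        have := a.coe_ne_zero
        simp only [PM.eq_iff, PM.coe_neg, PM.lt_iff] at h2 h3 hab
        omega
    · rintro (⟨rfl, rfl⟩ | ⟨rfl, rfl⟩) k l hkl h1 h2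
      · exact Or.inl (hs.unique hkl h1 h2)
      · exact Or.inr (hs.neg.unique hkl h1 h2)
  have hw : Wall a b p := by
    refine ⟨hab, fun c d => ?_⟩
    by_cases hcd : c = d
    · simp [hcd]
    have hna : pos v (-b) < pos v (-a) := pos_lt_neg.mpr hs.1
    rcases pos_lt_or (w := v) hcd with h | h
    · rw [key c d h]
      constructor
      · tauto
      · rintro (h1 | h1 | ⟨rfl, rfl⟩ | ⟨rfl, rfl⟩ | h1)
        · exact absurd h1 hcd
        · exact Or.inl h1
        · exact absurd h hs.1.asymm
        · exact absurd h hna.asymm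
        · exact Or.inr h1
    · rw [eq_comm, key d c h]
      constructor
      · tauto
      · rintro (h1 | ⟨rfl, rfl⟩ | h1 | h1 | ⟨rfl, rfl⟩)
        · exact absurd h1 hcd
        · exact absurd h hs.1.asymm
        · exact Or.inl h1.symm
        · exact Or.inr h1.symm
        · exact absurd h hna.asymm
  refine ⟨p, hw, signedPerm_ext fun c d h => ?_⟩
  rw [topP_lt] at h
  rcases h with h | ⟨h, hdc⟩
  · rcases pos_lt_or (w := v) (a := c) (b := d) (by rintro rfl; exact lt_irrefl _ h) with h2 | h2
    · exact h2
    · exact absurd (hp _ _ h2) (not_le.mpr h)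
  · rw [hw.2] at h
    rcases h with rfl | ⟨rfl, rfl⟩ | ⟨rfl, rfl⟩ | ⟨rfl, rfl⟩ | ⟨rfl, rfl⟩
    · exact absurd hdc (lt_irrefl _)
    · exact hs.1
    · exact absurd hdc hab.asymm
    · exact absurd (PM.neg_lt_neg.mp hdc) hab.asymm
    · exact pos_lt_neg.mpr hs.1

/-- Otherwise u keeps every step of v in order: ascents because u ≤ v, descents by assumption and
`Wall.le_botP`. By transitivity u and v are then the same order. -/
theorem exists_lower_wall {u v : SignedPerm n} (h : u < v) :
    ∃ a b p, Wall a b p ∧ topP p = v ∧ u ≤ botP p := by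
  by_contra hcon
  push Not at hcon
  have hd : ∀ a b, Step v a b → pos u a < pos u b := by
    intro a b hs
    rcases lt_trichotomy a b with h1 | h1 | h1
    · exact noninv_of_le h.le h1 hs.1
    · subst h1; exact absurd hs.1 (lt_irrefl _)
    · obtain ⟨p, hp, hpv⟩ := exists_wall hs h1
      rcases pos_lt_or (w := u) h1.ne' with h2 | h2
      · exact h2
      · exact absurd (hp.le_botP (by rw [hpv]; exact h.le) h2) (hcon a b p hp hpv)
  apply h.ne'
  refine signedPerm_ext fun c d hcd => ?_
  have : Relation.TransGen (fun k l => pos u k < pos u l) c d :=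
    Relation.TransGen.mono (fun k l h => hd k l h.1) _ _ (step_chain hcd)
  clear hcd
  induction this with
  | single h => exact h
  | tail _ h ih => exact ih.trans h

end Faces

/-! ### Cones and connected components -/

section Cones

variable {V : Type*} [NormedAddCommGroup V] [NormedSpace ℝ V]

/-- A convex cone is not covered by finitely many subspaces none of which contains it. A subspace
meeting the ray x + εs for two values of ε would contain both x and s, so each one excludes at most
one value. -/
theorem exists_generic {C : Set V} (hne : C.Nonempty) (hadd : ∀ x ∈ C, ∀ y ∈ C, x + y ∈ C)
    (hsmul : ∀ x ∈ C, ∀ t : ℝ, 0 < t → t • x ∈ C) {𝒦 : Set (Submodule ℝ V)} (hfin : 𝒦.Finite)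
    (h : ∀ K ∈ 𝒦, ∃ s ∈ C, s ∉ K) : ∃ s ∈ C, ∀ K ∈ 𝒦, s ∉ K := by
  induction 𝒦, hfin using Set.Finite.induction_on with
  | empty => exact ⟨hne.choose, hne.choose_spec, by simp⟩
  | @insert K 𝒦 hK hfin ih =>
    obtain ⟨x, hx, hxK⟩ := ih fun K' hK' => h K' (Set.mem_insert_of_mem _ hK')
    obtain ⟨s, hs, hsK⟩ := h K (Set.mem_insert _ _)
    have hsub : ∀ K' ∈ insert K 𝒦, {ε : ℝ | x + ε • s ∈ K'}.Subsingleton := by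
      intro K' hK' ε hε δ hδ
      by_contra hne
      have h1 : (ε - δ) • s ∈ K' := by
        have := K'.sub_mem hε hδ
        simpa [sub_smul] using this
      have h2 : s ∈ K' := (K'.smul_mem_iff (sub_ne_zero.mpr hne)).mp h1
      have h3 : x ∈ K' := by
        have := K'.sub_mem hε (K'.smul_mem ε h2)
        simpa using this
      rcases Set.mem_insert_iff.mp hK' with rfl | h4
      · exact hsK h2
      · exact hxK K' h4 h3
    have hbad : (⋃ K' ∈ insert K 𝒦, {ε : ℝ | x + ε • s ∈ K'}).Finite :=
      (hfin.insert K).biUnion fun K' hK' => (hsub K' hK').finite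
    obtain ⟨ε, hε, hε'⟩ := ((Set.Ioi_infinite (0 : ℝ)).sdiff hbad).nonempty
    refine ⟨x + ε • s, hadd _ hx _ (hsmul _ hs _ hε), fun K' hK' h1 => hε' ?_⟩
    simp only [Set.mem_iUnion]
    exact ⟨K', hK', h1⟩

theorem le_span_of_perturb {W : Submodule ℝ V} {C : Set V} {p : V} (hp : p ∈ C)
    (h : ∀ u ∈ W, ∃ ε : ℝ, 0 < ε ∧ p + ε • u ∈ C) : W ≤ Submodule.span ℝ C := by
  intro u hu
  obtain ⟨ε, hε, h1⟩ := h u hu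
  have h2 := (Submodule.span ℝ C).sub_mem (Submodule.subset_span h1) (Submodule.subset_span hp)
  rw [add_sub_cancel_left] at h2
  exact ((Submodule.span ℝ C).smul_mem_iff hε.ne').mp h2

/-- This turns the dimension conditions of the definitions into inclusions of spans, which
`le_span_of_perturb` verifies by moving a single point. -/
theorem dim_add_eq_iff [FiniteDimensional ℝ V] {X : Set V} {H : Submodule ℝ V} {k : ℕ}
    (hH : Module.finrank ℝ H + k = Module.finrank ℝ V) (hX : X ⊆ H) :
    dim X + k = Module.finrank ℝ V ↔ H ≤ Submodule.span ℝ X := by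
  have hle : Submodule.span ℝ X ≤ H := Submodule.span_le.mpr hX
  rw [← hH, Nat.add_right_cancel_iff, dim]
  constructor
  · intro h
    exact (Submodule.eq_of_le_of_finrank_eq hle h).ge
  · intro h
    rw [le_antisymm hle h]

theorem finrank_inf_hyperplanes [FiniteDimensional ℝ V] {H₁ H₂ : Submodule ℝ V}
    (h₁ : Module.finrank ℝ H₁ + 1 = Module.finrank ℝ V)
    (h₂ : Module.finrank ℝ H₂ + 1 = Module.finrank ℝ V) (hne : H₁ ≠ H₂) :
    Module.finrank ℝ (H₁ ⊓ H₂ : Submodule ℝ V) + 2 = Module.finrank ℝ V := by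
  have h := Submodule.finrank_sup_add_finrank_inf_eq H₁ H₂
  have h3 : Module.finrank ℝ H₁ < Module.finrank ℝ (H₁ ⊔ H₂ : Submodule ℝ V) := by
    apply Submodule.finrank_lt_finrank_of_lt
    refine lt_of_le_of_ne le_sup_left fun h4 => hne ?_
    have h5 : H₂ ≤ H₁ := by rw [h4]; exact le_sup_right
    exact (Submodule.eq_of_le_of_finrank_eq h5 (by omega)).symm
  have h4 := Submodule.finrank_le (H₁ ⊔ H₂)
  omega

/-- By the intermediate value theorem a nonvanishing function keeps its sign on a component; a
connected sign cell is then the whole component. -/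
theorem connectedComponentIn_eq_signs {E ι : Type*} [TopologicalSpace E] {S : Set E}
    (f : ι → E → ℝ) (hf : ∀ i, Continuous (f i)) (hS : ∀ y ∈ S, ∀ i, f i y ≠ 0) {x : E}
    (hx : x ∈ S) (hC : IsPreconnected {y ∈ S | ∀ i, 0 < f i x * f i y}) :
    connectedComponentIn S x = {y ∈ S | ∀ i, 0 < f i x * f i y} := by
  apply Set.Subset.antisymm
  · intro y hy
    have hsub := connectedComponentIn_subset S x
    refine ⟨hsub hy, fun i => ?_⟩
    have hpre : IsPreconnected (connectedComponentIn S x) := isPreconnected_connectedComponentIn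
    have hxc := mem_connectedComponentIn hx
    have hzero : (0 : ℝ) ∉ f i '' connectedComponentIn S x := by
      rintro ⟨z, hz, hz0⟩
      exact hS z (hsub hz) i hz0
    have hy0 := hS y (hsub hy) i
    rcases lt_or_gt_of_ne (hS x hx i) with h1 | h1
    · refine mul_pos_of_neg_of_neg h1 (lt_of_not_ge fun h2 => hzero ?_)
      exact hpre.intermediate_value hxc hy (hf i).continuousOn ⟨h1.le, h2⟩
    · refine mul_pos h1 (lt_of_not_ge fun h2 => hzero ?_)
      exact hpre.intermediate_value hy hxc (hf i).continuousOn ⟨h2, h1.le⟩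
  · refine hC.subset_connectedComponentIn ⟨hx, fun i => ?_⟩ fun y hy => hy.1
    exact mul_self_pos.mpr (hS x hx i)

/-- Each point y of `D` is the limit of y + t x in `C` as t tends to 0 from above. -/
theorem closure_eq_of_perturb {C D : Set V} (hD : IsClosed D) (hCD : C ⊆ D) (x : V)
    (h : ∀ y ∈ D, ∀ t : ℝ, 0 < t → y + t • x ∈ C) : closure C = D := by
  apply Set.Subset.antisymm (closure_minimal hCD hD)
  intro y hy
  have h1 : Filter.Tendsto (fun t : ℝ => y + t • x) (𝓝[>] 0) (𝓝 y) := by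
    have : Continuous fun t : ℝ => y + t • x := by fun_prop
    have h2 := this.tendsto 0
    simp only [zero_smul, add_zero] at h2
    exact h2.mono_left nhdsWithin_le_nhds
  refine mem_closure_of_tendsto h1 ?_
  filter_upwards [self_mem_nhdsWithin] with t ht
  exact h y hy t ht

end Cones

/-! ### The hyperplanes of the Coxeter arrangement of type `B_n` -/

section Hyperplanes

variable {n : ℕ}

theorem mem_hyp {a b : PM n} {x : BSpace n} : x ∈ hyp a b ↔ x.1 a = x.1 b := Iff.rfl

/-- The functional `x ↦ x_a - x_b`. -/
def diff (a b : PM n) : BSpace n →ₗ[ℝ] ℝ where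
  toFun x := x.1 a - x.1 b
  map_add' x y := by simp; ring
  map_smul' t x := by simp; ring

@[simp] theorem diff_apply (a b : PM n) (x : BSpace n) : diff a b x = x.1 a - x.1 b := rfl

theorem continuous_coord (a : PM n) : Continuous fun x : BSpace n => x.1 a :=
  (continuous_apply a).comp continuous_subtype_val

theorem ker_diff (a b : PM n) : LinearMap.ker (diff a b) = hyp a b := by
  ext x
  rw [LinearMap.mem_ker, diff_apply, sub_eq_zero, mem_hyp]

/-- The vector with coordinates `1` at `s` and `-1` at `-s`. -/
noncomputable def ind (s : Set (PM n)) : BSpace n :=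
  ⟨fun c => s.indicator 1 c - s.indicator 1 (-c), fun c => by
    change s.indicator 1 (-c) - s.indicator 1 (- -c) = -(s.indicator 1 c - s.indicator 1 (-c))
    rw [PM.neg_neg, neg_sub]⟩

theorem ind_apply (s : Set (PM n)) (c : PM n) [Decidable (c ∈ s)] [Decidable (-c ∈ s)] :
    (ind s).1 c = (if c ∈ s then 1 else 0) - (if -c ∈ s then 1 else 0) := by
  simp [ind, Set.indicator_apply]

theorem hyp_comm (a b : PM n) : hyp a b = hyp b a := by
  ext x; rw [mem_hyp, mem_hyp, eq_comm]

theorem hyp_neg (a b : PM n) : hyp (-a) (-b) = hyp a b := by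
  ext x; rw [mem_hyp, mem_hyp, coord_neg, coord_neg, _root_.neg_inj]

/-- The test vectors `ind {c}`, `ind {d}` and `ind {a, b}` already distinguish the hyperplanes; the
case a = -b, where the hyperplane is x_a = 0, behaves differently. -/
theorem hyp_le_hyp {a b c d : PM n} (hcd : c ≠ d) (h : hyp a b ≤ hyp c d) :
    (c = a ∧ d = b) ∨ (c = b ∧ d = a) ∨ (c = -a ∧ d = -b) ∨ (c = -b ∧ d = -a) := by
  classical
  have key : ∀ s : Set (PM n), (ind s).1 a = (ind s).1 b → (ind s).1 c = (ind s).1 d :=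
    fun s h1 => h h1
  simp only [ind_apply] at key
  have h1 := key {c}
  have h2 := key {d}
  have h3 := key {a, b}
  simp only [Set.mem_singleton_iff, Set.mem_insert_iff] at h1 h2 h3
  have ha := a.neg_ne_self
  have hb := b.neg_ne_self
  have hc := c.neg_ne_self
  have hd := d.neg_ne_self
  by_cases hab : a = -b
  · subst hab
    simp only [PM.neg_neg] at *
    grind [PM.neg_neg]
  · grind [PM.neg_neg]

theorem hyp_lt_iff {a b c d : PM n} (hab : b < a) (hcd : d < c) :
    hyp a b = hyp c d ↔ (c = a ∧ d = b) ∨ (c = -b ∧ d = -a) := by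
  constructor
  · intro h
    have := hyp_le_hyp hcd.ne' h.le
    simp only [PM.eq_iff, PM.lt_iff, PM.coe_neg] at *
    omega
  · rintro (⟨rfl, rfl⟩ | ⟨rfl, rfl⟩)
    · rfl
    · rw [hyp_neg, hyp_comm]

theorem hyp_swap (a b : PM n) : hyp (-b) (-a) = hyp a b := by rw [hyp_neg, hyp_comm]

theorem finrank_hyp {a b : PM n} (hab : a ≠ b) :
    Module.finrank ℝ (hyp a b) + 1 = Module.finrank ℝ (BSpace n) := by
  rw [← ker_diff]
  apply Module.Dual.finrank_ker_add_one_of_ne_zero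
  intro h
  have h1 : diff a b (ind {a}) = 0 := by rw [h]; rfl
  classical
  have ha := a.neg_ne_self
  have : -b ≠ a → True := fun _ => trivial
  simp only [diff_apply, ind_apply, Set.mem_singleton_iff, if_true, if_neg ha, if_neg hab.symm] at h1
  split_ifs at h1 <;> norm_num at h1

theorem finrank_inf_hyp {a b c d : PM n} (hab : a ≠ b) (hcd : c ≠ d) (h : hyp a b ≠ hyp c d) :
    Module.finrank ℝ (hyp a b ⊓ hyp c d : Submodule ℝ (BSpace n)) + 2 =
      Module.finrank ℝ (BSpace n) :=
  finrank_inf_hyperplanes (finrank_hyp hab) (finrank_hyp hcd) h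

theorem eventually_perturb (p u : BSpace n) : ∃ ε : ℝ, 0 < ε ∧
    ∀ a b, p.1 a < p.1 b → (p + ε • u).1 a < (p + ε • u).1 b := by
  have h : ∀ᶠ ε : ℝ in 𝓝[>] 0, ∀ a b, p.1 a < p.1 b → (p + ε • u).1 a < (p + ε • u).1 b := by
    refine Filter.eventually_all.mpr fun a => Filter.eventually_all.mpr fun b => ?_
    by_cases hab : p.1 a < p.1 b
    · have hc : ∀ c, Filter.Tendsto (fun ε : ℝ => (p + ε • u).1 c) (𝓝[>] 0) (𝓝 (p.1 c)) := by
        intro c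
        have : Continuous fun ε : ℝ => p.1 c + ε * u.1 c := by fun_prop
        have h2 := this.tendsto 0
        simp only [zero_mul, add_zero] at h2
        exact h2.mono_left nhdsWithin_le_nhds
      filter_upwards [(hc a).eventually_lt (hc b) hab] with ε hε _ using hε
    · exact Filter.Eventually.of_forall fun ε h => absurd h hab
  obtain ⟨ε, hε, h1⟩ := (h.and self_mem_nhdsWithin).exists
  exact ⟨ε, h1, hε⟩

theorem add_coord (x y : BSpace n) (a : PM n) : (x + y).1 a = x.1 a + y.1 a := rfl

theorem smul_coord (t : ℝ) (x : BSpace n) (a : PM n) : (t • x).1 a = t * x.1 a := rfl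

theorem neg_coord (x : BSpace n) (a : PM n) : (-x).1 a = -x.1 a := rfl

/-- This produces points whose only ties are those forced by W. -/
theorem exists_generic_hyp {C : Set (BSpace n)} (h0 : 0 ∈ C) (hadd : ∀ x ∈ C, ∀ y ∈ C, x + y ∈ C)
    (hsmul : ∀ x ∈ C, ∀ t : ℝ, 0 < t → t • x ∈ C) {W : Submodule ℝ (BSpace n)}
    (hW : W ≤ Submodule.span ℝ C) :
    ∃ p ∈ C, ∀ c d, p.1 c = p.1 d → W ≤ hyp c d := by
  obtain ⟨p, hpC, hp⟩ := exists_generic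
    (𝒦 := {K | K ∈ Set.range (fun q : PM n × PM n => hyp q.1 q.2) ∧ ¬ W ≤ K}) ⟨0, h0⟩ hadd hsmul
    ((Set.finite_range _).subset fun K hK => hK.1) (by
      rintro K ⟨-, hK⟩
      by_contra hcon
      push Not at hcon
      exact hK (hW.trans (Submodule.span_le.mpr hcon)))
  refine ⟨p, hpC, fun c d h => ?_⟩
  by_contra h1
  exact hp _ ⟨⟨(c, d), rfl⟩, h1⟩ h

/-- A vector in the interior of the base region. -/
noncomputable def rho : BSpace n := ⟨fun a => -(a.1 : ℝ), fun a => by simp⟩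

theorem rho_lt {a b : PM n} : (rho : BSpace n).1 a < (rho : BSpace n).1 b ↔ b < a := by
  simp only [rho, neg_lt_neg_iff, Int.cast_lt]; rfl

/-- A vector in the interior of the region of `w`. -/
noncomputable def vec (w : SignedPerm n) : BSpace n :=
  ⟨fun a => -((pos w a).1 : ℝ), fun a => by simp [pos_neg]⟩

theorem vec_lt {w : SignedPerm n} {a b : PM n} :
    (vec w).1 a < (vec w).1 b ↔ pos w b < pos w a := by
  simp only [vec, neg_lt_neg_iff, Int.cast_lt]; rfl

end Hyperplanes

/-! ### Regions -/

section Regions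

variable {n : ℕ}

theorem hyp_mem_arrB {a b : PM n} (h : a ≠ b) : hyp a b ∈ arrB n := by
  rcases lt_or_gt_of_ne h with h | h
  · exact ⟨b, a, h, hyp_comm a b⟩
  · exact ⟨a, b, h, rfl⟩

theorem isClosed_setOf_le (r : PM n → PM n → Prop) :
    IsClosed {y : BSpace n | ∀ a b, r a b → y.1 a ≤ y.1 b} := by
  simp only [Set.ofPred_forall]
  exact isClosed_iInter fun a => isClosed_iInter fun b => isClosed_iInter fun _ =>
    isClosed_le (continuous_coord a) (continuous_coord b)

/-- The component of x is the convex set of points with the same signs as x. Its closure relaxes the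
inequalities, because adding a positive multiple of x makes them strict again. -/
theorem isRegion_iff {𝒜 : Set (Submodule ℝ (BSpace n))} (h𝒜 : 𝒜 ⊆ arrB n) {R : Set (BSpace n)} :
    IsRegion 𝒜 R ↔ ∃ x ∈ arrCompl 𝒜,
      R = {y | ∀ a b, hyp a b ∈ 𝒜 ∧ x.1 a < x.1 b → y.1 a ≤ y.1 b} := by
  suffices h : ∀ x ∈ arrCompl 𝒜, closure (connectedComponentIn (arrCompl 𝒜) x) =
      {y | ∀ a b, hyp a b ∈ 𝒜 ∧ x.1 a < x.1 b → y.1 a ≤ y.1 b} by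
    constructor
    · rintro ⟨x, hx, rfl⟩
      exact ⟨x, hx, h x hx⟩
    · rintro ⟨x, hx, rfl⟩
      exact ⟨x, hx, (h x hx).symm⟩
  intro x hx
  let f : {q : PM n × PM n // hyp q.1 q.2 ∈ 𝒜} → BSpace n → ℝ := fun q => diff q.1.1 q.1.2
  have hmem : ∀ y : BSpace n, y ∈ arrCompl 𝒜 ↔ ∀ i, f i y ≠ 0 := by
    intro y
    constructor
    · intro hy i h
      exact hy _ i.2 (sub_eq_zero.mp h)
    · intro hy H hH hyH
      obtain ⟨a, b, _, rfl⟩ := h𝒜 hH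
      exact hy ⟨(a, b), hH⟩ (sub_eq_zero.mpr hyH)
  have hset : {y ∈ arrCompl 𝒜 | ∀ i, 0 < f i x * f i y} = {y | ∀ i, 0 < f i x * f i y} := by
    ext y
    simp only [Set.mem_ofPred_eq, and_iff_right_iff_imp, hmem]
    intro h i h0
    have := h i
    rw [h0, mul_zero] at this
    exact lt_irrefl _ this
  have hconv : Convex ℝ {y : BSpace n | ∀ i, 0 < f i x * f i y} := by
    simp only [Set.ofPred_forall]
    refine convex_iInter fun i => ?_
    exact convex_halfSpace_gt (f := fun y => f i x * f i y)
      ((f i x) • (diff i.1.1 i.1.2)).isLinear 0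
  rw [connectedComponentIn_eq_signs f (fun i => by
      exact (continuous_coord _).sub (continuous_coord _)) (fun y hy => (hmem y).mp hy) hx
      (by rw [hset]; exact hconv.isPreconnected), hset]
  refine closure_eq_of_perturb (isClosed_setOf_le _) ?_ x ?_
  · rintro y hy a b ⟨hab, hlt⟩
    have := hy ⟨(a, b), hab⟩
    simp only [f, diff_apply] at this
    nlinarith
  · rintro y hy t ht ⟨⟨a, b⟩, hab⟩
    have h0 := (hmem x).mp hx ⟨(a, b), hab⟩
    simp only [f, diff_apply, add_coord, smul_coord] at h0 ⊢
    have hab' : hyp b a ∈ 𝒜 := by rw [hyp_comm]; exact hab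
    rcases lt_or_gt_of_ne h0 with h1 | h1
    · have h2 := hy a b ⟨hab, by simpa using h1⟩
      exact mul_pos_of_neg_of_neg h1 (by nlinarith)
    · have h2 := hy b a ⟨hab', by simpa using h1⟩
      exact mul_pos h1 (by nlinarith)

theorem mem_regionB {w : SignedPerm n} {x : BSpace n} :
    x ∈ regionB w ↔ ∀ a b, pos w a < pos w b → x.1 b ≤ x.1 a := by
  constructor
  · intro h a b hab
    simpa [apply_pos] using h _ _ hab
  · intro h i j hij
    exact h _ _ (by simpa [pos_apply] using hij)

theorem isRegion_arrB {R : Set (BSpace n)} : IsRegion (arrB n) R ↔ ∃ w, R = regionB w := by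
  rw [isRegion_iff subset_rfl]
  have key : ∀ (x : BSpace n) w, (∀ a b, x.1 a < x.1 b ↔ pos w b < pos w a) →
      {y : BSpace n | ∀ a b, hyp a b ∈ arrB n ∧ x.1 a < x.1 b → y.1 a ≤ y.1 b} = regionB w := by
    intro x w h
    ext y
    rw [mem_regionB]
    constructor
    · intro hy a b hab
      refine hy b a ⟨hyp_mem_arrB ?_, (h b a).mpr hab⟩
      rintro rfl; exact lt_irrefl _ hab
    · rintro hy a b ⟨_, hab⟩
      exact hy b a ((h a b).mp hab)
  constructor
  · rintro ⟨x, hx, rfl⟩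
    refine ⟨topP x, key x _ fun a b => ?_⟩
    rw [topP_lt]
    constructor
    · exact Or.inl
    · rintro (h | ⟨h, h1⟩)
      · exact h
      · exact absurd (mem_hyp.mpr h) (hx _ (hyp_mem_arrB h1.ne'))
  · rintro ⟨w, rfl⟩
    refine ⟨vec w, ?_, (key _ w fun a b => vec_lt).symm⟩
    rintro H ⟨a, b, hab, rfl⟩ h
    rw [mem_hyp] at h
    rcases pos_lt_or (w := w) hab.ne with h1 | h1
    · exact (vec_lt.mpr h1).ne h
    · exact (vec_lt.mpr h1).ne' h

theorem lt_of_mem_interior {w : SignedPerm n} {x : BSpace n} (hx : x ∈ interior (regionB w))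
    {a b : PM n} (hab : pos w a < pos w b) : x.1 b < x.1 a := by
  have h1 : Filter.Tendsto (fun t : ℝ => x + t • -vec w) (𝓝[>] 0) (𝓝 x) := by
    have : Continuous fun t : ℝ => x + t • -vec w := by fun_prop
    have h2 := this.tendsto 0
    simp only [zero_smul, add_zero] at h2
    exact h2.mono_left nhdsWithin_le_nhds
  have h2 := h1.eventually (mem_interior_iff_mem_nhds.mp hx)
  obtain ⟨t, h3, ht⟩ := (h2.and self_mem_nhdsWithin).exists
  have h4 := mem_regionB.mp h3 a b hab
  simp only [add_coord, smul_coord, neg_coord] at h4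
  have h5 := vec_lt.mpr hab
  have h6 : (0 : ℝ) < t := ht
  nlinarith

theorem vec_mem_interior (w : SignedPerm n) : vec w ∈ interior (regionB w) := by
  have h1 : IsOpen {y : BSpace n | ∀ a b, pos w a < pos w b → y.1 b < y.1 a} := by
    simp only [Set.ofPred_forall]
    exact isOpen_iInter_of_finite fun a => isOpen_iInter_of_finite fun b =>
      isOpen_iInter_of_finite fun _ => isOpen_lt (continuous_coord b) (continuous_coord a)
  refine mem_interior.mpr ⟨_, fun y hy => ?_, h1, fun a b hab => vec_lt.mpr hab⟩
  exact mem_regionB.mpr fun a b hab => (hy a b hab).le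

theorem regionB_injective : Function.Injective (regionB (n := n)) := by
  intro v w h
  refine signedPerm_ext fun a b hab => ?_
  have h1 := vec_mem_interior w
  rw [← h] at h1
  exact vec_lt.mp (lt_of_mem_interior h1 hab)

theorem pos_botP_zero {a b : PM n} : pos (botP (0 : BSpace n)) a < pos (botP 0) b ↔ a < b := by
  rw [botP_lt]; simp

theorem baseB_eq : baseB n = regionB (botP 0) := by
  ext x
  rw [mem_regionB]
  simp only [pos_botP_zero]
  exact ⟨fun h a b hab => h b a hab, fun h a b hab => h b a hab⟩

theorem hyp_mem_sepSet {w : SignedPerm n} {a b : PM n} (hab : b < a) :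
    hyp a b ∈ sepSet (arrB n) (baseB n) (regionB w) ↔ pos w a < pos w b := by
  rw [baseB_eq]
  constructor
  · rintro ⟨_, f, hf, h1, h2⟩
    by_contra hcon
    have h3 := (pos_lt_or hab.ne).resolve_right hcon
    have h4 := h1 _ (vec_mem_interior _)
    have h5 := h2 _ (vec_mem_interior _)
    set x := vec (botP (0 : BSpace n))
    set y := vec w
    have h6 : x.1 a < x.1 b := vec_lt.mpr (pos_botP_zero.mpr hab)
    have h7 : y.1 a < y.1 b := vec_lt.mpr h3
    -- This combination is killed by f, so its coordinates at a and b must agree; but x and y both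
    -- have their a-coordinate below their b-coordinate, and both coefficients are positive.
    have h8 : f y • x - f x • y ∈ hyp a b := by
      rw [← hf, LinearMap.mem_ker, map_sub, map_smul, map_smul, smul_eq_mul, smul_eq_mul]
      ring
    rw [sub_eq_add_neg, mem_hyp, add_coord, add_coord, neg_coord, neg_coord, smul_coord,
      smul_coord, smul_coord, smul_coord] at h8
    nlinarith
  · intro h
    refine ⟨hyp_mem_arrB hab.ne', diff a b, ker_diff a b, fun x hx => ?_, fun x hx => ?_⟩
    · have := lt_of_mem_interior hx (pos_botP_zero.mpr hab)
      rw [diff_apply]; linarith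
    · have := lt_of_mem_interior hx h
      rw [diff_apply]; linarith

theorem sepSet_subset_iff {v w : SignedPerm n} :
    sepSet (arrB n) (baseB n) (regionB v) ⊆ sepSet (arrB n) (baseB n) (regionB w) ↔ v ≤ w := by
  rw [weak_le_iff]
  constructor
  · intro h a b hab h1
    exact (hyp_mem_sepSet hab).mp (h ((hyp_mem_sepSet hab).mpr h1))
  · rintro h H hH
    obtain ⟨a, b, hab, rfl⟩ := hH.1
    rw [hyp_mem_sepSet hab] at hH ⊢
    exact h _ _ hab hH

end Regions

/-! ### Basic hyperplanes and shards -/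

section Basic

variable {n : ℕ}

/-- The averages of `rho` and its reflection lie on no hyperplane containing two points of an
interval between `b` and `a`. -/
theorem exists_basicPoint {U : Submodule ℝ (BSpace n)} {a b : PM n} (hab : b < a)
    (hU : U ≤ hyp a b) (h : ∀ c, b < c → c < a → ¬ U ≤ hyp a c) :
    ∃ p : BSpace n, p.1 a = p.1 b ∧
      ∀ c d, d < c → U ≤ hyp c d → hyp c d ≠ hyp a b → p.1 c < p.1 d := by
  let τ : PM n → PM n := fun c =>
    if c = a then b else if c = b then a else if c = -a then -b else if c = -b then -a else c
  have hτ : ∀ c, (c = a ∧ τ c = b) ∨ (c = b ∧ τ c = a) ∨ (c = -a ∧ τ c = -b) ∨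
      (c = -b ∧ τ c = -a) ∨ (c ≠ a ∧ c ≠ b ∧ c ≠ -a ∧ c ≠ -b ∧ τ c = c) := by
    intro c; simp only [τ]; split_ifs <;> simp_all
  have hτa : τ a = b := by simp [τ]
  have hτb : τ b = a := by simp [τ, hab.ne]
  clear_value τ
  have hneg : ∀ c, τ (-c) = -τ c := by
    intro c
    have h1 := hτ c
    have h2 := hτ (-c)
    clear hτ hτa hτb h hU
    generalize τ c = tc at *
    generalize τ (-c) = tc' at *
    have ha := a.coe_ne_zero
    have hb := b.coe_ne_zero
    simp only [PM.eq_iff, PM.lt_iff, PM.coe_neg, ne_eq] at *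
    omega
  refine ⟨⟨fun c => -((c.1 + (τ c).1 : ℤ) : ℝ), fun c => ?_⟩, ?_, ?_⟩
  · change -(((-c : PM n).1 + (τ (-c)).1 : ℤ) : ℝ) = - -((c.1 + (τ c).1 : ℤ) : ℝ)
    rw [hneg]; simp; ring
  · simp only [hτa, hτb, add_comm]
  · intro c d hdc hUcd hne
    have hsw : ∀ {e f}, U ≤ hyp e f → U ≤ hyp (-f) (-e) := fun {e f} he => by rwa [hyp_swap]
    have hcm : ∀ {e f}, U ≤ hyp e f → U ≤ hyp f e := fun {e f} he => by rwa [hyp_comm]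
    have htr : ∀ {e f g}, U ≤ hyp e f → U ≤ hyp f g → U ≤ hyp e g := by
      intro e f g h1 h2 x hx
      exact (mem_hyp.mp (h1 hx)).trans (mem_hyp.mp (h2 hx))
    -- The inequality c + τ c > d + τ d can fail only if one of c, d is an endpoint of (b, a) or of
    -- (-a, -b) and the other lies strictly inside that interval. The following four facts exclude
    -- this.
    have h1 : c = a → ¬ (b < d ∧ d < a) := by
      rintro rfl ⟨h1, h2⟩; exact h d h1 h2 hUcd
    have h2 : d = b → ¬ (b < c ∧ c < a) := by
      rintro rfl ⟨h1, h2⟩; exact h c h1 h2 (htr hU (hcm hUcd))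
    have h3 : c = -b → ¬ (b < -d ∧ -d < a) := by
      rintro rfl ⟨h1, h2⟩
      have h3 := hcm (hsw hUcd)
      rw [PM.neg_neg] at h3
      exact h _ h1 h2 (htr hU h3)
    have h4 : d = -a → ¬ (b < -c ∧ -c < a) := by
      rintro rfl ⟨h1, h2⟩
      have h3 := hsw hUcd
      rw [PM.neg_neg] at h3
      exact h _ h1 h2 h3
    have h5 : ¬ ((c = a ∧ d = b) ∨ (c = -b ∧ d = -a)) := fun h5 =>
      hne ((hyp_lt_iff hab hdc).mpr h5).symm
    have h6 := hτ c
    have h7 := hτ d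
    have : d.1 + (τ d).1 < c.1 + (τ c).1 := by
      clear h hne hUcd hU hsw hcm htr hneg hτ
      generalize τ c = tc at *
      generalize τ d = td at *
      simp only [PM.eq_iff, PM.coe_neg, PM.lt_iff, ne_eq] at *
      omega
    exact neg_lt_neg (Int.cast_lt.mpr this)

/-- If x_a = x_c contains U for some b < c < a, the region around B satisfies x_a ≤ x_c ≤ x_b, so
its part in x_a = x_b lies in x_a = x_c as well and is too small. Otherwise the point of
`exists_basicPoint` is strictly inside all other hyperplanes and can be moved freely in x_a = x_b.
-/
theorem isBasic_iff {U : Submodule ℝ (BSpace n)} {a b : PM n} (hab : b < a) (hU : U ≤ hyp a b) :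
    IsBasic {H ∈ arrB n | U ≤ H} (baseB n) (hyp a b) ↔ ∀ c, b < c → c < a → ¬ U ≤ hyp a c := by
  set 𝒜 : Set (Submodule ℝ (BSpace n)) := {H ∈ arrB n | U ≤ H} with h𝒜
  have hsub : 𝒜 ⊆ arrB n := fun H hH => hH.1
  have hmem : ∀ {c d : PM n}, c ≠ d → (hyp c d ∈ 𝒜 ↔ U ≤ hyp c d) := fun hcd =>
    ⟨fun h => h.2, fun h => ⟨hyp_mem_arrB hcd, h⟩⟩
  constructor
  · rintro ⟨-, B', hB', hBB', hdim⟩ c hbc hca hUc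
    obtain ⟨x, hx, rfl⟩ := (isRegion_iff hsub).mp hB'
    have hlt : ∀ c d, d < c → U ≤ hyp c d → x.1 c < x.1 d := by
      intro c d hdc hcd
      have h1 : hyp d c ∈ 𝒜 := by rw [hyp_comm]; exact (hmem hdc.ne').mpr hcd
      rcases lt_trichotomy (x.1 c) (x.1 d) with h | h | h
      · exact h
      · exact absurd (mem_hyp.mpr h.symm) (hx _ h1)
      · have h2 : (rho : BSpace n) ∈ baseB n := fun a b hab => (rho_lt.mpr hab).le
        exact absurd (hBB' h2 d c ⟨h1, h⟩) (not_le.mpr (rho_lt.mpr hdc))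
    have hUc' : U ≤ hyp c b := fun y hy => (mem_hyp.mp (hUc hy)).symm.trans (mem_hyp.mp (hU hy))
    rw [dim_add_eq_iff (finrank_hyp hab.ne') Set.inter_subset_right] at hdim
    have h1 : hyp a b ≤ hyp a c := by
      refine hdim.trans (Submodule.span_le.mpr ?_)
      rintro y ⟨hy, hyab⟩
      have h2 := hy a c ⟨(hmem hca.ne').mpr hUc, hlt _ _ hca hUc⟩
      have h3 := hy c b ⟨(hmem hbc.ne').mpr hUc', hlt _ _ hbc hUc'⟩
      have h4 : y.1 a = y.1 b := hyab
      exact le_antisymm h2 (h3.trans h4.ge)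
    have h2 := hyp_le_hyp hca.ne' h1
    simp only [PM.eq_iff, PM.lt_iff, PM.coe_neg] at *
    omega
  · intro h
    obtain ⟨p, hp, hp'⟩ := exists_basicPoint hab hU h
    have hle : ∀ c d, hyp c d ∈ 𝒜 ∧ (rho : BSpace n).1 c < (rho : BSpace n).1 d →
        d < c ∧ U ≤ hyp c d := fun c d h1 => ⟨rho_lt.mp h1.2, h1.1.2⟩
    refine ⟨(hmem hab.ne').mpr hU, _, (isRegion_iff hsub).mpr ⟨rho, ?_, rfl⟩, ?_, ?_⟩
    · rintro H ⟨⟨c, d, hcd, rfl⟩, _⟩ h1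
      exact (rho_lt.mpr hcd).ne h1
    · intro y hy c d h1
      exact hy c d (hle c d h1).1
    · rw [dim_add_eq_iff (finrank_hyp hab.ne') Set.inter_subset_right]
      refine le_span_of_perturb (p := p) ⟨fun c d h1 => ?_, hp⟩ fun u hu => ?_
      · by_cases h2 : hyp c d = hyp a b
        · have h3 : p ∈ hyp c d := by rw [h2]; exact hp
          exact h3.le
        · exact (hp' c d (hle c d h1).1 (hle c d h1).2 h2).le
      · obtain ⟨ε, hε, h1⟩ := eventually_perturb p u
        refine ⟨ε, hε, fun c d h2 => ?_, (hyp a b).add_mem hp ((hyp a b).smul_mem ε hu)⟩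
        by_cases h3 : hyp c d = hyp a b
        · have h4 : p + ε • u ∈ hyp c d := by
            rw [h3]; exact (hyp a b).add_mem hp ((hyp a b).smul_mem ε hu)
          exact h4.le
        · exact (h1 c d (hp' c d (hle c d h2).1 (hle c d h2).2 h3)).le

theorem cutHyperplane_hyp {a b : PM n} (hab : b < a) : cutHyperplane (arrB n) (baseB n) (hyp a b) =
    {x | x.1 a = x.1 b ∧ ∀ c, b < c → c < a → x.1 c ≠ x.1 a} := by
  ext x
  have hnle : ∀ {c}, b < c → c < a → hyp a b ≠ hyp a c := by
    intro c hbc hca h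
    have := hyp_le_hyp hca.ne' h.le
    simp only [PM.eq_iff, PM.lt_iff, PM.coe_neg] at *
    omega
  constructor
  · rintro ⟨h1, h2⟩
    refine ⟨h1, fun c hbc hca hxc => ?_⟩
    set U := hyp a b ⊓ hyp a c with hU
    refine h2 {H ∈ arrB n | U ≤ H} ⟨⟨U, finrank_inf_hyp hab.ne' hca.ne' (hnle hbc hca), rfl⟩,
      ⟨hyp a b, ⟨hyp_mem_arrB hab.ne', inf_le_left⟩, hyp a c, ⟨hyp_mem_arrB hca.ne', inf_le_right⟩,
        hnle hbc hca⟩⟩ ⟨hyp_mem_arrB hab.ne', inf_le_left⟩ ?_ ?_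
    · rw [isBasic_iff hab inf_le_left]
      push Not
      exact ⟨c, hbc, hca, inf_le_right⟩
    · rw [Submodule.mem_sInf]
      rintro H ⟨_, hH⟩
      exact hH ⟨h1, hxc.symm⟩
  · rintro ⟨h1, h2⟩
    refine ⟨h1, ?_⟩
    rintro 𝒜' ⟨⟨U, hfr, rfl⟩, _⟩ hH hnb hx
    rw [isBasic_iff hab hH.2] at hnb
    push Not at hnb
    obtain ⟨c, hbc, hca, hUc⟩ := hnb
    rw [Submodule.mem_sInf] at hx
    exact h2 c hbc hca (hx _ ⟨hyp_mem_arrB hca.ne', hUc⟩).symm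

/-- The cuts x_c = x_a divide the hyperplane into convex sign cells, so a shard is given by one side
for each c in (b, a). -/
theorem closure_component_hyp {a b : PM n} (hab : b < a) {x : BSpace n}
    (hx : x ∈ cutHyperplane (arrB n) (baseB n) (hyp a b)) :
    closure (connectedComponentIn (cutHyperplane (arrB n) (baseB n) (hyp a b)) x) =
      {y : BSpace n | y.1 a = y.1 b ∧ ∀ c, b < c → c < a →
          (x.1 c < x.1 a → y.1 c ≤ y.1 a) ∧ (x.1 a < x.1 c → y.1 a ≤ y.1 c)} := by
  rw [cutHyperplane_hyp hab] at hx ⊢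
  let f : {c : PM n // b < c ∧ c < a} → BSpace n → ℝ := fun c => diff c.1 a
  have hconv : Convex ℝ {y ∈ {x : BSpace n | x.1 a = x.1 b ∧ ∀ c, b < c → c < a → x.1 c ≠ x.1 a} |
      ∀ i, 0 < f i x * f i y} := by
    have : {y ∈ {x : BSpace n | x.1 a = x.1 b ∧ ∀ c, b < c → c < a → x.1 c ≠ x.1 a} |
      ∀ i, 0 < f i x * f i y} = (hyp a b : Set (BSpace n)) ∩ {y | ∀ i, 0 < f i x * f i y} := by
      ext y
      constructor
      · rintro ⟨⟨h1, _⟩, h2⟩; exact ⟨h1, h2⟩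
      · rintro ⟨h1, h2⟩
        refine ⟨⟨h1, fun c hbc hca h3 => ?_⟩, h2⟩
        have h4 := h2 ⟨c, hbc, hca⟩
        simp only [f, diff_apply, h3, sub_self, mul_zero, lt_irrefl] at h4
    rw [this]
    refine (hyp a b).convex.inter ?_
    simp only [Set.ofPred_forall]
    refine convex_iInter fun i => ?_
    exact convex_halfSpace_gt (f := fun y => f i x * f i y)
      ((f i x) • (diff i.1 a)).isLinear 0
  rw [connectedComponentIn_eq_signs f (fun i => by
      exact (continuous_coord _).sub (continuous_coord _))
      (fun y hy i h => hy.2 i.1 i.2.1 i.2.2 (sub_eq_zero.mp h)) hx hconv.isPreconnected]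
  refine closure_eq_of_perturb ?_ ?_ x ?_
  · simp only [Set.ofPred_and, Set.ofPred_forall]
    refine (isClosed_eq (continuous_coord a) (continuous_coord b)).inter ?_
    refine isClosed_iInter fun c => isClosed_iInter fun _ => isClosed_iInter fun _ => ?_
    exact (isClosed_iInter fun _ => isClosed_le (continuous_coord c) (continuous_coord a)).inter
      (isClosed_iInter fun _ => isClosed_le (continuous_coord a) (continuous_coord c))
  · rintro y ⟨⟨h1, _⟩, h2⟩
    refine ⟨h1, fun c hbc hca => ?_⟩
    have h3 := h2 ⟨c, hbc, hca⟩
    simp only [f, diff_apply] at h3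
    constructor <;> intro h4 <;> nlinarith
  · rintro y ⟨h1, h2⟩ t ht
    have h3 : ∀ c, b < c → c < a → 0 < (x.1 c - x.1 a) * ((y + t • x).1 c - (y + t • x).1 a) := by
      intro c hbc hca
      simp only [add_coord, smul_coord]
      rcases lt_or_gt_of_ne (hx.2 c hbc hca) with h4 | h4
      · have h5 := (h2 c hbc hca).1 h4
        exact mul_pos_of_neg_of_neg (by linarith) (by nlinarith)
      · have h5 := (h2 c hbc hca).2 h4
        exact mul_pos (by linarith) (by nlinarith)
    refine ⟨⟨?_, fun c hbc hca h4 => ?_⟩, fun i => h3 i.1 i.2.1 i.2.2⟩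
    · simp only [add_coord, smul_coord, h1, hx.1]
    · have h5 := h3 c hbc hca
      rw [h4, sub_self, mul_zero] at h5
      exact lt_irrefl _ h5

end Basic

/-! ### Admissible signed subsets -/

namespace SignedSubset

variable {n : ℕ} (A : SignedSubset n)

theorem m_mem : A.m ∈ A.carrier := Finset.min'_mem _ _

theorem m_le {c : PM n} (hc : c ∈ A.carrier) : A.m ≤ c := Finset.min'_le _ _ hc

theorem mem_pmCompl {c : PM n} : c ∈ A.pmCompl ↔ c ∉ A.carrier ∧ -c ∉ A.carrier := by
  simp [pmCompl]

theorem neg_m_not_mem : -A.m ∉ A.carrier := A.signed _ A.m_mem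

/-- Either every absolute value occurs in `A`, or `M` is the largest that does not. -/
theorem full_or : (A.M = -A.m ∧ ∀ c, c ∈ A.carrier ∨ -c ∈ A.carrier) ∨
    (A.M ≠ -A.m ∧ A.M ≠ A.m ∧ A.M ∉ A.carrier ∧ -A.M ∉ A.carrier ∧
      ∀ c, c ∉ A.carrier → -c ∉ A.carrier → -A.M ≤ c ∧ c ≤ A.M) := by
  unfold M
  split_ifs with h
  · right
    have h1 := Finset.max'_mem _ h
    have h2 := A.mem_pmCompl.mp h1
    refine ⟨fun h3 => ?_, fun h3 => ?_, h2.1, h2.2, fun c hc hc' => ⟨?_, ?_⟩⟩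
    · rw [h3, PM.neg_neg] at h2; exact h2.2 A.m_mem
    · rw [h3] at h2; exact h2.1 A.m_mem
    · have : -c ≤ A.pmCompl.max' h := Finset.le_max' _ _ (A.mem_pmCompl.mpr ⟨hc', by simpa⟩)
      simp only [PM.le_iff, PM.coe_neg] at *
      omega
    · exact Finset.le_max' _ _ (A.mem_pmCompl.mpr ⟨hc, hc'⟩)
  · left
    refine ⟨rfl, fun c => ?_⟩
    by_contra h1
    push Not at h1
    exact h ⟨c, A.mem_pmCompl.mpr h1⟩

theorem M_not_mem : A.M ∉ A.carrier := by
  rcases A.full_or with h | h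
  · rw [h.1]; exact A.neg_m_not_mem
  · exact h.2.2.1

theorem M_pos (h : A.m < A.M) : 0 < A.M.1 := by
  rcases A.full_or with h1 | h1
  · have := h1.1
    simp only [PM.lt_iff, PM.eq_iff, PM.coe_neg] at *
    omega
  · have := h1.2.2.2.2 _ h1.2.2.2.1 (by simpa using h1.2.2.1)
    have := A.M.coe_ne_zero
    simp only [PM.le_iff, PM.coe_neg] at *
    omega

theorem mem_iff_of_M_lt {c : PM n} (h : A.M < c) : c ∈ A.carrier ↔ -c ∉ A.carrier := by
  constructor
  · exact A.signed c
  · intro h1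
    rcases A.full_or with h2 | h2
    · exact (h2.2 c).resolve_right h1
    · by_contra h3
      exact absurd (h2.2.2.2.2 c h3 h1).2 (not_le.mpr h)

theorem ext_carrier {A A' : SignedSubset n} (h : A.carrier = A'.carrier) : A = A' := by
  cases A; cases A'; simp_all

/-- Below m there is nothing, M itself is absent, and for c > M > 0 membership of c is the opposite
of membership of -c, which is below M. -/
theorem ext_of_Ioo {A A' : SignedSubset n} (hm : A.m = A'.m) (hM : A.M = A'.M) (h : A.m < A.M)
    (hI : ∀ c, A.m < c → c < A.M → (c ∈ A.carrier ↔ c ∈ A'.carrier)) : A = A' := by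
  have h1 : ∀ c, c ≤ A.M → (c ∈ A.carrier ↔ c ∈ A'.carrier) := by
    intro c hc
    rcases lt_trichotomy c A.m with h1 | h1 | h1
    · refine iff_of_false (fun h2 => absurd (A.m_le h2) (not_le.mpr h1)) fun h2 => ?_
      exact absurd (A'.m_le h2) (not_le.mpr (hm ▸ h1))
    · subst h1
      exact iff_of_true A.m_mem (hm ▸ A'.m_mem)
    · rcases hc.eq_or_lt with h2 | h2
      · subst h2
        exact iff_of_false A.M_not_mem (hM ▸ A'.M_not_mem)
      · exact hI c h1 h2
  apply ext_carrier
  ext c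
  rcases le_or_gt c A.M with h2 | h2
  · exact h1 c h2
  · rw [A.mem_iff_of_M_lt h2, A'.mem_iff_of_M_lt (hM ▸ h2), h1]
    have := A.M_pos h
    simp only [PM.le_iff, PM.lt_iff, PM.coe_neg] at *
    omega

/-- The shard encoded by `A`. -/
def shard : Set (BSpace n) :=
  {y | y.1 A.M = y.1 A.m ∧ ∀ c, A.m < c → c < A.M →
    (c ∈ A.carrier → y.1 c ≤ y.1 A.m) ∧ (c ∉ A.carrier → y.1 A.m ≤ y.1 c)}

/-- The relative interior of the shard encoded by `A`. -/
def inner : Set (BSpace n) :=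
  {y | y.1 A.M = y.1 A.m ∧ ∀ c, A.m < c → c < A.M →
    (c ∈ A.carrier → y.1 c < y.1 A.m) ∧ (c ∉ A.carrier → y.1 A.m < y.1 c)}

/-- The hyperplane containing the shard encoded by `A`. -/
noncomputable def hyper : Submodule ℝ (BSpace n) := hyp A.M A.m

variable {A}

theorem inner_subset_shard : A.inner ⊆ A.shard := fun _ hy => ⟨hy.1, fun c h1 h2 =>
  ⟨fun h3 => ((hy.2 c h1 h2).1 h3).le, fun h3 => ((hy.2 c h1 h2).2 h3).le⟩⟩

theorem inner_ne {y : BSpace n} (hy : y ∈ A.inner) {c : PM n} (h1 : A.m < c) (h2 : c < A.M) :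
    y.1 c ≠ y.1 A.m := by
  by_cases h3 : c ∈ A.carrier
  · exact ((hy.2 c h1 h2).1 h3).ne
  · exact ((hy.2 c h1 h2).2 h3).ne'

theorem inner_lt_iff {y : BSpace n} (hy : y ∈ A.inner) {c : PM n} (h1 : A.m < c) (h2 : c < A.M) :
    y.1 c < y.1 A.m ↔ c ∈ A.carrier := by
  by_cases h3 : c ∈ A.carrier
  · exact iff_of_true ((hy.2 c h1 h2).1 h3) h3
  · exact iff_of_false ((hy.2 c h1 h2).2 h3).not_gt h3

theorem mem_inner_of_shard {y : BSpace n} (hy : y ∈ A.shard)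
    (h : ∀ c, A.m < c → c < A.M → y.1 c ≠ y.1 A.m) : y ∈ A.inner :=
  ⟨hy.1, fun c h1 h2 => ⟨fun h3 => lt_of_le_of_ne ((hy.2 c h1 h2).1 h3) (h c h1 h2),
    fun h3 => lt_of_le_of_ne ((hy.2 c h1 h2).2 h3) (h c h1 h2).symm⟩⟩

theorem mem_cut_of_inner (hA : A.m < A.M) {y : BSpace n} (hy : y ∈ A.inner) :
    y ∈ cutHyperplane (arrB n) (baseB n) A.hyper := by
  rw [hyper, cutHyperplane_hyp hA]
  refine ⟨hy.1, fun c h1 h2 => ?_⟩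
  rw [hy.1]
  exact inner_ne hy h1 h2

theorem mem_inner_of_cut (hA : A.m < A.M) {y : BSpace n} (hy : y ∈ A.shard)
    (h : y ∈ cutHyperplane (arrB n) (baseB n) A.hyper) : y ∈ A.inner := by
  rw [hyper, cutHyperplane_hyp hA] at h
  refine mem_inner_of_shard hy fun c h1 h2 => ?_
  have := h.2 c h1 h2
  rwa [h.1] at this

/-- Exactly one of -M and -m lies in (m, M). It is not in A, and the side condition there reads y_m
< -y_m. This sign tells the name (M, m) of the hyperplane from its other name (-m, -M). -/
theorem inner_neg_of_mem {y : BSpace n} (hy : y ∈ A.inner) (hA : A.m < A.M) (h0 : A.m.1 < 0)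
    (h1 : A.M ≠ -A.m) : y.1 A.m < 0 := by
  have hMpos := A.M_pos hA
  rcases A.full_or with h2 | h2
  · exact absurd h2.1 h1
  · rcases lt_or_gt_of_ne h1 with h3 | h3
    · have := (hy.2 (-A.M) (by simp only [PM.lt_iff, PM.coe_neg] at *; omega)
        (by simp only [PM.lt_iff, PM.coe_neg] at *; omega)).2 h2.2.2.2.1
      rw [coord_neg, hy.1] at this
      linarith
    · have := (hy.2 (-A.m) (by simp only [PM.lt_iff, PM.coe_neg] at *; omega) h3).2 A.neg_m_not_mem
      rw [coord_neg] at this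
      linarith

theorem shard_nonpos_of_mem {y : BSpace n} (hy : y ∈ A.shard) (hA : A.m < A.M) (h0 : A.m.1 < 0) :
    y.1 A.m ≤ 0 := by
  have hMpos := A.M_pos hA
  rcases A.full_or with h2 | h2
  · have h3 := hy.1
    rw [h2.1, coord_neg] at h3
    linarith
  · rcases lt_or_gt_of_ne h2.1 with h3 | h3
    · have := (hy.2 (-A.M) (by simp only [PM.lt_iff, PM.coe_neg] at *; omega)
        (by simp only [PM.lt_iff, PM.coe_neg] at *; omega)).2 h2.2.2.2.1
      rw [coord_neg, hy.1] at this
      linarith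
    · have := (hy.2 (-A.m) (by simp only [PM.lt_iff, PM.coe_neg] at *; omega) h3).2 A.neg_m_not_mem
      rw [coord_neg] at this
      linarith

theorem hyper_eq_iff {A A' : SignedSubset n} (hA : A.m < A.M) (hA' : A'.m < A'.M) :
    A.hyper = A'.hyper ↔ (A'.M = A.M ∧ A'.m = A.m) ∨ (A'.M = -A.m ∧ A'.m = -A.M) :=
  hyp_lt_iff hA hA'

/-- If the two subsets used different names for the hyperplane, `inner_neg_of_mem` would give both
y_m < 0 and -y_M < 0, although y_M = y_m. -/
theorem eq_of_inner {A A' : SignedSubset n} (hA : A.m < A.M) (hA' : A'.m < A'.M)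
    (h : A.hyper = A'.hyper) {y : BSpace n} (hy : y ∈ A.inner) (hy' : y ∈ A'.inner) : A = A' := by
  have key : A'.M = A.M ∧ A'.m = A.m → A = A' := by
    rintro ⟨h1, h2⟩
    refine ext_of_Ioo h2.symm h1.symm hA fun c h3 h4 => ?_
    rw [← inner_lt_iff hy h3 h4, ← inner_lt_iff hy' (h2 ▸ h3) (h1 ▸ h4), h2]
  rcases (hyper_eq_iff hA hA').mp h with h1 | h1
  · exact key h1
  · by_cases h2 : A.M = -A.m
    · exact key ⟨by rw [h1.1, h2], by rw [h1.2, h2, PM.neg_neg]⟩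
    · exfalso
      have hM := A.M_pos hA
      have hM' := A'.M_pos hA'
      have h3 := inner_neg_of_mem hy hA (by
        simp only [PM.eq_iff, PM.coe_neg] at *; omega) h2
      have h4 := inner_neg_of_mem hy' hA' (by
        simp only [PM.eq_iff, PM.coe_neg] at *; omega) (by
        simp only [PM.eq_iff, PM.coe_neg, ne_eq] at *; omega)
      rw [h1.2, coord_neg, hy.1] at h4
      linarith

/-- The hypothesis `h` is the sign normalization under which (a, b), rather than (-b, -a), is the
name carried by the signed subset. -/
theorem exists_of_normalized {a b : PM n} {x : BSpace n} (hab : b < a) (ha : 0 < a.1)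
    (hx : x.1 a = x.1 b) (hcut : ∀ c, b < c → c < a → x.1 c ≠ x.1 a)
    (h : a = -b ∨ (a ≠ -b ∧ (0 < b.1 ∨ x.1 b < 0))) :
    ∃ A : SignedSubset n, A.M = a ∧ A.m = b ∧ x ∈ A.inner := by
  classical
  have h0 : a = -b → x.1 b = 0 := by
    rintro rfl
    rw [coord_neg] at hx; linarith
  -- Besides b and the indices on the low side of a cut, `P` holds above a for every index whose
  -- negative is not already taken. This exhausts all absolute values beyond a, leaving a as the
  -- largest one missing unless a = -b.
  let P : PM n → Prop := fun c => c = b ∨ (b < c ∧ c < a ∧ x.1 c < x.1 b) ∨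
    (a < c ∧ -c ≠ b ∧ ¬ (b < -c ∧ -c < a ∧ x.1 (-c) < x.1 b))
  have hPneg : ∀ c, P c → ¬ P (-c) := by
    intro c
    have hb := b.coe_ne_zero
    have hbb := coord_neg x b
    have hcc := coord_neg x c
    simp only [P, PM.neg_neg]
    simp only [PM.eq_iff, PM.lt_iff, PM.coe_neg, ne_eq] at *
    by_cases hcb : c.1 = b.1
    · have : c = b := Subtype.ext hcb
      subst this
      rintro - (h1 | h1 | h1)
      · omega
      · rcases h with h | ⟨h, h2 | h2⟩
        · omega
        · omega
        · linarith [h1.2.2]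
      · omega
    by_cases hcb' : -c.1 = b.1
    · have : c = -b := PM.eq_neg_comm.mp (Subtype.ext hcb'.symm)
      subst this
      rintro (h1 | h1 | h1) -
      · omega
      · rcases h with h | ⟨h, h2 | h2⟩
        · simp only [PM.coe_neg] at *; omega
        · simp only [PM.coe_neg] at *; omega
        · linarith [h1.2.2]
      · omega
    rintro (h1 | h1 | h1) (h2 | h2 | h2)
    · omega
    · omega
    · omega
    · omega
    · rcases h with h | ⟨h, h3 | h3⟩
      · linarith [h1.2.2, h2.2.2, h0 h]
      · omega
      · linarith [h1.2.2, h2.2.2]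
    · exact h2.2.2 h1
    · omega
    · exact h1.2.2 h2
    · omega
  let A : SignedSubset n := ⟨Finset.univ.filter P, ⟨b, by simp [P]⟩, fun c hc => by
    simp only [Finset.mem_filter, Finset.mem_univ, true_and] at hc ⊢
    exact hPneg c hc⟩
  have hA : ∀ c, c ∈ A.carrier ↔ P c := fun c => by simp [A]
  have hm : A.m = b := by
    apply le_antisymm
    · exact A.m_le ((hA b).mpr (Or.inl rfl))
    · have := (hA _).mp A.m_mem
      rcases this with h1 | h1 | h1
      · exact h1.ge
      · exact h1.1.le
      · exact (hab.trans h1.1).le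
  have hMa : A.M = a := by
    rcases h with h | ⟨h, h'⟩
    · rcases A.full_or with h1 | h1
      · rw [h1.1, hm, h]
      · exfalso
        have h2 : ¬ P A.M := fun h => h1.2.2.1 ((hA _).mpr h)
        have h3 : ¬ P (-A.M) := fun h => h1.2.2.2.1 ((hA _).mpr h)
        have h4 := coord_neg x A.M
        have h5 := hcut A.M
        have h6 := h0 h
        simp only [P, not_or, PM.neg_neg] at h2 h3
        rw [h6] at hx
        by_cases h7 : b < A.M ∧ A.M < a
        · have h8 := h5 h7.1 h7.2
          rcases lt_or_gt_of_ne h8 with h9 | h9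
          · exact h2.2.1 ⟨h7.1, h7.2, by rw [h6, ← hx]; exact h9⟩
          · refine h3.2.1 ⟨?_, ?_, by rw [h6, h4]; linarith⟩
            · simp only [PM.eq_iff, PM.lt_iff, PM.coe_neg, ne_eq] at *; omega
            · simp only [PM.eq_iff, PM.lt_iff, PM.coe_neg, ne_eq] at *; omega
        · simp only [PM.eq_iff, PM.lt_iff, PM.coe_neg, ne_eq] at *
          omega
    · have hb := b.coe_ne_zero
      have haa := coord_neg x a
      have h1 : ¬ P a := by
        simp only [P]; simp only [PM.eq_iff, PM.lt_iff, PM.coe_neg, ne_eq] at *; omega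
      have h2 : ¬ P (-a) := by
        simp only [P, PM.neg_neg]
        simp only [PM.eq_iff, PM.lt_iff, PM.coe_neg, ne_eq] at *
        rintro (h2 | h2 | h2)
        · omega
        · rcases h' with h3 | h3
          · omega
          · linarith [h2.2.2]
        · omega
      rcases A.full_or with h3 | h3
      · rcases h3.2 a with h4 | h4
        · exact absurd ((hA _).mp h4) h1
        · exact absurd ((hA _).mp h4) h2
      · have h4 := h3.2.2.2.2 a (fun h => h1 ((hA _).mp h)) (fun h => h2 ((hA _).mp h))
        refine le_antisymm (not_lt.mp fun h5 => ?_) h4.2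
        have h6 : ¬ P A.M := fun h => h3.2.2.1 ((hA _).mpr h)
        have h7 : ¬ P (-A.M) := fun h => h3.2.2.2.1 ((hA _).mpr h)
        simp only [P, not_or, PM.neg_neg] at h6 h7
        exact h6.2.2 ⟨h5, h7.1, h7.2.1⟩
  refine ⟨A, hMa, hm, ?_⟩
  refine ⟨by rw [hMa, hm, hx], fun c h1 h2 => ?_⟩
  rw [hm] at h1 ⊢
  rw [hMa] at h2
  have h3 : c ∈ A.carrier ↔ x.1 c < x.1 b := by
    rw [hA]
    simp only [P, h1, h2, true_and, h2.not_gt, h1.ne', false_and, or_false, false_or]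
  rw [h3]
  refine ⟨id, fun h4 => lt_of_le_of_ne (not_lt.mp h4) ?_⟩
  rw [← hx]
  exact (hcut c h1 h2).symm

/-- For b < 0 < a and a ≠ -b the sign of x_b decides which name is normalized; x_b = 0 is
impossible, as a cut at -a or -b would pass through x. In the remaining cases the signs of a and b
decide. -/
theorem exists_inner {a b : PM n} {x : BSpace n} (hab : b < a) (hx : x.1 a = x.1 b)
    (hcut : ∀ c, b < c → c < a → x.1 c ≠ x.1 a) :
    ∃ A : SignedSubset n, A.m < A.M ∧ ((A.M = a ∧ A.m = b) ∨ (A.M = -b ∧ A.m = -a)) ∧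
      x ∈ A.inner := by
  have h1 : (0 < a.1 ∧ (a = -b ∨ (a ≠ -b ∧ (0 < b.1 ∨ x.1 b < 0)))) ∨
      (0 < (-b).1 ∧ ((-b) = -(-a) ∨ (-b ≠ - -a ∧ (0 < (-a).1 ∨ x.1 (-a) < 0)))) := by
    have ha := a.coe_ne_zero
    have hb := b.coe_ne_zero
    have h2 := coord_neg x a
    have h3 := coord_neg x b
    have h4 := hcut (-a)
    have h5 := hcut (-b)
    rw [PM.neg_neg]
    simp only [PM.eq_iff, PM.lt_iff, PM.coe_neg, ne_eq] at *
    by_cases h6 : a.1 = -b.1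
    · left; omega
    by_cases h7 : 0 < b.1
    · left; omega
    by_cases h8 : a.1 < 0
    · right; omega
    rcases lt_trichotomy (x.1 b) 0 with h9 | h9 | h9
    · left; exact ⟨by omega, Or.inr ⟨h6, Or.inr h9⟩⟩
    · exfalso
      by_cases h10 : -a.1 < b.1
      · exact h5 (by omega) (by omega) (by rw [h3, hx, h9, neg_zero])
      · exact h4 (by omega) (by omega) (by rw [h2, hx, h9, neg_zero])
    · right; exact ⟨by omega, Or.inr ⟨by omega, Or.inr (by rw [h2, hx]; linarith)⟩⟩
  rcases h1 with ⟨h1, h2⟩ | ⟨h1, h2⟩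
  · obtain ⟨A, hM, hm, hA⟩ := exists_of_normalized hab h1 hx hcut h2
    exact ⟨A, by rw [hM, hm]; exact hab, Or.inl ⟨hM, hm⟩, hA⟩
  · obtain ⟨A, hM, hm, hA⟩ := exists_of_normalized (PM.neg_lt_neg.mpr hab) h1
      (by rw [coord_neg, coord_neg, hx]) (fun c hc1 hc2 => by
        have := hcut (-c) (by rw [← PM.neg_lt_neg, PM.neg_neg]; exact hc2)
          (by rw [← PM.neg_lt_neg, PM.neg_neg]; exact hc1)
        rw [coord_neg] at this ⊢
        rw [← hx]
        contrapose! this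
        rw [this, _root_.neg_neg]) h2
    exact ⟨A, by rw [hM, hm]; exact PM.neg_lt_neg.mpr hab, Or.inr ⟨hM, hm⟩, hA⟩

/-- A wall point meets no cut of its hyperplane, so it is interior to a shard. This shard labels the
corresponding cover. -/
theorem exists_label {a b : PM n} {p : BSpace n} (hp : Wall a b p) :
    ∃ A : SignedSubset n, A.m < A.M ∧ A.hyper = hyp a b ∧ Wall A.M A.m p ∧ p ∈ A.inner := by
  obtain ⟨A, hA, h1, h2⟩ := exists_inner hp.1 hp.eq (fun c h1 h2 h3 => by
    have h4 := hp.1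
    rw [hp.2] at h3
    simp only [PM.eq_iff, PM.lt_iff, PM.coe_neg] at *
    omega)
  refine ⟨A, hA, ?_, ?_, h2⟩
  · rcases h1 with ⟨h3, h4⟩ | ⟨h3, h4⟩
    · rw [hyper, h3, h4]
    · rw [hyper, h3, h4, hyp_swap]
  · rcases h1 with ⟨h3, h4⟩ | ⟨h3, h4⟩
    · rw [h3, h4]; exact hp
    · rw [h3, h4]; exact hp.swap

end SignedSubset

/-! ### Join-irreducible signed permutations -/

theorem mem_regionB_topP {n : ℕ} (p : BSpace n) : p ∈ regionB (topP p) := by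
  rw [mem_regionB]
  intro a b h
  exact refines le_rfl (botP_le_topP p) h

theorem Wall.step {n : ℕ} {a b : PM n} {p : BSpace n} (h : Wall a b p) : Step (topP p) a b := by
  refine ⟨topP_lt.mpr (Or.inr ⟨h.eq, h.1⟩), fun c hc => ?_⟩
  by_contra h1
  rw [not_le, topP_lt] at h1
  rw [topP_lt] at hc
  have h2 := h.eq
  have h3 : p.1 a = p.1 c := by
    rcases hc with hc | hc <;> rcases h1 with h1 | h1
    · linarith
    · linarith [h1.1]
    · linarith [hc.1]
    · exact hc.1
  have h4 := h.1
  rw [h.2] at h3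
  simp only [PM.eq_iff, PM.lt_iff, PM.coe_neg] at *
  rcases hc with hc | hc <;> rcases h1 with h1 | h1 <;> try omega
  · linarith
  · linarith [h1.1]
  · linarith [hc.1]

theorem Wall.pos_botP {n : ℕ} {a b : PM n} {p : BSpace n} (h : Wall a b p) :
    pos (botP p) b < pos (botP p) a :=
  botP_lt.mpr (Or.inr ⟨h.eq.symm, h.1⟩)

theorem Wall.pos_topP {n : ℕ} {a b : PM n} {p : BSpace n} (h : Wall a b p) :
    pos (topP p) a < pos (topP p) b :=
  topP_lt.mpr (Or.inr ⟨h.eq, h.1⟩)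

theorem Wall.botP_le_botP {n : ℕ} {a b : PM n} {p q : BSpace n} (hp : Wall a b p)
    (hq : Wall a b q) (h : topP p = topP q) : botP p ≤ botP q :=
  hq.le_botP (h ▸ botP_le_topP p) hp.pos_botP

namespace SignedSubset

variable {n : ℕ} (A : SignedSubset n)

theorem block_neg (c : PM n) : A.block (-c) + A.block c = 2 := by
  have := A.signed c
  have := A.signed (-c)
  simp only [block, PM.neg_neg] at *
  split_ifs <;> simp_all

theorem block_le (c : PM n) : A.block c ≤ 2 := by have := A.block_neg c; omega

theorem block_eq_two {c : PM n} : A.block c = 2 ↔ c ∈ A.carrier := by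
  have := A.signed c
  simp only [block]
  split_ifs <;> simp_all

theorem block_eq_zero {c : PM n} : A.block c = 0 ↔ -c ∈ A.carrier := by
  simp only [block]
  split_ifs <;> simp_all

/-- The vector whose level sets are the blocks of `A`. -/
noncomputable def blockVec : BSpace n :=
  ⟨fun c => 1 - (A.block c : ℝ), fun c => by
    have : (A.block (-c) : ℝ) + A.block c = 2 := by exact_mod_cast A.block_neg c
    linarith⟩

/-- The signed permutation listing the blocks of `A` in ascending order. -/
noncomputable def gamma : SignedPerm n := botP A.blockVec

variable {A}

theorem gamma_lt {a b : PM n} : pos A.gamma a < pos A.gamma b ↔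
    A.block a < A.block b ∨ (A.block a = A.block b ∧ a < b) := by
  rw [gamma, botP_lt]
  simp [blockVec]

theorem lists_iff {w : SignedPerm n} : A.Lists w ↔ w = A.gamma := by
  have h : A.Lists w ↔ ∀ a b, pos w a < pos w b → pos A.gamma a < pos A.gamma b := by
    simp only [gamma_lt]
    constructor
    · intro h a b hab
      simpa [apply_pos] using h _ _ hab
    · intro h i j hij
      exact h _ _ (by simpa [pos_apply] using hij)
  rw [h]
  exact ⟨signedPerm_ext, fun h a b hab => h ▸ hab⟩

/-- Between m and M, the coordinates in A are at most p_m = p_M and the others at least that. An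
index beyond M is treated through its negative, using p_m ≤ 0. -/
theorem le_of_mem_shard (hA : A.m < A.M) {p : BSpace n} (hp : p ∈ A.shard) {c d : PM n}
    (hdc : d < c) (hd : d ∈ A.carrier) (hc : c ∉ A.carrier) : p.1 d ≤ p.1 c := by
  have hmd := A.m_le hd
  have hlow : ∀ e, A.m ≤ e → e < A.M → e ∈ A.carrier → p.1 e ≤ p.1 A.m := by
    intro e h1 h2 h3
    rcases h1.eq_or_lt with rfl | h1
    · exact le_rfl
    · exact (hp.2 e h1 h2).1 h3
  rcases lt_trichotomy c A.M with h1 | h1 | h1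
  · exact (hlow d hmd (hdc.trans h1) hd).trans ((hp.2 c (lt_of_le_of_lt hmd hdc) h1).2 hc)
  · rw [h1, hp.1]
    exact hlow d hmd (h1 ▸ hdc) hd
  · have h2 : -c ∈ A.carrier := by
      by_contra h2
      exact hc ((A.mem_iff_of_M_lt h1).mpr h2)
    have h3 := A.m_le h2
    have hMp := A.M_pos hA
    have h4 := hlow (-c) h3 (by simp only [PM.lt_iff, PM.coe_neg] at *; omega) h2
    have h5 := shard_nonpos_of_mem hp hA (by
      simp only [PM.lt_iff, PM.le_iff, PM.coe_neg] at *; omega)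
    rw [coord_neg] at h4
    rcases lt_trichotomy d A.M with h6 | h6 | h6
    · have := hlow d hmd h6 hd
      linarith
    · exact absurd (h6 ▸ hd) A.M_not_mem
    · have h7 := (hp.2 (-d) (by simp only [PM.lt_iff, PM.le_iff, PM.coe_neg] at *; omega)
        (by simp only [PM.lt_iff, PM.le_iff, PM.coe_neg] at *; omega)).2 (A.signed d hd)
      rw [coord_neg] at h7
      linarith

/-- Every inversion of `gamma` is, up to negation, a pair d < c with d in A and c outside A, which
`le_of_mem_shard` controls. -/
theorem gamma_le_topP (hA : A.m < A.M) {p : BSpace n} (hp : p ∈ A.shard) : A.gamma ≤ topP p := by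
  apply le_topP_of
  intro c d hdc h
  rw [gamma_lt] at h
  rcases h with h | h
  · by_cases h1 : d ∈ A.carrier
    · exact le_of_mem_shard hA hp hdc h1 fun h2 => by
        rw [← block_eq_two] at h1 h2; omega
    · have h2 : -c ∈ A.carrier := by
        have := A.block_le d
        rw [← block_eq_two] at h1
        rw [← block_eq_zero]; omega
      have h3 : -d ∉ A.carrier := by rw [← block_eq_zero]; omega
      have := le_of_mem_shard hA hp (PM.neg_lt_neg.mpr hdc) h2 h3
      rw [coord_neg, coord_neg] at this
      linarith
  · exact absurd h.2 hdc.asymm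

variable (A) in
theorem pos_gamma : pos A.gamma A.M < pos A.gamma A.m := by
  rw [gamma_lt]
  left
  have h1 := A.M_not_mem
  have h2 := A.block_le A.M
  rw [← block_eq_two] at h1
  rw [A.block_eq_two.mpr A.m_mem]
  omega

theorem pos_m_le {c : PM n} (hc : c ∈ A.carrier) : pos A.gamma A.m ≤ pos A.gamma c := by
  by_contra h
  rw [not_le, gamma_lt, A.block_eq_two.mpr A.m_mem, A.block_eq_two.mpr hc] at h
  rcases h with h | h
  · exact lt_irrefl _ h
  · exact absurd (A.m_le hc) (not_le.mpr h.2)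

theorem pos_le_M {c : PM n} (hc : c ∉ A.carrier) : pos A.gamma c ≤ pos A.gamma A.M := by
  by_contra h
  have h1 := A.block_le c
  rw [← block_eq_two] at hc
  have h2 := A.M_not_mem
  rw [← block_eq_two] at h2
  have h2' := A.block_le A.M
  rw [not_le, gamma_lt] at h
  rcases A.full_or with h3 | h3
  · have h4 : A.block A.M = 0 := by rw [block_eq_zero, h3.1, PM.neg_neg]; exact A.m_mem
    have h5 : A.block c = 0 := by
      rw [block_eq_zero]
      refine (h3.2 c).resolve_left ?_
      rwa [← block_eq_two]
    have h6 := A.m_le (block_eq_zero A |>.mp h5)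
    have h7 := h3.1
    rcases h with h | h
    · omega
    · simp only [PM.lt_iff, PM.le_iff, PM.eq_iff, PM.coe_neg] at *; omega
  · have h4 : A.block A.M ≠ 0 := by rw [Ne, block_eq_zero]; exact h3.2.2.2.1
    rcases h with h | h
    · omega
    · have h5 := h3.2.2.2.2 c (by rw [← block_eq_two]; omega) (by rw [← block_eq_zero]; omega)
      exact absurd h5.2 (not_le.mpr h.2)

-- M closes the part of the notation preceding A, and m opens A.
variable (A) in
theorem step_gamma : Step A.gamma A.M A.m := by
  refine ⟨A.pos_gamma, fun c hc => ?_⟩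
  by_cases h : c ∈ A.carrier
  · exact pos_m_le h
  · exact absurd (pos_le_M h) (not_le.mpr hc)

/-- Within a block the notation ascends. The junction before A is M, m, and the junction after -A is
its negation. -/
theorem eq_of_step_gamma {a b : PM n} (hs : Step A.gamma a b) (hab : b < a) :
    (a = A.M ∧ b = A.m) ∨ (a = -A.m ∧ b = -A.M) := by
  have key : ∀ {a b : PM n}, Step A.gamma a b → b ∈ A.carrier → a ∉ A.carrier →
      a = A.M ∧ b = A.m := by
    intro a b hs hb ha
    have h1 := pos_le_M ha
    have h2 := pos_m_le hb
    have h3 := A.pos_gamma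
    have h4 : a = A.M := by
      rcases h1.eq_or_lt with h | h
      · exact pos_injective _ h
      · exact absurd (hs.2 _ h) (not_le.mpr (lt_of_lt_of_le h3 h2))
    subst h4
    exact ⟨rfl, pos_injective _ (le_antisymm (hs.2 _ h3) h2)⟩
  have h := hs.1
  rw [gamma_lt] at h
  have h' := h.resolve_right fun h => h.2.asymm hab
  by_cases hb : b ∈ A.carrier
  · refine Or.inl (key hs hb fun ha => ?_)
    rw [← block_eq_two] at ha hb; omega
  · have h1 : -a ∈ A.carrier := by
      have := A.block_le b
      rw [← block_eq_two] at hb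
      rw [← block_eq_zero]; omega
    have h2 : -b ∉ A.carrier := by rw [← block_eq_zero]; omega
    have := key hs.neg h1 h2
    right
    exact ⟨PM.eq_neg_comm.mp this.2.symm, PM.eq_neg_comm.mp this.1.symm⟩

theorem mem_inner_of_topP_eq {p : BSpace n} (hp : topP p = A.gamma)
    (h : p.1 A.M = p.1 A.m) : p ∈ A.inner := by
  refine ⟨h, fun c h1 h2 => ⟨fun h3 => ?_, fun h3 => ?_⟩⟩
  · have h4 := lt_of_le_of_ne (pos_m_le h3) fun h => h1.ne (pos_injective _ h)
    rw [← hp, topP_lt] at h4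
    exact h4.resolve_right fun h => h.2.asymm h1
  · have h4 := lt_of_le_of_ne (pos_le_M h3) fun h => h2.ne (pos_injective _ h)
    rw [← hp, topP_lt, h] at h4
    exact h4.resolve_right fun h => h.2.asymm h2

theorem exists_wall_gamma (hA : A.m < A.M) :
    ∃ p, Wall A.M A.m p ∧ p ∈ A.inner ∧ topP p = A.gamma := by
  obtain ⟨p, hp, hp'⟩ := exists_wall (A.step_gamma) hA
  exact ⟨p, hp, mem_inner_of_topP_eq hp' hp.eq, hp'⟩

/-- All lower walls of `gamma` lie on the hyperplane of A, so they share their bottom, the only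
element that `gamma` covers. -/
theorem le_botP_of_lt_gamma {p : BSpace n} (hp : Wall A.M A.m p)
    (hp' : topP p = A.gamma) {u : SignedPerm n} (hu : u < A.gamma) : u ≤ botP p := by
  obtain ⟨a, b, q, hq, hq', huq⟩ := exists_lower_wall hu
  have h1 := hq.step
  rw [hq'] at h1
  have h2 : Wall A.M A.m q := by
    rcases eq_of_step_gamma h1 hq.1 with ⟨rfl, rfl⟩ | ⟨rfl, rfl⟩
    · exact hq
    · simpa using hq.swap
  exact huq.trans (h2.botP_le_botP hp (hq'.trans hp'.symm))

theorem isJoinIrr_gamma (hA : A.m < A.M) : IsJoinIrr A.gamma := by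
  intro S hS
  by_contra hcon
  obtain ⟨p, hp, -, hp'⟩ := exists_wall_gamma hA
  have : A.gamma ≤ botP p := hS.2 fun s hs => le_botP_of_lt_gamma hp hp'
    (lt_of_le_of_ne (hS.1 hs) fun h => hcon (h ▸ hs))
  exact absurd (this.trans_lt hp.botP_lt_topP) (by rw [hp']; exact lt_irrefl _)

theorem pos_gamma_of_hyper {a b : PM n} (hA : A.m < A.M) (hab : b < a) (h : A.hyper = hyp a b) :
    pos A.gamma a < pos A.gamma b := by
  rcases (hyp_lt_iff hA hab).mp h with ⟨rfl, rfl⟩ | ⟨rfl, rfl⟩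
  · exact A.pos_gamma
  · exact pos_lt_neg.mpr (A.pos_gamma)

/-- Let p be a lower wall of w with label A. Then `gamma` of A is below w and inverts the hyperplane
of p. If it were strictly below, it would lie below the bottom of some lower wall q; every upper
bound of `botP p` and `botP q` would invert the hyperplane of p, making w the join of two smaller
elements. -/
theorem exists_gamma_of_isJoinIrr {w : SignedPerm n} (hw : IsJoinIrr w) :
    ∃ A : SignedSubset n, A.m < A.M ∧ A.gamma = w := by
  obtain ⟨u, hu⟩ : ∃ u, u < w := by
    by_contra hcon
    push Not at hcon
    -- A minimal element is the least one, since meets exist, and so is the join of the empty set.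
    refine absurd (hw ∅ ⟨by simp, fun x _ => ?_⟩) (Set.notMem_empty _)
    obtain ⟨z, hz⟩ := exists_isGLB w x
    have h1 : z ≤ w := hz.1 (by simp)
    have h2 : z ≤ x := hz.1 (by simp)
    rcases h1.eq_or_lt with rfl | h1
    · exact h2
    · exact absurd h1 (hcon z)
  obtain ⟨a, b, p, hp, hpw, -⟩ := exists_lower_wall hu
  obtain ⟨A, hA, hAh, -, hpA⟩ := exists_label hp
  refine ⟨A, hA, ?_⟩
  have hle : A.gamma ≤ w := hpw ▸ gamma_le_topP hA (inner_subset_shard hpA)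
  by_contra hne
  obtain ⟨c, d, q, hq, hqw, hAq⟩ := exists_lower_wall (lt_of_le_of_ne hle hne)
  have hlub : IsLUB {botP p, botP q} w := by
    constructor
    · simp only [mem_upperBounds, Set.mem_insert_iff, Set.mem_singleton_iff, forall_eq_or_imp,
        forall_eq]
      exact ⟨hpw ▸ botP_le_topP p, hqw ▸ botP_le_topP q⟩
    · intro z hz
      simp only [mem_upperBounds, Set.mem_insert_iff, Set.mem_singleton_iff, forall_eq_or_imp,
        forall_eq] at hz
      rw [← hpw]
      refine hp.topP_le hz.1 ?_
      exact weak_le_iff.mp (hAq.trans hz.2) b a hp.1 (pos_gamma_of_hyper hA hp.1 hAh)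
  rcases hw _ hlub with h | h
  · exact hp.botP_lt_topP.ne (h ▸ hpw.symm)
  · exact hq.botP_lt_topP.ne ((Set.mem_singleton_iff.mp h) ▸ hqw.symm)

theorem eq_of_topP_eq_gamma {A A' : SignedSubset n} (hA : A.m < A.M) (hA' : A'.m < A'.M)
    {p : BSpace n} (hp : Wall A.M A.m p) (hpA : p ∈ A.inner) (h : topP p = A'.gamma) : A = A' := by
  have h1 := hp.step
  rw [h] at h1
  have h3 : A.hyper = A'.hyper := by
    rw [eq_comm, hyper_eq_iff hA' hA]
    exact eq_of_step_gamma h1 hA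
  refine eq_of_inner hA hA' h3 hpA (mem_inner_of_topP_eq h ?_)
  have h4 : p ∈ A'.hyper := h3 ▸ hpA.1
  exact h4

theorem gamma_injective {A A' : SignedSubset n} (hA : A.m < A.M) (hA' : A'.m < A'.M)
    (h : A.gamma = A'.gamma) : A = A' := by
  obtain ⟨p, hp, hpA, hp'⟩ := exists_wall_gamma hA
  exact eq_of_topP_eq_gamma hA hA' hp hpA (hp'.trans h)

/-! ### Shards and upper regions -/

theorem isShardIn_iff {H : Submodule ℝ (BSpace n)} {T : Set (BSpace n)} :
    IsShardIn (arrB n) (baseB n) H T ↔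
      ∃ A : SignedSubset n, A.m < A.M ∧ H = A.hyper ∧ T = A.shard := by
  have key : ∀ {A : SignedSubset n}, A.m < A.M → ∀ {x}, x ∈ A.inner →
      closure (connectedComponentIn (cutHyperplane (arrB n) (baseB n) A.hyper) x) = A.shard := by
    intro A hA x hx
    rw [hyper, closure_component_hyp hA (mem_cut_of_inner hA hx)]
    ext y
    rw [Set.mem_ofPred_eq]
    refine and_congr_right fun h1 => forall_congr' fun c => forall₂_congr fun h2 h3 => ?_
    rw [hx.1, h1]
    refine and_congr (imp_congr_left (inner_lt_iff hx h2 h3)) (imp_congr_left ?_)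
    rw [← inner_lt_iff hx h2 h3, not_lt]
    exact ⟨le_of_lt, fun h => lt_of_le_of_ne h (inner_ne hx h2 h3).symm⟩
  constructor
  · rintro ⟨⟨a, b, hab, rfl⟩, x, hx, rfl⟩
    have hx' := hx
    rw [cutHyperplane_hyp hab] at hx'
    obtain ⟨A, hA, h1, h2⟩ := exists_inner hab hx'.1 hx'.2
    have h3 : hyp a b = A.hyper := by
      rcases h1 with ⟨h3, h4⟩ | ⟨h3, h4⟩
      · rw [hyper, h3, h4]
      · rw [hyper, h3, h4, hyp_swap]
    exact ⟨A, hA, h3, by rw [h3, key hA h2]⟩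
  · rintro ⟨A, hA, rfl, rfl⟩
    obtain ⟨x, -, hx, -⟩ := exists_wall_gamma hA
    exact ⟨hyp_mem_arrB hA.ne', x, mem_cut_of_inner hA hx, (key hA hx).symm⟩

theorem hyper_le_span (hA : A.m < A.M) : A.hyper ≤ Submodule.span ℝ A.shard := by
  obtain ⟨p, -, hp, -⟩ := exists_wall_gamma hA
  refine le_span_of_perturb (inner_subset_shard hp) fun u hu => ?_
  obtain ⟨ε, hε, h⟩ := eventually_perturb p u
  refine ⟨ε, hε, A.hyper.add_mem hp.1 (A.hyper.smul_mem ε hu), fun c h1 h2 => ⟨fun h3 => ?_, fun h3 => ?_⟩⟩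
  · exact (h _ _ ((hp.2 c h1 h2).1 h3)).le
  · exact (h _ _ ((hp.2 c h1 h2).2 h3)).le

theorem zero_mem_shard : 0 ∈ A.shard := ⟨rfl, fun _ _ _ => ⟨fun _ => le_rfl, fun _ => le_rfl⟩⟩

theorem shard_add {x y : BSpace n} (hx : x ∈ A.shard) (hy : y ∈ A.shard) : x + y ∈ A.shard :=
  ⟨congrArg₂ (· + ·) hx.1 hy.1, fun c h1 h2 =>
    ⟨fun h3 => add_le_add ((hx.2 c h1 h2).1 h3) ((hy.2 c h1 h2).1 h3),
      fun h3 => add_le_add ((hx.2 c h1 h2).2 h3) ((hy.2 c h1 h2).2 h3)⟩⟩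

theorem shard_smul {x : BSpace n} (hx : x ∈ A.shard) {t : ℝ} (ht : 0 < t) : t • x ∈ A.shard :=
  ⟨congrArg (t * ·) hx.1, fun c h1 h2 =>
    ⟨fun h3 => mul_le_mul_of_nonneg_left ((hx.2 c h1 h2).1 h3) ht.le,
      fun h3 => mul_le_mul_of_nonneg_left ((hx.2 c h1 h2).2 h3) ht.le⟩⟩

theorem inner_add {x y : BSpace n} (hx : x ∈ A.inner) (hy : y ∈ A.inner) : x + y ∈ A.inner :=
  ⟨congrArg₂ (· + ·) hx.1 hy.1, fun c h1 h2 =>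
    ⟨fun h3 => add_lt_add ((hx.2 c h1 h2).1 h3) ((hy.2 c h1 h2).1 h3),
      fun h3 => add_lt_add ((hx.2 c h1 h2).2 h3) ((hy.2 c h1 h2).2 h3)⟩⟩

theorem inner_smul {x : BSpace n} (hx : x ∈ A.inner) {t : ℝ} (ht : 0 < t) : t • x ∈ A.inner :=
  ⟨congrArg (t * ·) hx.1, fun c h1 h2 =>
    ⟨fun h3 => mul_lt_mul_of_pos_left ((hx.2 c h1 h2).1 h3) ht,
      fun h3 => mul_lt_mul_of_pos_left ((hx.2 c h1 h2).2 h3) ht⟩⟩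

theorem shard_subset_hyper : A.shard ⊆ A.hyper := fun _ hy => hy.1

theorem shard_injective {A A' : SignedSubset n} (hA : A.m < A.M) (hA' : A'.m < A'.M)
    (h : A.shard = A'.shard) : A = A' := by
  have h1 : A.hyper = A'.hyper := by
    apply le_antisymm
    · refine (hyper_le_span hA).trans (Submodule.span_le.mpr ?_)
      rw [h]; exact shard_subset_hyper
    · refine (hyper_le_span hA').trans (Submodule.span_le.mpr ?_)
      rw [← h]; exact shard_subset_hyper
  obtain ⟨p, -, hp, -⟩ := exists_wall_gamma hA
  refine eq_of_inner hA hA' h1 hp (mem_inner_of_cut hA' (h ▸ inner_subset_shard hp) ?_)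
  exact h1 ▸ mem_cut_of_inner hA hp

theorem isShard_iff {T : Set (BSpace n)} : IsShard (arrB n) (baseB n) T ↔
    ∃ A : SignedSubset n, A.m < A.M ∧ T = A.shard := by
  constructor
  · rintro ⟨H, hT⟩
    obtain ⟨A, hA, -, h⟩ := isShardIn_iff.mp hT
    exact ⟨A, hA, h⟩
  · rintro ⟨A, hA, rfl⟩
    exact ⟨A.hyper, isShardIn_iff.mpr ⟨A, hA, rfl, rfl⟩⟩

theorem isShardIn_shard_iff (hA : A.m < A.M) {H : Submodule ℝ (BSpace n)} :
    IsShardIn (arrB n) (baseB n) H A.shard ↔ H = A.hyper := by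
  constructor
  · intro h
    obtain ⟨A', hA', h1, h2⟩ := isShardIn_iff.mp h
    rw [h1, shard_injective hA hA' h2]
  · rintro rfl
    exact isShardIn_iff.mpr ⟨A, hA, rfl, rfl⟩

/-- Moving a wall point of `gamma` slightly inside its hyperplane keeps it in both the region and
the shard, so their intersection spans the hyperplane. -/
theorem isUpperRegion_gamma (hA : A.m < A.M) :
    IsUpperRegion (arrB n) (baseB n) A.shard (regionB A.gamma) := by
  obtain ⟨p, hw, hp, hp'⟩ := exists_wall_gamma hA
  refine ⟨isRegion_arrB.mpr ⟨_, rfl⟩, ?_, A.hyper, (isShardIn_shard_iff hA).mpr rfl,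
    (hyp_mem_sepSet hA).mpr (A.pos_gamma)⟩
  rw [dim_add_eq_iff (finrank_hyp hA.ne') (Set.inter_subset_right.trans shard_subset_hyper)]
  refine le_span_of_perturb (p := p) ⟨hp' ▸ mem_regionB_topP p, inner_subset_shard hp⟩ fun u hu => ?_
  obtain ⟨ε, hε, h⟩ := eventually_perturb p u
  have hmem : p + ε • u ∈ A.hyper := A.hyper.add_mem hp.1 (A.hyper.smul_mem ε hu)
  refine ⟨ε, hε, ?_, hmem, fun c h1 h2 => ⟨fun h3 => ?_, fun h3 => ?_⟩⟩
  · rw [mem_regionB]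
    intro c d hcd
    rw [← hp', topP_lt] at hcd
    rcases hcd with hcd | ⟨hcd, hdc⟩
    · exact (h _ _ hcd).le
    · have h2 : (p + ε • u).1 A.M = (p + ε • u).1 A.m := hmem
      have h3 := coord_neg (p + ε • u) A.M
      have h4 := coord_neg (p + ε • u) A.m
      rw [hw.2] at hcd
      rcases hcd with rfl | ⟨rfl, rfl⟩ | ⟨rfl, rfl⟩ | ⟨rfl, rfl⟩ | ⟨rfl, rfl⟩ <;> linarith
  · exact (h _ _ ((hp.2 c h1 h2).1 h3)).le
  · exact (h _ _ ((hp.2 c h1 h2).2 h3)).le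

/-- A generic point p of the intersection has only the ties forced by the hyperplane. As u is on the
upper side, u = `topP p`, and `gamma_le_topP` applies. -/
theorem gamma_le_of_isUpperRegion (hA : A.m < A.M) {u : SignedPerm n}
    (h : IsUpperRegion (arrB n) (baseB n) A.shard (regionB u)) : A.gamma ≤ u := by
  obtain ⟨-, hdim, H, hH, hsep⟩ := h
  rw [isShardIn_shard_iff hA] at hH
  subst hH
  rw [hyper, hyp_mem_sepSet hA] at hsep
  rw [dim_add_eq_iff (finrank_hyp hA.ne') (Set.inter_subset_right.trans shard_subset_hyper)] at hdim
  obtain ⟨p, ⟨hpu, hpA⟩, hp⟩ := exists_generic_hyp (C := regionB u ∩ A.shard)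
    ⟨mem_regionB.mpr fun _ _ _ => le_rfl, zero_mem_shard⟩
    (fun x hx y hy => ⟨mem_regionB.mpr fun a b hab =>
      add_le_add (mem_regionB.mp hx.1 a b hab) (mem_regionB.mp hy.1 a b hab), shard_add hx.2 hy.2⟩)
    (fun x hx t ht => ⟨mem_regionB.mpr fun a b hab =>
      mul_le_mul_of_nonneg_left (mem_regionB.mp hx.1 a b hab) ht.le, shard_smul hx.2 ht⟩) hdim
  have hle := gamma_le_topP hA hpA
  convert hle using 1
  symm
  refine signedPerm_ext fun c d hcd => ?_
  rw [mem_regionB] at hpu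
  rcases pos_lt_or (w := u) (a := c) (b := d) (by rintro rfl; exact lt_irrefl _ hcd) with h | h
  · exact h
  · exfalso
    have h1 := hpu d c h
    rw [topP_lt] at hcd
    rcases hcd with hcd | ⟨h2, hdc⟩
    · exact absurd h1 (not_le.mpr hcd)
    · have h4 := hyp_le_hyp hdc.ne' (hp c d h2)
      have h5 := pos_lt_neg.mpr hsep
      rcases h4 with ⟨rfl, rfl⟩ | ⟨rfl, rfl⟩ | ⟨rfl, rfl⟩ | ⟨rfl, rfl⟩
      · exact h.asymm hsep
      · exact hdc.asymm hA
      · exact hdc.asymm (PM.neg_lt_neg.mpr hA)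
      · exact h.asymm h5

theorem isMinUpperRegion_iff {A A' : SignedSubset n} (hA : A.m < A.M) (hA' : A'.m < A'.M) :
    IsMinUpperRegion (arrB n) (baseB n) A'.shard (regionB A.gamma) ↔ A' = A := by
  constructor
  · rintro ⟨h1, h2⟩
    have h3 := h2 _ (isUpperRegion_gamma hA')
      (sepSet_subset_iff.mpr (gamma_le_of_isUpperRegion hA' h1))
    exact gamma_injective hA' hA (regionB_injective h3)
  · rintro rfl
    refine ⟨isUpperRegion_gamma hA, fun R hR hsub => ?_⟩
    obtain ⟨u, rfl⟩ := isRegion_arrB.mp hR.1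
    rw [le_antisymm (sepSet_subset_iff.mp hsub) (gamma_le_of_isUpperRegion hA hR)]

end SignedSubset

/-! ### Congruences of lattices with labelled covers -/

/-- A labelling of the covers of a lattice such that each label `s` is attained at the lower cover
`jl s ⋖ j s` of a join-irreducible element and at the upper cover `m s ⋖ mu s` of a meet-irreducible
element, and such that forcing between covers is described by the arrows between labels. -/
structure EdgeSystem (L S : Type*) [PartialOrder L] where
  edge : S → L → L → Prop
  j : S → L
  jl : S → L
  m : S → L
  mu : S → L
  Arr : S → S → Prop
  ht : S → ℤ
  exists_glb : ∀ x y : L, ∃ z, IsGLB {x, y} z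
  exists_lub : ∀ x y : L, ∃ z, IsLUB {x, y} z
  lt_of_edge : ∀ {s x y}, edge s x y → x < y
  exists_edge : ∀ {x y}, x < y → ∃ s u, edge s u y ∧ x ≤ u
  edge_j : ∀ s, edge s (jl s) (j s)
  edge_m : ∀ s, edge s (m s) (mu s)
  le_jl : ∀ {s x}, x < j s → x ≤ jl s
  mu_le : ∀ {s x}, m s < x → mu s ≤ x
  j_le : ∀ {s x y}, edge s x y → j s ≤ y
  j_not_le : ∀ {s x y}, edge s x y → ¬ j s ≤ x
  jl_le : ∀ {s x y}, edge s x y → jl s ≤ x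
  le_of_j_le : ∀ {s x y z}, edge s x y → x ≤ z → j s ≤ z → y ≤ z
  le_m : ∀ {s x y}, edge s x y → x ≤ m s
  not_le_m : ∀ {s x y}, edge s x y → ¬ y ≤ m s
  -- Forcing stays within arrow paths: an edge labelled s across which `j t` enters or `m t` is lost
  -- reaches t. In the other direction, `forces` supplies such an edge for each single arrow.
  reach_j : ∀ {s t x y}, edge s x y → j t ≤ y → ¬ j t ≤ x → Relation.ReflTransGen Arr s t
  reach_m : ∀ {s t x y}, edge s x y → x ≤ m t → ¬ y ≤ m t → Relation.ReflTransGen Arr s t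
  forces : ∀ {s t}, Arr s t → (∃ x y, edge s x y ∧ j t ≤ y ∧ ¬ j t ≤ x) ∨
    ∃ x y, edge s x y ∧ x ≤ m t ∧ ¬ y ≤ m t
  ht_lt : ∀ {s t}, Arr s t → ht s < ht t

namespace EdgeSystem

variable {L S : Type*} [PartialOrder L] (E : EdgeSystem L S)

theorem isGLB_left {x y : L} (h : x ≤ y) : IsGLB {x, y} x :=
  ⟨by simp [h], fun _ hz => hz (by simp)⟩

theorem isGLB_right {x y : L} (h : y ≤ x) : IsGLB {x, y} y :=
  ⟨by simp [h], fun _ hz => hz (by simp)⟩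

theorem isLUB_right {x y : L} (h : x ≤ y) : IsLUB {x, y} y :=
  ⟨by simp [h], fun _ hz => hz (by simp)⟩

theorem con_left {Θ : Con L} {x y z : L} (h : Θ.1 x z) (hxy : x ≤ y) (hyz : y ≤ z) : Θ.1 x y :=
  Θ.2.2 x z y y x y h (Θ.1.refl y) (isGLB_left hxy) (isGLB_right hyz)

theorem con_right {Θ : Con L} {x y z : L} (h : Θ.1 x z) (hxy : x ≤ y) (hyz : y ≤ z) : Θ.1 y z :=
  Θ.1.trans (Θ.1.symm (con_left h hxy hyz)) h

/-- The labels contracted by a congruence. -/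
def contracted (Θ : Con L) : Set S := {s | Θ.1 (E.jl s) (E.j s)}

/-- For an edge from x to y one has x ∧ j s = jl s and x ∨ j s = y, so it is perspective to the edge
below `j s`. -/
theorem con_edge_iff {Θ : Con L} {s : S} {x y : L} (h : E.edge s x y) :
    Θ.1 x y ↔ Θ.1 (E.jl s) (E.j s) := by
  have hjl := (E.lt_of_edge (E.edge_j s)).le
  constructor
  · intro h1
    refine Θ.2.2 x y (E.j s) (E.j s) _ _ h1 (Θ.1.refl _) ⟨?_, fun z hz => ?_⟩
      (isGLB_right (E.j_le h))
    · simpa using ⟨E.jl_le h, hjl⟩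
    · have h2 : z ≤ x := hz (by simp)
      have h3 : z ≤ E.j s := hz (by simp)
      exact E.le_jl (lt_of_le_of_ne h3 fun h4 => E.j_not_le h (h4 ▸ h2))
  · intro h1
    refine Θ.2.1 (E.jl s) (E.j s) x x _ _ h1 (Θ.1.refl _) (isLUB_right (E.jl_le h)) ⟨?_, fun z hz => ?_⟩
    · simpa using ⟨E.j_le h, (E.lt_of_edge h).le⟩
    · exact E.le_of_j_le h (hz (by simp)) (hz (by simp))

/-- Meeting the contracted edge with `j t` contracts an interval that ends at `j t` and contains `jl
t`; joining it with `m t` does the same dually. -/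
theorem contracted_closed (Θ : Con L) {s t : S} (hs : s ∈ E.contracted Θ) (h : E.Arr s t) :
    t ∈ E.contracted Θ := by
  rcases E.forces h with ⟨x, y, he, h1, h2⟩ | ⟨x, y, he, h1, h2⟩
  · have h3 := (E.con_edge_iff he).mpr hs
    obtain ⟨z, hz⟩ := E.exists_glb x (E.j t)
    have h4 : Θ.1 z (E.j t) :=
      Θ.2.2 x y (E.j t) (E.j t) _ _ h3 (Θ.1.refl _) hz (isGLB_right h1)
    have h5 : z ≤ x := hz.1 (by simp)
    have h6 : z ≤ E.j t := hz.1 (by simp)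
    have h7 := E.le_jl (lt_of_le_of_ne h6 fun h => h2 (h ▸ h5))
    exact con_right h4 h7 (E.lt_of_edge (E.edge_j t)).le
  · have h3 := (E.con_edge_iff he).mpr hs
    obtain ⟨z, hz⟩ := E.exists_lub y (E.m t)
    have h4 : Θ.1 (E.m t) z :=
      Θ.2.1 x y (E.m t) (E.m t) _ _ h3 (Θ.1.refl _) (isLUB_right h1) hz
    have h5 : y ≤ z := hz.1 (by simp)
    have h6 : E.m t ≤ z := hz.1 (by simp)
    have h7 := E.mu_le (lt_of_le_of_ne h6 fun h => h2 (h ▸ h5))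
    exact (E.con_edge_iff (E.edge_m t)).mp
      (con_left h4 (E.lt_of_edge (E.edge_m t)).le h7)

theorem mem_of_reach {D : Set S} (hD : ∀ s ∈ D, ∀ t, E.Arr s t → t ∈ D) {s t : S} (hs : s ∈ D)
    (h : Relation.ReflTransGen E.Arr s t) : t ∈ D := by
  induction h with
  | refl => exact hs
  | tail _ h ih => exact hD _ ih _ h

theorem ht_lt_of_transGen {s t : S} (h : Relation.TransGen E.Arr s t) : E.ht s < E.ht t := by
  induction h with
  | single h => exact E.ht_lt h
  | tail _ h ih => exact ih.trans (E.ht_lt h)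

theorem contracts_j_iff {Θ : Con L} {s : S} : Contracts Θ (E.j s) ↔ s ∈ E.contracted Θ := by
  have hlt := E.lt_of_edge (E.edge_j s)
  constructor
  · rintro ⟨v, hv, hΘ⟩
    have h1 := E.le_jl hv.lt
    rcases h1.eq_or_lt with rfl | h1
    · exact hΘ
    · exact absurd hlt (hv.2 h1)
  · intro h
    refine ⟨E.jl s, ⟨hlt, fun x hx hx' => ?_⟩, h⟩
    exact absurd (E.le_jl hx') hx.not_ge

variable [Finite L]

/-- Relations that are generated by the edges inside their classes. -/
theorem chain_induction (r r' : L → L → Prop) (refl : ∀ x, r' x x)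
    (trans : ∀ x y z, r' x y → r' y z → r' x z)
    (conv : ∀ x y z, r x z → x ≤ y → y ≤ z → r x y ∧ r y z)
    (edge : ∀ s x y, E.edge s x y → r x y → r' x y) {x y : L} (hxy : x ≤ y) (h : r x y) :
    r' x y := by
  induction y using (Finite.wellFounded_of_trans_of_irrefl (α := L) (· < ·)).induction with
  | _ y ih =>
    rcases hxy.eq_or_lt with rfl | h1
    · exact refl x
    · obtain ⟨s, u, hs, hu⟩ := E.exists_edge h1
      have h2 := E.lt_of_edge hs
      have h3 := conv _ _ _ h hu h2.le
      exact trans _ _ _ (ih u h2 hu h3.1) (edge _ _ _ hs h3.2)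

/-- A congruence is determined by the intervals it collapses, and a collapsed interval is a chain of
collapsed edges. -/
theorem con_le_iff {Θ Ψ : Con L} : Θ ≤ Ψ ↔ E.contracted Θ ⊆ E.contracted Ψ := by
  constructor
  · intro h s hs
    exact h hs
  · intro h x y hxy
    have key : ∀ {x y}, x ≤ y → Θ.1 x y → Ψ.1 x y := fun {x y} hle hr =>
      E.chain_induction (fun x y => Θ.1 x y) (fun x y => Ψ.1 x y) (fun x => Ψ.1.refl x)
        (fun x y z => Ψ.1.trans) (fun x y z h h1 h2 => ⟨con_left h h1 h2, con_right h h1 h2⟩)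
        (fun s x y he h1 => (E.con_edge_iff he).mpr (h ((E.con_edge_iff he).mp h1))) hle hr
    obtain ⟨z, hz⟩ := E.exists_glb x y
    have h1 : z ≤ x := hz.1 (by simp)
    have h2 : z ≤ y := hz.1 (by simp)
    have h3 : Θ.1 z y := Θ.2.2 x y y y _ _ hxy (Θ.1.refl _) hz (isGLB_left le_rfl)
    exact Ψ.1.trans (Ψ.1.symm (key h1 (Θ.1.trans h3 (Θ.1.symm hxy)))) (key h2 h3)

/-- For a set of labels closed under arrows: the same remaining join-irreducible elements lie below
two elements iff the same remaining meet-irreducible elements lie above them. -/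
theorem rel_iff {D : Set S} (hD : ∀ s ∈ D, ∀ t, E.Arr s t → t ∈ D) {x y : L} :
    (∀ t ∉ D, (E.j t ≤ x ↔ E.j t ≤ y)) ↔ ∀ t ∉ D, (x ≤ E.m t ↔ y ≤ E.m t) := by
  constructor
  · intro h
    have key : ∀ {x y}, x ≤ y → (∀ t ∉ D, (E.j t ≤ x ↔ E.j t ≤ y)) →
        ∀ t ∉ D, (x ≤ E.m t ↔ y ≤ E.m t) := fun {x y} hle hr =>
      E.chain_induction (fun x y => ∀ t ∉ D, (E.j t ≤ x ↔ E.j t ≤ y))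
        (fun x y => ∀ t ∉ D, (x ≤ E.m t ↔ y ≤ E.m t)) (fun x t _ => Iff.rfl)
        (fun x y z h1 h2 t ht => (h1 t ht).trans (h2 t ht))
        (fun x y z h h1 h2 => ⟨fun t ht => ⟨fun h3 => h3.trans h1, fun h3 =>
          (h t ht).mpr (h3.trans h2)⟩, fun t ht => ⟨fun h3 => h3.trans h2, fun h3 =>
          ((h t ht).mpr h3).trans h1⟩⟩)
        (fun s x y he h t ht => ⟨fun h1 => by
          by_contra h2
          -- The label of an edge inside a class lies in D, since `j s` separates its ends. Then t,
          -- being reachable from s, would lie in D too.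
          have h3 : s ∈ D := by
            by_contra h3
            exact E.j_not_le he ((h s h3).mpr (E.j_le he))
          exact ht (E.mem_of_reach hD h3 (E.reach_m he h1 h2)), fun h1 =>
          (E.lt_of_edge he).le.trans h1⟩) hle hr
    obtain ⟨z, hz⟩ := E.exists_glb x y
    have h1 : z ≤ x := hz.1 (by simp)
    have h2 : z ≤ y := hz.1 (by simp)
    have h3 : ∀ t ∉ D, E.j t ≤ x → E.j t ≤ z := fun t ht h4 =>
      hz.2 (by simpa using ⟨h4, (h t ht).mp h4⟩)
    intro t ht
    rw [← key h1 (fun t ht => ⟨fun h4 => h4.trans h1, h3 t ht⟩) t ht,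
      key h2 (fun t ht => ⟨fun h4 => h4.trans h2, fun h4 => h3 t ht ((h t ht).mpr h4)⟩) t ht]
  · intro h
    have key : ∀ {x y}, x ≤ y → (∀ t ∉ D, (x ≤ E.m t ↔ y ≤ E.m t)) →
        ∀ t ∉ D, (E.j t ≤ x ↔ E.j t ≤ y) := fun {x y} hle hr =>
      E.chain_induction (fun x y => ∀ t ∉ D, (x ≤ E.m t ↔ y ≤ E.m t))
        (fun x y => ∀ t ∉ D, (E.j t ≤ x ↔ E.j t ≤ y)) (fun x t _ => Iff.rfl)
        (fun x y z h1 h2 t ht => (h1 t ht).trans (h2 t ht))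
        (fun x y z h h1 h2 => ⟨fun t ht => ⟨fun h3 => h2.trans ((h t ht).mp h3), fun h3 =>
          h1.trans h3⟩, fun t ht => ⟨fun h3 => (h t ht).mp (h1.trans h3), fun h3 =>
          h2.trans h3⟩⟩)
        (fun s x y he h t ht => ⟨fun h1 => h1.trans (E.lt_of_edge he).le, fun h1 => by
          by_contra h2
          have h3 : s ∈ D := by
            by_contra h3
            exact E.not_le_m he ((h s h3).mp (E.le_m he))
          exact ht (E.mem_of_reach hD h3 (E.reach_j he h1 h2))⟩) hle hr
    obtain ⟨z, hz⟩ := E.exists_lub x y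
    have h1 : x ≤ z := hz.1 (by simp)
    have h2 : y ≤ z := hz.1 (by simp)
    have h3 : ∀ t ∉ D, x ≤ E.m t → z ≤ E.m t := fun t ht h4 =>
      hz.2 (by simpa using ⟨h4, (h t ht).mp h4⟩)
    intro t ht
    rw [key h1 (fun t ht => ⟨h3 t ht, fun h4 => h1.trans h4⟩) t ht,
      key h2 (fun t ht => ⟨fun h4 => h3 t ht ((h t ht).mpr h4), fun h4 => h2.trans h4⟩) t ht]

/-- The congruence contracting a set of labels closed under arrows. -/
def cong (D : Set S) (hD : ∀ s ∈ D, ∀ t, E.Arr s t → t ∈ D) : Con L :=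
  ⟨⟨fun x y => ∀ t ∉ D, (E.j t ≤ x ↔ E.j t ≤ y), fun _ _ _ => Iff.rfl,
    fun h t ht => (h t ht).symm, fun h h' t ht => (h t ht).trans (h' t ht)⟩, by
    constructor
    · intro a₁ a₂ b₁ b₂ c₁ c₂ ha hb hc₁ hc₂
      change ∀ t ∉ D, (E.j t ≤ c₁ ↔ E.j t ≤ c₂)
      change ∀ t ∉ D, (E.j t ≤ a₁ ↔ E.j t ≤ a₂) at ha
      change ∀ t ∉ D, (E.j t ≤ b₁ ↔ E.j t ≤ b₂) at hb
      -- Joins are tested against the elements `m t` above, meets against the elements `j t` below;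
      -- hence both descriptions of the relation are needed.
      rw [E.rel_iff hD] at ha hb ⊢
      intro t ht
      rw [isLUB_le_iff hc₁, isLUB_le_iff hc₂]
      simp [ha t ht, hb t ht]
    · intro a₁ a₂ b₁ b₂ c₁ c₂ ha hb hc₁ hc₂ t ht
      have ha' : E.j t ≤ a₁ ↔ E.j t ≤ a₂ := ha t ht
      have hb' : E.j t ≤ b₁ ↔ E.j t ≤ b₂ := hb t ht
      rw [le_isGLB_iff hc₁, le_isGLB_iff hc₂]
      simp [ha', hb']⟩

theorem contracted_cong (D : Set S) (hD : ∀ s ∈ D, ∀ t, E.Arr s t → t ∈ D) :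
    E.contracted (E.cong D hD) = D := by
  ext s
  constructor
  · intro h
    by_contra hs
    have h1 : E.j s ≤ E.jl s := (h s hs).mpr le_rfl
    exact absurd h1 (E.lt_of_edge (E.edge_j s)).not_ge
  · intro hs t ht
    refine ⟨fun h => h.trans (E.lt_of_edge (E.edge_j s)).le, fun h => ?_⟩
    by_contra h1
    exact ht (E.mem_of_reach hD hs (E.reach_j (E.edge_j s) h h1))

/-- The smallest congruence contracting the label `s`. -/
def principal (s : S) : Con L :=
  E.cong {t | Relation.ReflTransGen E.Arr s t} fun _ h _ h' => h.tail h'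

theorem contracted_principal (s : S) :
    E.contracted (E.principal s) = {t | Relation.ReflTransGen E.Arr s t} :=
  E.contracted_cong _ _

theorem principal_le_iff {s : S} {Θ : Con L} : E.principal s ≤ Θ ↔ s ∈ E.contracted Θ := by
  rw [E.con_le_iff, contracted_principal]
  constructor
  · intro h; exact h .refl
  · intro h t ht
    exact E.mem_of_reach (fun s hs t h => E.contracted_closed Θ hs h) h ht

theorem principal_le_principal {s t : S} :
    E.principal t ≤ E.principal s ↔ Relation.ReflTransGen E.Arr s t := by
  rw [principal_le_iff, contracted_principal]; rfl

/-- Two labels reaching each other would form a cycle, which `ht` excludes. -/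
theorem principal_injective : Function.Injective E.principal := by
  intro s t h
  have h1 := E.principal_le_principal.mp h.le
  have h2 := E.principal_le_principal.mp h.ge
  rcases Relation.reflTransGen_iff_eq_or_transGen.mp h1 with h1 | h1
  · exact h1
  rcases Relation.reflTransGen_iff_eq_or_transGen.mp h2 with h2 | h2
  · exact h2.symm
  exact absurd (E.ht_lt_of_transGen h1) (E.ht_lt_of_transGen h2).asymm

theorem principal_lt_principal {s t : S} :
    E.principal t < E.principal s ↔ Relation.TransGen E.Arr s t := by
  constructor
  · intro h
    have h1 := E.principal_le_principal.mp h.le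
    rcases Relation.reflTransGen_iff_eq_or_transGen.mp h1 with rfl | h1
    · exact absurd h (lt_irrefl _)
    · exact h1
  · intro h
    refine lt_of_le_of_ne (E.principal_le_principal.mpr h.to_reflTransGen) fun h1 => ?_
    have := E.principal_injective h1
    subst this
    exact lt_irrefl _ (E.ht_lt_of_transGen h)

/-- The labels reached from s by nonempty paths form a closed set without s. Its congruence bounds
every congruence strictly below that of s, so these cannot join to it. -/
theorem isJoinIrr_principal (s : S) : IsJoinIrr (E.principal s) := by
  intro 𝒮 h𝒮
  by_contra hcon
  have hD : ∀ t ∈ {t | Relation.TransGen E.Arr s t}, ∀ u, E.Arr t u →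
      u ∈ {t | Relation.TransGen E.Arr s t} := fun t h u h' => Relation.TransGen.tail h h'
  have h1 : E.principal s ≤ E.cong _ hD := by
    refine h𝒮.2 fun Θ hΘ => ?_
    rw [E.con_le_iff, contracted_cong]
    intro t ht
    have h2 := h𝒮.1 hΘ
    have h3 := E.con_le_iff.mp h2 ht
    rw [contracted_principal] at h3
    rcases Relation.reflTransGen_iff_eq_or_transGen.mp h3 with rfl | h4
    · exact absurd (le_antisymm h2 (E.principal_le_iff.mpr ht) ▸ hΘ) hcon
    · exact h4
  rw [principal_le_iff, contracted_cong] at h1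
  exact lt_irrefl _ (E.ht_lt_of_transGen h1)

/-- Every congruence is the join of the principal congruences of the labels that it contracts. -/
theorem exists_principal_of_isJoinIrr {Θ : Con L} (h : IsJoinIrr Θ) : ∃ s, E.principal s = Θ := by
  have h1 : IsLUB (E.principal '' E.contracted Θ) Θ := by
    constructor
    · rintro _ ⟨s, hs, rfl⟩
      exact E.principal_le_iff.mpr hs
    · intro Ψ hΨ
      rw [E.con_le_iff]
      intro s hs
      exact E.principal_le_iff.mp (hΨ ⟨s, hs, rfl⟩)
  obtain ⟨s, -, hs⟩ := h _ h1
  exact ⟨s, hs⟩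

/-- Labels correspond to join-irreducible congruences. -/
noncomputable def principalEquiv : S ≃ {Θ : Con L // IsJoinIrr Θ} :=
  Equiv.ofBijective (fun s => ⟨E.principal s, E.isJoinIrr_principal s⟩)
    ⟨fun _ _ h => E.principal_injective (Subtype.ext_iff.mp h),
      fun Θ => (E.exists_principal_of_isJoinIrr Θ.2).imp fun _ h => Subtype.ext h⟩

theorem isLeast_principal (s : S) : IsLeast {Θ : Con L | Contracts Θ (E.j s)} (E.principal s) := by
  constructor
  · exact E.contracts_j_iff.mpr (E.principal_le_iff.mp le_rfl)
  · intro Θ hΘ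
    exact E.principal_le_iff.mpr (E.contracts_j_iff.mp hΘ)

end EdgeSystem
namespace SignedSubset

variable {n : ℕ}

/-! ### Arrows between shards -/

/-- The arrow from the shard of `A₁` to the shard of `A₂`, by a point of codimension two in both. -/
def Arr (A₁ A₂ : SignedSubset n) : Prop :=
  ∃ p ∈ A₁.inner, p ∈ A₂.shard ∧
    (∃ e, A₂.m < e ∧ e < A₂.M ∧ A₁.hyper ⊓ A₂.hyper ≤ hyp A₂.M e) ∧
    ∀ c, A₂.m < c → c < A₂.M → p.1 c = p.1 A₂.m → A₁.hyper ⊓ A₂.hyper ≤ hyp A₂.M c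

theorem not_hyper_le {A : SignedSubset n} {e : PM n} (h1 : A.m < e) (h2 : e < A.M) :
    ¬ A.hyper ≤ hyp A.M e := by
  intro h
  have := hyp_le_hyp h2.ne' h
  simp only [PM.eq_iff, PM.lt_iff, PM.coe_neg] at *
  omega

theorem Arr.hyper_ne {A₁ A₂ : SignedSubset n} (h : Arr A₁ A₂) : A₁.hyper ≠ A₂.hyper := by
  obtain ⟨p, -, -, ⟨e, h1, h2, h3⟩, -⟩ := h
  intro h4
  rw [h4, inf_idem] at h3
  exact not_hyper_le h1 h2 h3

/-- A generic point of the intersection of the shards has only the ties forced by the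
codimension-two space. Conversely, such a point can be moved slightly in every direction of that
space without leaving either shard. -/
theorem shArrow_iff {A₁ A₂ : SignedSubset n} (h₁ : A₁.m < A₁.M) (h₂ : A₂.m < A₂.M) :
    ShArrow (arrB n) (baseB n) A₁.shard A₂.shard ↔ Arr A₁ A₂ := by
  have hsub : A₁.shard ∩ A₂.shard ⊆ (A₁.hyper ⊓ A₂.hyper : Submodule ℝ (BSpace n)) :=
    fun x hx => ⟨shard_subset_hyper hx.1, shard_subset_hyper hx.2⟩
  constructor
  · rintro ⟨H₁, H₂, hH₁, hH₂, ⟨hb, -, hnb⟩, hdim⟩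
    rw [isShardIn_shard_iff h₁] at hH₁
    rw [isShardIn_shard_iff h₂] at hH₂
    subst hH₁ hH₂
    have hne : A₁.hyper ≠ A₂.hyper := by
      intro h
      rw [h, inf_idem] at hb hnb
      exact hnb hb
    have hb' := (isBasic_iff (U := A₁.hyper ⊓ A₂.hyper) h₁ inf_le_left).mp hb
    have hnb' := (isBasic_iff (U := A₁.hyper ⊓ A₂.hyper) h₂ inf_le_right).not.mp hnb
    push Not at hnb'
    rw [dim_add_eq_iff (finrank_inf_hyp h₁.ne' h₂.ne' hne) hsub] at hdim
    obtain ⟨p, ⟨hp1, hp2⟩, hp⟩ := exists_generic_hyp (C := A₁.shard ∩ A₂.shard)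
      ⟨zero_mem_shard, zero_mem_shard⟩
      (fun x hx y hy => ⟨shard_add hx.1 hy.1, shard_add hx.2 hy.2⟩)
      (fun x hx t ht => ⟨shard_smul hx.1 ht, shard_smul hx.2 ht⟩) hdim
    refine ⟨p, mem_inner_of_shard hp1 fun c hc1 hc2 hc3 => ?_, hp2, hnb', fun c _ _ hc3 => ?_⟩
    · exact hb' c hc1 hc2 (hp _ _ (hp1.1.trans hc3.symm))
    · exact hp _ _ (hp2.1.trans hc3.symm)
  · intro harr
    have hne := harr.hyper_ne
    obtain ⟨p, hp1, hp2, ⟨e, he1, he2, he3⟩, hp⟩ := harr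
    refine ⟨A₁.hyper, A₂.hyper, (isShardIn_shard_iff h₁).mpr rfl, (isShardIn_shard_iff h₂).mpr rfl,
      ⟨?_, hyp_mem_arrB h₂.ne', ?_⟩, ?_⟩
    · refine (isBasic_iff h₁ inf_le_left).mpr fun c hc1 hc2 hc3 => inner_ne hp1 hc1 hc2 ?_
      have h3 : p ∈ hyp A₁.M c := hc3 ⟨hp1.1, hp2.1⟩
      exact (mem_hyp.mp h3).symm.trans hp1.1
    · refine (isBasic_iff (U := A₁.hyper ⊓ A₂.hyper) h₂ inf_le_right).not.mpr ?_
      push Not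
      exact ⟨e, he1, he2, he3⟩
    · rw [dim_add_eq_iff (finrank_inf_hyp h₁.ne' h₂.ne' hne) hsub]
      refine le_span_of_perturb (p := p) ⟨inner_subset_shard hp1, hp2⟩ fun u hu => ?_
      obtain ⟨ε, hε, h⟩ := eventually_perturb p u
      have hU : p + ε • u ∈ A₁.hyper ⊓ A₂.hyper :=
        Submodule.add_mem _ ⟨hp1.1, hp2.1⟩ (Submodule.smul_mem _ ε hu)
      refine ⟨ε, hε, ⟨hU.1, fun c hc1 hc2 => ⟨fun hc3 => ?_, fun hc3 => ?_⟩⟩,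
        ⟨hU.2, fun c hc1 hc2 => ?_⟩⟩
      · exact (h _ _ ((hp1.2 c hc1 hc2).1 hc3)).le
      · exact (h _ _ ((hp1.2 c hc1 hc2).2 hc3)).le
      · by_cases hc : p.1 c = p.1 A₂.m
        · have h3 := mem_hyp.mp (hp c hc1 hc2 hc hU)
          have h4 : (p + ε • u).1 A₂.M = (p + ε • u).1 A₂.m := hU.2
          exact ⟨fun _ => (h3.symm.trans h4).le, fun _ => (h3.symm.trans h4).ge⟩
        · exact ⟨fun hc3 => (h _ _ (lt_of_le_of_ne ((hp2.2 c hc1 hc2).1 hc3) hc)).le,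
            fun hc3 => (h _ _ (lt_of_le_of_ne ((hp2.2 c hc1 hc2).2 hc3) (Ne.symm hc))).le⟩

/-! ### Negation of shards -/

theorem neg_mem_cut {A : SignedSubset n} (hA : A.m < A.M) {x : BSpace n}
    (h : x ∈ cutHyperplane (arrB n) (baseB n) A.hyper) :
    -x ∈ cutHyperplane (arrB n) (baseB n) A.hyper := by
  rw [hyper, cutHyperplane_hyp hA] at *
  refine ⟨?_, fun c h1 h2 h3 => h.2 c h1 h2 ?_⟩
  · rw [neg_coord, neg_coord, h.1]
  · rwa [neg_coord, neg_coord, _root_.neg_inj] at h3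

/-- The cuts are symmetric under x ↦ -x, so the antipode of a shard is a shard. Its encoding is the
label of -p for a wall point p; the normalized name of the hyperplane may switch. -/
theorem exists_neg {A : SignedSubset n} (hA : A.m < A.M) :
    ∃ A' : SignedSubset n, A'.m < A'.M ∧ A'.hyper = A.hyper ∧ ∀ x ∈ A.shard, -x ∈ A'.shard := by
  obtain ⟨p, hp, hpA, -⟩ := exists_wall_gamma hA
  obtain ⟨A', hA', hh, -, hpA'⟩ := exists_label hp.neg
  refine ⟨A', hA', hh, fun x hx => ?_⟩
  rcases (hyper_eq_iff hA hA').mp hh.symm with ⟨h1, h2⟩ | ⟨h1, h2⟩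
  · refine ⟨by rw [h1, h2, neg_coord, neg_coord, hx.1], fun c h3 h4 => ?_⟩
    have h5 := inner_lt_iff hpA' h3 h4
    rw [h2] at h3 h5 ⊢
    rw [h1] at h4
    have h6 := inner_ne hpA h3 h4
    simp only [neg_coord, neg_lt_neg_iff, neg_le_neg_iff] at h5 ⊢
    rw [← h5]
    constructor
    · intro h7
      exact (hx.2 c h3 h4).2 fun h8 => h7.asymm ((hpA.2 c h3 h4).1 h8)
    · intro h7
      refine (hx.2 c h3 h4).1 ?_
      by_contra h8
      exact h7 ((hpA.2 c h3 h4).2 h8)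
  · refine ⟨by rw [h1, h2, neg_coord, neg_coord, coord_neg, coord_neg, hx.1], fun c h3 h4 => ?_⟩
    have h5 := inner_lt_iff hpA' h3 h4
    rw [h2] at h3 h5 ⊢
    rw [h1] at h4
    have h3' : -c < A.M := by rw [← PM.neg_lt_neg, PM.neg_neg]; exact h3
    have h4' : A.m < -c := by rw [← PM.neg_lt_neg, PM.neg_neg]; exact h4
    have h6 := inner_lt_iff hpA h4' h3'
    have h7 := hx.2 (-c) h4' h3'
    rw [coord_neg, ← hpA.1] at h6
    rw [coord_neg, ← hx.1] at h7
    simp only [neg_coord, coord_neg, _root_.neg_neg] at h5 ⊢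
    rw [← h5, h6]
    exact h7

end SignedSubset

open SignedSubset

/-- Admissible signed subsets. -/
abbrev Adm (n : ℕ) : Type := {A : SignedSubset n // A.m < A.M}

namespace Adm

variable {n : ℕ}

/-- The admissible signed subset encoding the negative of the shard of `A`. -/
noncomputable def neg (A : Adm n) : Adm n :=
  ⟨(exists_neg A.2).choose, (exists_neg A.2).choose_spec.1⟩

theorem neg_hyper (A : Adm n) : A.neg.1.hyper = A.1.hyper := (exists_neg A.2).choose_spec.2.1

theorem neg_shard {A : Adm n} {x : BSpace n} (hx : x ∈ A.1.shard) : -x ∈ A.neg.1.shard :=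
  (exists_neg A.2).choose_spec.2.2 x hx

theorem neg_inner {A : Adm n} {x : BSpace n} (hx : x ∈ A.1.inner) : -x ∈ A.neg.1.inner := by
  refine mem_inner_of_cut A.neg.2 (neg_shard (inner_subset_shard hx)) ?_
  rw [neg_hyper]
  exact neg_mem_cut A.2 (mem_cut_of_inner A.2 hx)

theorem neg_neg (A : Adm n) : A.neg.neg = A := by
  obtain ⟨p, -, hp, -⟩ := exists_wall_gamma A.2
  have h := neg_inner (neg_inner hp)
  rw [_root_.neg_neg] at h
  exact Subtype.ext (eq_of_inner A.neg.neg.2 A.2 (by rw [neg_hyper, neg_hyper]) h hp)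

theorem neg_names (A : Adm n) : (A.neg.1.M = A.1.M ∧ A.neg.1.m = A.1.m) ∨
    (A.neg.1.M = -A.1.m ∧ A.neg.1.m = -A.1.M) :=
  (hyper_eq_iff A.2 A.neg.2).mp A.neg_hyper.symm

theorem neg_wall {A : Adm n} {p : BSpace n} (h : Wall A.1.M A.1.m p) :
    Wall A.neg.1.M A.neg.1.m (-p) := by
  rcases A.neg_names with ⟨h1, h2⟩ | ⟨h1, h2⟩
  · rw [h1, h2]; exact h.neg
  · rw [h1, h2]; exact h.neg.swap

theorem arr_neg {A₁ A₂ : Adm n} (h : Arr A₁.1 A₂.1) : Arr A₁.neg.1 A₂.neg.1 := by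
  obtain ⟨p, hp1, hp2, ⟨e, he1, he2, he3⟩, hp⟩ := h
  have hU : A₁.1.hyper ⊓ A₂.1.hyper ≤ hyp A₂.1.M A₂.1.m := inf_le_right
  have hU' : ∀ {c}, A₁.1.hyper ⊓ A₂.1.hyper ≤ hyp A₂.1.M (-c) →
      A₁.1.hyper ⊓ A₂.1.hyper ≤ hyp (-A₂.1.m) c := by
    intro c hc x hx
    have h1 := mem_hyp.mp (hU hx)
    have h2 := mem_hyp.mp (hc hx)
    rw [coord_neg] at h2
    rw [mem_hyp, coord_neg]
    linarith
  refine ⟨-p, neg_inner hp1, neg_shard hp2, ?_, ?_⟩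
  · rw [neg_hyper, neg_hyper]
    rcases A₂.neg_names with ⟨h1, h2⟩ | ⟨h1, h2⟩
    · rw [h1, h2]; exact ⟨e, he1, he2, he3⟩
    · rw [h1, h2]
      exact ⟨-e, PM.neg_lt_neg.mpr he2, PM.neg_lt_neg.mpr he1, hU' (by rwa [PM.neg_neg])⟩
  · rw [neg_hyper, neg_hyper]
    rcases A₂.neg_names with ⟨h1, h2⟩ | ⟨h1, h2⟩
    · rw [h1, h2]
      intro c hc1 hc2 hc3
      exact hp c hc1 hc2 (_root_.neg_inj.mp hc3)
    · rw [h1, h2]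
      intro c hc1 hc2 hc3
      refine hU' (hp (-c) ?_ ?_ ?_)
      · rw [← PM.neg_lt_neg, PM.neg_neg]; exact hc2
      · rw [← PM.neg_lt_neg, PM.neg_neg]; exact hc1
      · have h3 := hp2.1
        rw [neg_coord, neg_coord, coord_neg] at hc3
        rw [coord_neg]
        linarith

/-! ### Covers of the weak order crossing a shard -/

/-- The cover `x ⋖ y` crosses the shard of `A`. -/
def Edge (A : Adm n) (x y : SignedPerm n) : Prop :=
  ∃ p, Wall A.1.M A.1.m p ∧ p ∈ A.1.inner ∧ botP p = x ∧ topP p = y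

theorem edge_neg {A : Adm n} {x y : SignedPerm n} (h : A.Edge x y) :
    A.neg.Edge (negP y) (negP x) := by
  obtain ⟨p, h1, h2, rfl, rfl⟩ := h
  exact ⟨-p, neg_wall h1, neg_inner h2, botP_neg p, topP_neg p⟩

/-- No cut passes through p, so no index tied with M and m lies between them. This holds even if p
lies on further hyperplanes. -/
theorem step_topP {A : SignedSubset n} (hA : A.m < A.M) {p : BSpace n} (hp : p ∈ A.inner) :
    Step (topP p) A.M A.m := by
  refine ⟨topP_lt.mpr (Or.inr ⟨hp.1, hA⟩), fun c hc => ?_⟩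
  by_contra h
  rw [not_le, topP_lt] at h
  rw [topP_lt] at hc
  have h1 := hp.1
  rcases hc with hc | hc <;> rcases h with h | h
  · linarith
  · linarith [h.1]
  · linarith [hc.1]
  · exact inner_ne hp h.2 hc.2 h.1

/-- A wall of the hyperplane of `A` next to a point `p` of the interior of the shard lies in the
interior of the shard. -/
theorem mem_inner_of_wall {A : SignedSubset n} {p q : BSpace n} (hp : p ∈ A.inner)
    (hq : Wall A.M A.m q) (h1 : botP p ≤ topP q) (h2 : topP q ≤ topP p) : q ∈ A.inner := by
  refine ⟨hq.eq, fun c hc1 hc2 => ⟨fun h => ?_, fun h => ?_⟩⟩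
  · have h3 := refines_lt h2 h1 ((hp.2 c hc1 hc2).1 h)
    rw [topP_lt] at h3
    exact h3.resolve_right fun h => h.2.asymm hc1
  · have h3 := (hp.2 c hc1 hc2).2 h
    rw [← hp.1] at h3
    have h4 := refines_lt h2 h1 h3
    rw [topP_lt, hq.eq] at h4
    exact h4.resolve_right fun h => h.2.asymm hc2

theorem exists_edge_topP (A : Adm n) {p : BSpace n} (hp : p ∈ A.1.inner) :
    ∃ q, Wall A.1.M A.1.m q ∧ q ∈ A.1.inner ∧ topP q = topP p := by
  obtain ⟨q, hq, hqp⟩ := exists_wall (step_topP A.2 hp) A.2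
  exact ⟨q, hq, mem_inner_of_wall hp hq (hqp ▸ botP_le_topP p) hqp.le, hqp⟩

/-- The cover ending at `topP p` crosses the first shard; its lower end does not invert the
hyperplane of A₁, while `gamma` of A₂ does. -/
theorem forces_of_inverted {A₁ A₂ : Adm n} (h : Arr A₁.1 A₂.1)
    (hpos : pos A₂.1.gamma A₁.1.M < pos A₂.1.gamma A₁.1.m) :
    ∃ x y, A₁.Edge x y ∧ A₂.1.gamma ≤ y ∧ ¬ A₂.1.gamma ≤ x := by
  obtain ⟨p, hp1, hp2, -, -⟩ := h
  obtain ⟨q, hq, hq1, hqp⟩ := A₁.exists_edge_topP hp1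
  exact ⟨_, _, ⟨q, hq, hq1, rfl, rfl⟩, hqp ▸ gamma_le_topP A₂.2 hp2, hq.not_le_botP hpos⟩

/-- An arrow forces a cover of the second shard to be crossed below a cover of the first shard, or
dually. -/
theorem inverted_or {A₁ A₂ : Adm n} (h : Arr A₁.1 A₂.1) :
    pos A₂.1.gamma A₁.1.M < pos A₂.1.gamma A₁.1.m ∨
      pos A₂.neg.1.gamma A₁.1.M < pos A₂.neg.1.gamma A₁.1.m := by
  by_contra hcon
  push Not at hcon
  have hne := A₁.2.ne
  have h1 := lt_of_le_of_ne hcon.1 fun h => hne (pos_injective _ h)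
  have h2 := lt_of_le_of_ne hcon.2 fun h => hne (pos_injective _ h)
  obtain ⟨q, -, hq, hqt⟩ := exists_wall_gamma A₂.2
  obtain ⟨r, -, hr, hrt⟩ := exists_wall_gamma A₂.neg.2
  obtain ⟨p, -, -, ⟨e, he1, he2, he3⟩, -⟩ := h
  rw [← hqt, topP_lt] at h1
  rw [← hrt, topP_lt] at h2
  have h1' := h1.resolve_right fun h => h.2.asymm A₁.2
  have h2' := h2.resolve_right fun h => h.2.asymm A₁.2
  have hr' := neg_inner hr
  rw [neg_neg] at hr'
  -- If both failed, the interior of the second shard would have points q and -r on opposite sides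
  -- of the hyperplane of A₁. This positive combination lies on that hyperplane, hence on the cut at
  -- e, yet it is interior.
  have hz := inner_add (inner_smul hq (sub_pos.mpr h2')) (inner_smul hr' (sub_pos.mpr h1'))
  refine inner_ne hz he1 he2 ?_
  have hU := he3 (x := (r.1 A₁.1.m - r.1 A₁.1.M) • q + (q.1 A₁.1.m - q.1 A₁.1.M) • -r) ⟨?_, hz.1⟩
  · exact (mem_hyp.mp hU).symm.trans hz.1
  · change _ = _
    simp only [add_coord, smul_coord, neg_coord]
    ring

end Adm
open SignedSubset

/-! ### Forcing along the covers of the weak order -/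

/-- Additional ties under the same top can only remove inversions from the bottom. -/
theorem botP_le_botP_of_ties {n : ℕ} {p r : BSpace n} (ht : topP p = topP r)
    (h : ∀ c d, p.1 c = p.1 d → r.1 c = r.1 d) : botP r ≤ botP p := by
  apply botP_le_of
  intro c d hcd h1
  rw [botP_lt] at h1
  rcases h1 with h1 | h1
  · have h2 : pos (topP r) c < pos (topP r) d := by rw [← ht, topP_lt]; exact Or.inl h1
    rw [topP_lt] at h2
    rcases h2 with h2 | h2
    · exact h2.le
    · exact h2.1.ge
  · exact (h _ _ h1.1).ge

namespace Adm

variable {n : ℕ}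

/-- A generic point `r` of the common face of two lower walls `p`, `q` of the same signed
permutation. -/
theorem exists_commonFace {a b c d : PM n} {p q : BSpace n} (hp : Wall a b p) (hq : Wall c d q)
    (h : topP p = topP q) : ∃ r : BSpace n, topP r = topP p ∧ botP r ≤ botP p ∧ botP r ≤ botP q ∧
      r ∈ hyp a b ⊓ hyp c d ∧ (∀ e f, r.1 e = r.1 f → hyp a b ⊓ hyp c d ≤ hyp e f) ∧
      ∀ e f, Step (topP p) e f → r.1 e = r.1 f →
        (e = a ∧ f = b) ∨ (e = -b ∧ f = -a) ∨ (e = c ∧ f = d) ∨ (e = -d ∧ f = -c) := by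
  set y := topP p with hy
  have hsp : Step y a b := hp.step
  have hsq : Step y c d := by rw [h]; exact hq.step
  let J : PM n → PM n → Prop := fun e f =>
    (e = a ∧ f = b) ∨ (e = -b ∧ f = -a) ∨ (e = c ∧ f = d) ∨ (e = -d ∧ f = -c)
  obtain ⟨r, hr1, hr2⟩ := exists_facePoint y J (by
    rintro e f (⟨rfl, rfl⟩ | ⟨rfl, rfl⟩ | ⟨rfl, rfl⟩ | ⟨rfl, rfl⟩) <;> simp [J])
  -- A tie at r is a chain of steps in `J`, so every transitive relation containing `J` holds
  -- between tied indices, taken in the order of y.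
  have hchain : ∀ R : PM n → PM n → Prop, (∀ k l m, R k l → R l m → R k m) →
      (∀ k l, J k l → R k l) → ∀ e f, pos y e < pos y f → r.1 e = r.1 f → R e f := by
    intro R htr hJR e f hef hrr
    have h1 := (hr2 e f hef).mp hrr
    have h2 : Relation.TransGen R e f := Relation.TransGen.mono
      (fun k l hkl => hJR k l (h1 k l hkl.1 hkl.2.1 hkl.2.2)) _ _ (step_chain hef)
    clear hef hrr h1
    induction h2 with
    | single h => exact h
    | tail _ h ih => exact htr _ _ _ ih h
  have hdesc : ∀ e f, pos y e < pos y f → r.1 e = r.1 f → f < e := by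
    refine hchain (fun e f => f < e) (fun k l m h1 h2 => h2.trans h1) ?_
    rintro e f (⟨rfl, rfl⟩ | ⟨rfl, rfl⟩ | ⟨rfl, rfl⟩ | ⟨rfl, rfl⟩)
    · exact hp.1
    · exact PM.neg_lt_neg.mpr hp.1
    · exact hq.1
    · exact PM.neg_lt_neg.mpr hq.1
  have htop : topP r = y := by
    refine signedPerm_ext fun e f hef => ?_
    rcases pos_lt_or (w := y) (a := e) (b := f) (by rintro rfl; exact lt_irrefl _ hef) with h1 | h1
    · exact h1
    · rw [topP_lt] at hef
      rcases hef with h2 | ⟨h2, h3⟩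
      · exact absurd (hr1 _ _ h1) (not_le.mpr h2)
      · exact absurd (hdesc _ _ h1 h2.symm) h3.asymm
  have htie : ∀ e f, Step y e f → J e f → r.1 e = r.1 f := by
    intro e f hs hJ
    rw [hr2 e f hs.1]
    intro k l hkl h1 h2
    obtain ⟨rfl, rfl⟩ := hs.unique hkl h1 h2
    exact hJ
  have hab := htie a b hsp (by simp [J])
  have hcd := htie c d hsq (by simp [J])
  have hties : ∀ {a b : PM n} {p : BSpace n}, Wall a b p → r.1 a = r.1 b →
      ∀ e f, p.1 e = p.1 f → r.1 e = r.1 f := by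
    intro a b p hp hab e f hef
    have h1 := coord_neg r a
    have h2 := coord_neg r b
    rw [hp.2] at hef
    rcases hef with rfl | ⟨rfl, rfl⟩ | ⟨rfl, rfl⟩ | ⟨rfl, rfl⟩ | ⟨rfl, rfl⟩ <;> linarith
  refine ⟨r, htop, botP_le_botP_of_ties htop.symm (hties hp hab),
    botP_le_botP_of_ties (h.symm.trans htop.symm) (hties hq hcd), ⟨hab, hcd⟩, ?_, ?_⟩
  · have h1 := hchain (fun e f => hyp a b ⊓ hyp c d ≤ hyp e f)
      (fun k l m h1 h2 x hx => (mem_hyp.mp (h1 hx)).trans (mem_hyp.mp (h2 hx))) (by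
        rintro e f (⟨rfl, rfl⟩ | ⟨rfl, rfl⟩ | ⟨rfl, rfl⟩ | ⟨rfl, rfl⟩)
        · exact inf_le_left
        · rw [hyp_swap]; exact inf_le_left
        · exact inf_le_right
        · rw [hyp_swap]; exact inf_le_right)
    intro e f hef
    by_cases hne : e = f
    · subst hne; exact fun x _ => rfl
    rcases pos_lt_or (w := y) hne with h2 | h2
    · exact h1 e f h2 hef
    · rw [hyp_comm e f]; exact h1 f e h2 hef.symm
  · intro e f hs hef
    exact (hr2 e f hs.1).mp hef e f hs le_rfl le_rfl

/-- If the join-irreducible element of `A'` lies below the top but not below the bottom of a cover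
crossing the shard of `A`, then `A'` can be reached from `A`. -/
theorem reach_of_wall (A' : Adm n) (y : SignedPerm n) : ∀ (A : Adm n) (p : BSpace n),
    Wall A.1.M A.1.m p → p ∈ A.1.inner → topP p = y → A'.1.gamma ≤ y → ¬ A'.1.gamma ≤ botP p →
    Relation.ReflTransGen (fun B C : Adm n => Arr B.1 C.1) A A' := by
  induction y using (Finite.wellFounded_of_trans_of_irrefl (α := SignedPerm n) (· < ·)).induction with
  | _ y ih =>
  intro A p hp hpA hpy hle hnle
  rcases hle.eq_or_lt with heq | hlt
  · have : A = A' := Subtype.ext (eq_of_topP_eq_gamma A.2 A'.2 hp hpA (hpy.trans heq.symm))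
    rw [this]
  -- Now `gamma` of A' lies below the bottom of another lower wall q of y. The polygon is the
  -- interval from `botP r` to y, with r generic in the common face of p and q.
  obtain ⟨a, b, q, hq, hqy, hAq⟩ := exists_lower_wall hlt
  obtain ⟨r, hrt, hrp, hrq, hrU, hrtie, hrstep⟩ := exists_commonFace hp hq (hpy.trans hqy.symm)
  -- Choose v minimal above `gamma` of A' on the q-side of the polygon. It is not `botP r`, which
  -- lies below `botP p`. The label A₂ of an edge from v down inside the polygon reaches A' by
  -- induction, so it remains to find A = A₂ or an arrow from A to A₂.
  obtain ⟨v, ⟨hv1, hv2, hv3⟩, hmin⟩ :=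
    (Finite.wellFounded_of_trans_of_irrefl (α := SignedPerm n) (· < ·)).has_min
      {v | A'.1.gamma ≤ v ∧ botP r ≤ v ∧ v ≤ botP q} ⟨botP q, hAq, hrq, le_rfl⟩
  have hvr : botP r < v := lt_of_le_of_ne hv2 fun h => hnle (h ▸ hv1 |>.trans hrp)
  obtain ⟨c, d, q', hq', hq'v, hrq'⟩ := exists_lower_wall hvr
  obtain ⟨A₂, hA₂, -, hw₂, hi₂⟩ := exists_label hq'
  have hq'lt := hq'v ▸ hq'.botP_lt_topP
  have hnle' : ¬ A'.1.gamma ≤ botP q' := fun h =>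
    hmin _ ⟨h, hrq', hq'lt.le.trans hv3⟩ hq'lt
  have hvy : v < y := lt_of_le_of_lt hv3 (hqy ▸ hq.botP_lt_topP)
  refine Relation.ReflTransGen.trans ?_ (ih v hvy ⟨A₂, hA₂⟩ q' hw₂ hi₂ hq'v hv1 hnle')
  have hvtop : v ≤ topP r := by rw [hrt, hpy]; exact hvy.le
  have hr2 : r.1 A₂.M = r.1 A₂.m := by
    apply le_antisymm
    · have h1 := hq'lt.le.trans hvtop
      exact refines h1 hrq' hw₂.pos_botP
    · exact refines hvtop hv2 (hq'v ▸ hw₂.pos_topP)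
  have hrA : r ∈ A.1.inner := by
    refine ⟨hrU.1, fun c hc1 hc2 => ?_⟩
    have hne : r.1 c ≠ r.1 A.1.m := by
      intro h
      have h1 : pos (topP p) A.1.M < pos (topP p) c := by
        rw [← hrt, topP_lt]; exact Or.inr ⟨(mem_hyp.mp hrU.1).trans h.symm, hc2⟩
      have h2 : pos (topP p) c < pos (topP p) A.1.m := by
        rw [← hrt, topP_lt]; exact Or.inr ⟨h, hc1⟩
      exact absurd (hp.step.2 c h1) (not_le.mpr h2)
    refine ⟨fun h => lt_of_le_of_ne ?_ hne, fun h => lt_of_le_of_ne ?_ hne.symm⟩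
    · have h1 : pos (topP r) A.1.m < pos (topP r) c := by
        rw [hrt, topP_lt]; exact Or.inl ((hpA.2 c hc1 hc2).1 h)
      exact refines le_rfl (botP_le_topP r) h1
    · have h1 : pos (topP r) c < pos (topP r) A.1.m := by
        rw [hrt, topP_lt]; exact Or.inl ((hpA.2 c hc1 hc2).2 h)
      exact refines le_rfl (botP_le_topP r) h1
  have hrA₂ : r ∈ A₂.shard := by
    refine ⟨hr2, fun c hc1 hc2 => ⟨fun h => ?_, fun h => ?_⟩⟩
    · have h1 : pos v A₂.m < pos v c := by
        rw [← hq'v, topP_lt]; exact Or.inl ((hi₂.2 c hc1 hc2).1 h)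
      exact refines hvtop hv2 h1
    · have h1 : pos v c < pos v A₂.m := by
        rw [← hq'v, topP_lt]; exact Or.inl ((hi₂.2 c hc1 hc2).2 h)
      exact refines hvtop hv2 h1
  have hne : hyp A.1.M A.1.m ≠ hyp a b := by
    intro h
    have h1 : Wall A.1.M A.1.m q := by
      rcases (hyp_lt_iff A.2 hq.1).mp h with ⟨rfl, rfl⟩ | ⟨rfl, rfl⟩
      · exact hq
      · simpa using hq.swap
    exact hnle (hAq.trans (h1.botP_le_botP hp (hqy.trans hpy.symm)))
  -- If the hyperplane of A₂ is cut at r, then r witnesses an arrow.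
  by_cases hnb : ∃ e, A₂.m < e ∧ e < A₂.M ∧ r.1 e = r.1 A₂.m
  · obtain ⟨e, he1, he2, he3⟩ := hnb
    have hne₂ : A.1.hyper ≠ A₂.hyper := by
      intro h
      have h1 := mem_cut_of_inner A.2 hrA
      rw [h, hyper, cutHyperplane_hyp hA₂] at h1
      exact h1.2 e he1 he2 (he3.trans hr2.symm)
    have hU : A.1.hyper ⊓ A₂.hyper = hyp A.1.M A.1.m ⊓ hyp a b := by
      symm
      apply Submodule.eq_of_le_of_finrank_eq (le_inf inf_le_left (hrtie _ _ hr2))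
      have h1 := finrank_inf_hyp A.2.ne' hq.1.ne' hne
      have h2 := finrank_inf_hyp A.2.ne' hA₂.ne' hne₂
      exact Nat.add_right_cancel (h1.trans h2.symm)
    refine .single ⟨r, hrA, hrA₂, ⟨e, he1, he2, ?_⟩, fun c _ _ hc => ?_⟩
    · rw [hU]; exact hrtie _ _ (hr2.trans he3.symm)
    · rw [hU]; exact hrtie _ _ (hr2.trans hc.symm)
  -- Otherwise r is interior to the shard of A₂, so its two indices are adjacent in y and tied at r.
  -- The hyperplane is then that of p, whence A = A₂, or that of q, which v inverts although v ≤
  -- `botP q`.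
  · push Not at hnb
    have hri := mem_inner_of_shard hrA₂ hnb
    have hs := step_topP hA₂ hri
    rw [hrt] at hs
    have key : A.1.hyper = A₂.hyper → A = ⟨A₂, hA₂⟩ := fun h =>
      Subtype.ext (eq_of_inner A.2 hA₂ h hrA hri)
    have hkey2 : ¬ Wall A₂.M A₂.m q := fun h =>
      h.not_le_botP (u := v) (hq'v ▸ hw₂.pos_topP) hv3
    rcases hrstep _ _ hs hr2 with h | h | h | h
    · rw [key ((hyper_eq_iff A.2 hA₂).mpr (Or.inl h))]
    · rw [key ((hyper_eq_iff A.2 hA₂).mpr (Or.inr h))]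
    · exact absurd (by rw [h.1, h.2]; exact hq) hkey2
    · exact absurd (by rw [h.1, h.2]; exact hq.swap) hkey2

theorem reach_neg {A B : Adm n} (h : Relation.ReflTransGen (fun B C : Adm n => Arr B.1 C.1) A B) :
    Relation.ReflTransGen (fun B C : Adm n => Arr B.1 C.1) A.neg B.neg :=
  Relation.ReflTransGen.lift neg (fun _ _ h => arr_neg h) _ _ h

theorem reach_of_edge {A A' : Adm n} {x y : SignedPerm n} (h : A.Edge x y) (h1 : A'.1.gamma ≤ y)
    (h2 : ¬ A'.1.gamma ≤ x) : Relation.ReflTransGen (fun B C : Adm n => Arr B.1 C.1) A A' := by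
  obtain ⟨p, hp, hpA, rfl, rfl⟩ := h
  exact reach_of_wall A' _ A p hp hpA rfl h1 h2

/-- A wall of the join-irreducible element of `A`. -/
noncomputable def wallPoint (A : Adm n) : BSpace n := (exists_wall_gamma A.2).choose

theorem edge_gamma (A : Adm n) : A.Edge (botP A.wallPoint) A.1.gamma :=
  have h := (exists_wall_gamma A.2).choose_spec
  ⟨A.wallPoint, h.1, h.2.1, rfl, h.2.2⟩

theorem gamma_le_of_edge {A : Adm n} {x y : SignedPerm n} (h : A.Edge x y) : A.1.gamma ≤ y := by
  obtain ⟨p, _, hpA, rfl, rfl⟩ := h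
  exact gamma_le_topP A.2 (inner_subset_shard hpA)

theorem gamma_not_le_of_edge {A : Adm n} {x y : SignedPerm n} (h : A.Edge x y) :
    ¬ A.1.gamma ≤ x := by
  obtain ⟨p, hp, hpA, rfl, rfl⟩ := h
  exact hp.not_le_botP A.1.pos_gamma

theorem le_of_lt_gamma {A : Adm n} {x : SignedPerm n} (h : x < A.1.gamma) :
    x ≤ botP A.wallPoint :=
  have h' := (exists_wall_gamma A.2).choose_spec
  le_botP_of_lt_gamma h'.1 h'.2.2 h

/-- The weak order with its covers labelled by shards, given a function that increases along
arrows. -/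
noncomputable def edgeSystem (ht : Adm n → ℤ) (hht : ∀ A B : Adm n, Arr A.1 B.1 → ht A < ht B) :
    EdgeSystem (SignedPerm n) (Adm n) where
  edge := Edge
  j A := A.1.gamma
  jl A := botP A.wallPoint
  -- Reversing the notation turns join-irreducible into meet-irreducible elements; taking the
  -- antipodal label first makes the cover above it cross the shard of A itself.
  m A := negP A.neg.1.gamma
  mu A := negP (botP A.neg.wallPoint)
  Arr A B := Arr A.1 B.1
  ht := ht
  exists_glb := exists_isGLB
  exists_lub := exists_isLUB
  lt_of_edge := by
    rintro A _ _ ⟨p, hp, _, rfl, rfl⟩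
    exact hp.botP_lt_topP
  exists_edge := by
    intro x y h
    obtain ⟨a, b, p, hp, rfl, hx⟩ := exists_lower_wall h
    obtain ⟨A, hA, -, hw, hi⟩ := exists_label hp
    exact ⟨⟨A, hA⟩, _, ⟨p, hw, hi, rfl, rfl⟩, hx⟩
  edge_j := edge_gamma
  edge_m A := by
    have := edge_neg A.neg.edge_gamma
    rwa [neg_neg] at this
  le_jl := le_of_lt_gamma
  mu_le := by
    intro A x h
    rw [negP_le_iff]
    apply le_of_lt_gamma
    refine lt_of_le_of_ne (negP_le_iff.mp h.le) fun h1 => h.ne ?_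
    rw [← h1, negP_negP]
  j_le := gamma_le_of_edge
  j_not_le := gamma_not_le_of_edge
  jl_le := by
    rintro A _ _ ⟨p, hp, hpA, rfl, rfl⟩
    have h := (exists_wall_gamma A.2).choose_spec
    refine hp.le_botP ?_ h.1.pos_botP
    exact (h.1.botP_lt_topP.le.trans h.2.2.le).trans (gamma_le_topP A.2 (inner_subset_shard hpA))
  le_of_j_le := by
    rintro A _ _ z ⟨p, hp, hpA, rfl, rfl⟩ h1 h2
    exact hp.topP_le h1 (weak_le_iff.mp h2 _ _ A.2 A.1.pos_gamma)
  le_m := by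
    intro A x y h
    rw [le_negP_iff]
    exact gamma_le_of_edge (edge_neg h)
  not_le_m := by
    intro A x y h
    rw [le_negP_iff]
    exact gamma_not_le_of_edge (edge_neg h)
  reach_j := reach_of_edge
  reach_m := by
    intro A B x y h h1 h2
    rw [le_negP_iff] at h1 h2
    have := reach_neg (reach_of_edge (edge_neg h) h1 h2)
    rwa [neg_neg, neg_neg] at this
  forces := by
    intro A B h
    rcases inverted_or h with h1 | h1
    · exact Or.inl (forces_of_inverted h h1)
    · right
      have h2 : pos B.neg.1.gamma A.neg.1.M < pos B.neg.1.gamma A.neg.1.m := by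
        rcases A.neg_names with ⟨h2, h3⟩ | ⟨h2, h3⟩
        · rw [h2, h3]; exact h1
        · rw [h2, h3]; exact pos_lt_neg.mpr h1
      obtain ⟨x, y, he, hy, hx⟩ := forces_of_inverted (arr_neg h) h2
      have he' := edge_neg he
      rw [neg_neg] at he'
      refine ⟨_, _, he', ?_, ?_⟩
      · exact negP_le_negP hy
      · rw [le_negP_iff, negP_negP]; exact hx
  ht_lt := hht _ _

end Adm
namespace SignedSubset

variable {n : ℕ}

/-! ### The explicit description of the arrows -/

/-- The test vectors are the `ind` of {d}, {f} and {a, b, c}. The last alternative arises when two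
of a, b, c are opposite: their common value is then zero, and signs no longer matter. -/
theorem of_inf_le_hyp {a b c d f : PM n} (hab : a ≠ b) (hac : a ≠ c) (hbc : b ≠ c) (hdf : d ≠ f)
    (h : hyp a b ⊓ hyp a c ≤ hyp d f) :
    ((d = a ∨ d = b ∨ d = c) ∧ (f = a ∨ f = b ∨ f = c)) ∨
    ((d = -a ∨ d = -b ∨ d = -c) ∧ (f = -a ∨ f = -b ∨ f = -c)) ∨
    ((a = -b ∨ a = -c ∨ b = -c) ∧ (d = a ∨ d = b ∨ d = c ∨ d = -a ∨ d = -b ∨ d = -c) ∧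
      (f = a ∨ f = b ∨ f = c ∨ f = -a ∨ f = -b ∨ f = -c)) := by
  classical
  have key : ∀ s : Set (PM n), (ind s).1 a = (ind s).1 b → (ind s).1 a = (ind s).1 c →
      (ind s).1 d = (ind s).1 f := fun s h1 h2 => h ⟨h1, h2⟩
  simp only [ind_apply] at key
  have h1 := key {d}
  have h2 := key {f}
  have h3 := key {a, b, c}
  simp only [Set.mem_singleton_iff, Set.mem_insert_iff] at h1 h2 h3
  have ha := a.neg_ne_self
  have hb := b.neg_ne_self
  have hc := c.neg_ne_self
  have hd := d.neg_ne_self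
  have hf := f.neg_ne_self
  have hd' : d = a ∨ d = b ∨ d = c ∨ d = -a ∨ d = -b ∨ d = -c := by
    clear h2 h3 key h
    by_contra hcon
    push Not at hcon
    obtain ⟨k1, k2, k3, k4, k5, k6⟩ := hcon
    have k4' : ¬ -a = d := fun h => k4 h.symm
    have k5' : ¬ -b = d := fun h => k5 h.symm
    have k6' : ¬ -c = d := fun h => k6 h.symm
    rw [if_neg k1.symm, if_neg k2.symm, if_neg k3.symm, if_neg k4', if_neg k5', if_neg k6',
      if_pos trivial, if_neg hd, if_neg hdf.symm] at h1
    have := h1 rfl rfl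
    split_ifs at this <;> norm_num at this
  have hf' : f = a ∨ f = b ∨ f = c ∨ f = -a ∨ f = -b ∨ f = -c := by
    clear h1 h3 key h
    by_contra hcon
    push Not at hcon
    obtain ⟨k1, k2, k3, k4, k5, k6⟩ := hcon
    have k4' : ¬ -a = f := fun h => k4 h.symm
    have k5' : ¬ -b = f := fun h => k5 h.symm
    have k6' : ¬ -c = f := fun h => k6 h.symm
    rw [if_neg k1.symm, if_neg k2.symm, if_neg k3.symm, if_neg k4', if_neg k5', if_neg k6',
      if_pos trivial, if_neg hf, if_neg hdf] at h2
    have := h2 rfl rfl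
    split_ifs at this <;> norm_num at this
  by_cases hopp : a = -b ∨ a = -c ∨ b = -c
  · exact Or.inr (Or.inr ⟨hopp, hd', hf'⟩)
  · push Not at hopp
    obtain ⟨o1, o2, o3⟩ := hopp
    have o1' : ¬ -a = b := fun h => o1 (PM.eq_neg_comm.mp h.symm)
    have o2' : ¬ -a = c := fun h => o2 (PM.eq_neg_comm.mp h.symm)
    have o3' : ¬ -b = c := fun h => o3 (PM.eq_neg_comm.mp h.symm)
    clear h1 h2 key h
    have hS : ∀ x, x = a ∨ x = b ∨ x = c → ¬ (-x = a ∨ -x = b ∨ -x = c) := by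
      rintro x (rfl | rfl | rfl) (h | h | h)
      · exact ha h
      · exact o1' h
      · exact o2' h
      · exact o1 h.symm
      · exact hb h
      · exact o3' h
      · exact o2 h.symm
      · exact o3 h.symm
      · exact hc h
    have hN : ∀ x, x = -a ∨ x = -b ∨ x = -c → (-x = a ∨ -x = b ∨ -x = c) := by
      rintro x (rfl | rfl | rfl) <;> simp [PM.neg_neg]
    have hN' : ∀ x, x = -a ∨ x = -b ∨ x = -c → ¬ (x = a ∨ x = b ∨ x = c) :=
      fun x hx h => hS x h (hN x hx)
    have hSa := hS a (Or.inl rfl)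
    have hSb := hS b (Or.inr (Or.inl rfl))
    have hSc := hS c (Or.inr (Or.inr rfl))
    rw [if_neg hSa, if_neg hSb, if_neg hSc, if_pos (Or.inl trivial), if_pos (Or.inr (Or.inl trivial)),
      if_pos (Or.inr (Or.inr trivial))] at h3
    have h4 := h3 rfl rfl
    have hd2 : (d = a ∨ d = b ∨ d = c) ∨ (d = -a ∨ d = -b ∨ d = -c) := by simpa only [or_assoc] using hd'
    have hf2 : (f = a ∨ f = b ∨ f = c) ∨ (f = -a ∨ f = -b ∨ f = -c) := by simpa only [or_assoc] using hf'
    rcases hd2 with h5 | h5 <;> rcases hf2 with h6 | h6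
    · exact Or.inl ⟨h5, h6⟩
    · rw [if_pos h5, if_neg (hS d h5), if_neg (hN' f h6), if_pos (hN f h6)] at h4
      norm_num at h4
    · rw [if_neg (hN' d h5), if_pos (hN d h5), if_pos h6, if_neg (hS f h6)] at h4
      norm_num at h4
    · exact Or.inr (Or.inl ⟨h5, h6⟩)

/-! ### Necessity of the combinatorial conditions -/

section Necessity

variable {A₁ A₂ : SignedSubset n}

theorem inf_hyper_eq (h₁ : A₁.m < A₁.M) (h₂ : A₂.m < A₂.M) (hne : A₁.hyper ≠ A₂.hyper) {e : PM n}
    (he1 : A₂.m < e) (he2 : e < A₂.M) (he3 : A₁.hyper ⊓ A₂.hyper ≤ hyp A₂.M e) :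
    A₁.hyper ⊓ A₂.hyper = hyp A₂.M A₂.m ⊓ hyp A₂.M e := by
  apply Submodule.eq_of_le_of_finrank_eq (le_inf inf_le_right he3)
  have h3 := finrank_inf_hyp h₁.ne' h₂.ne' hne
  have h4 := finrank_inf_hyp h₂.ne' he2.ne' fun h => not_hyper_le he1 he2 h.le
  exact Nat.add_right_cancel (h3.trans h4.symm)

set_option maxHeartbeats 1600000 in
/-- The possible names of the hyperplane of `A₁` when there is an arrow to the shard of `A₂`
through the cut at `e`. -/
theorem names_of_arr (h₁ : A₁.m < A₁.M) (h₂ : A₂.m < A₂.M) (hne : A₁.hyper ≠ A₂.hyper) {e : PM n}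
    (he1 : A₂.m < e) (he2 : e < A₂.M) (he3 : A₁.hyper ⊓ A₂.hyper ≤ hyp A₂.M e)
    {p : BSpace n} (hp1 : p ∈ A₁.inner) (hp2 : p.1 A₂.M = p.1 A₂.m) (hpe : p.1 e = p.1 A₂.m) :
    (A₂.M = -A₂.m ∧ ((A₁.M = A₂.M ∧ (A₁.m = e ∨ A₁.m = -e) ∧ 0 < A₁.m.1) ∨
      ((A₁.M = e ∨ A₁.M = -e) ∧ A₁.m = -A₁.M))) ∨
    (A₂.M ≠ -A₂.m ∧ ((A₁.M = A₂.M ∧ A₁.m = e) ∨ (A₁.M = -e ∧ A₁.m = -A₂.M) ∨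
      (A₁.M = e ∧ A₁.m = A₂.m) ∨ (A₁.M = -A₂.m ∧ A₁.m = -e))) := by
  have hU := inf_hyper_eq h₁ h₂ hne he1 he2 he3
  have h3 : hyp A₂.M A₂.m ⊓ hyp A₂.M e ≤ hyp A₁.M A₁.m := hU ▸ inf_le_left
  have h4 := of_inf_le_hyp h₂.ne' he2.ne' he1.ne h₁.ne' h3
  have hM₁ := A₁.M_pos h₁
  have hM₂ := A₂.M_pos h₂
  have hn : ¬ ((A₂.M = A₁.M ∧ A₂.m = A₁.m) ∨ (A₂.M = -A₁.m ∧ A₂.m = -A₁.M)) := fun h =>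
    hne ((hyper_eq_iff h₁ h₂).mpr h)
  have hm0 := A₁.m.coe_ne_zero
  -- If two of M₂, m₂, e are opposite, all six signed names have value 0 at p, and so has m₁. As p
  -- is interior to the first shard, none of them lies strictly between m₁ and M₁.
  have hz : (A₂.M = -A₂.m ∨ A₂.M = -e ∨ A₂.m = -e) →
      (¬ (A₁.m < A₂.M ∧ A₂.M < A₁.M) ∧ ¬ (A₁.m < -A₂.M ∧ -A₂.M < A₁.M)) ∧
      (¬ (A₁.m < A₂.m ∧ A₂.m < A₁.M) ∧ ¬ (A₁.m < -A₂.m ∧ -A₂.m < A₁.M)) ∧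
      (¬ (A₁.m < e ∧ e < A₁.M) ∧ ¬ (A₁.m < -e ∧ -e < A₁.M)) := by
    intro h
    have k1 := coord_neg p A₂.M
    have k2 := coord_neg p A₂.m
    have k3 := coord_neg p e
    have k0 : p.1 A₂.m = 0 := by
      rcases h with h | h | h
      all_goals
        have h' := congrArg p.1 h
        linarith
    have k4 : p.1 A₁.m = 0 := by
      have k5 : ∀ d, (d = A₂.M ∨ d = A₂.m ∨ d = e ∨ d = -A₂.M ∨ d = -A₂.m ∨ d = -e) →
          p.1 d = 0 := by
        rintro d (rfl | rfl | rfl | rfl | rfl | rfl) <;> linarith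
      apply k5
      rcases h4 with ⟨-, h | h | h⟩ | ⟨-, h | h | h⟩ | ⟨-, -, h⟩
      · exact Or.inl h
      · exact Or.inr (Or.inl h)
      · exact Or.inr (Or.inr (Or.inl h))
      · exact Or.inr (Or.inr (Or.inr (Or.inl h)))
      · exact Or.inr (Or.inr (Or.inr (Or.inr (Or.inl h))))
      · exact Or.inr (Or.inr (Or.inr (Or.inr (Or.inr h))))
      · exact h
    have k6 : ∀ d, p.1 d = 0 → ¬ (A₁.m < d ∧ d < A₁.M) := fun d hd hd' =>
      inner_ne hp1 hd'.1 hd'.2 (hd.trans k4.symm)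
    exact ⟨⟨k6 _ (by linarith), k6 _ (by linarith)⟩, ⟨k6 _ (by linarith), k6 _ (by linarith)⟩,
      ⟨k6 _ (by linarith), k6 _ (by linarith)⟩⟩
  clear hU h3 he3 hne hp1 hp2 hpe
  by_cases ho : A₂.M = -A₂.m ∨ A₂.M = -e ∨ A₂.m = -e
  · have hz' := hz ho
    clear hz
    rcases h4 with ⟨h | h | h, h' | h' | h'⟩ | ⟨h | h | h, h' | h' | h'⟩ | ⟨-, hd, hf⟩
    on_goal 19 => rcases hd with h | h | h | h | h | h <;> rcases hf with h' | h' | h' | h' | h' | h'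
    all_goals
      simp only [PM.eq_iff, PM.lt_iff, PM.coe_neg, ne_eq] at *
      omega
  · clear hz
    rcases h4 with ⟨h | h | h, h' | h' | h'⟩ | ⟨h | h | h, h' | h' | h'⟩ | ⟨ho', -, -⟩
    on_goal 19 => exact absurd ho' ho
    all_goals
      simp only [PM.eq_iff, PM.lt_iff, PM.coe_neg, ne_eq] at *
      omega

/-- A failure of (f) forces an extra tie not implied by the cut at e. If -e lies in A₂ ∩ (m₂, M₂),
then p_m ≥ 0, hence p_m = 0, and -M₂ or -m₂ gives the tie. If e is -M₂ or -m₂, then p_m = 0, and a c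
in (±A₂)ᶜ with both c and -c in (m₂, M₂) satisfies p_c = 0. -/
theorem condF_of_arr (h₂ : A₂.m < A₂.M) (hfull : A₂.M ≠ -A₂.m) {e : PM n}
    (he1 : A₂.m < e) (he2 : e < A₂.M) {p : BSpace n} (hp : p ∈ A₂.shard)
    (hpe : p.1 e = p.1 A₂.m)
    (hcut : ∀ c, A₂.m < c → c < A₂.M → p.1 c = p.1 A₂.m →
      hyp A₂.M A₂.m ⊓ hyp A₂.M e ≤ hyp A₂.M c) : condF A₂ e := by
  have hM₂ := A₂.M_pos h₂
  have hcut' : ∀ c, A₂.m < c → c < A₂.M → p.1 c = p.1 A₂.m → c ≠ e →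
      (A₂.M = -e ∨ A₂.m = -e) ∧ (c = -A₂.M ∨ c = -A₂.m ∨ c = -e) := by
    intro c hc1 hc2 hc3 hce
    have := of_inf_le_hyp h₂.ne' he2.ne' he1.ne hc2.ne' (hcut c hc1 hc2 hc3)
    have h0 := e.coe_ne_zero
    clear hcut hpe hp
    simp only [PM.eq_iff, PM.lt_iff, PM.coe_neg, ne_eq] at *
    omega
  rcases A₂.full_or with hf | ⟨-, hMm, hM, hM', hC⟩
  · exact absurd hf.1 hfull
  by_cases heA : e ∈ A₂.carrier
  · exact Or.inl heA
  right
  by_cases hem : e = -A₂.M ∨ e = -A₂.m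
  · right
    refine ⟨hem, ?_⟩
    rw [Set.eq_empty_iff_forall_notMem]
    rintro c ⟨⟨hc, hc1, hc2⟩, hc3, hc4⟩
    have hc' := A₂.mem_pmCompl.mp hc
    have h5 : p.1 A₂.m = 0 := by
      have h6 := hp.1
      have k1 := coord_neg p A₂.M
      have k2 := coord_neg p A₂.m
      rcases hem with h | h <;> rw [h] at hpe <;> linarith
    have h6 := (hp.2 c hc1 hc2).2 hc'.1
    have h7 := (hp.2 (-c) (by rw [← PM.neg_lt_neg, PM.neg_neg]; exact hc4)
      (by rw [← PM.neg_lt_neg, PM.neg_neg]; exact hc3)).2 hc'.2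
    rw [coord_neg] at h7
    have h8 := hcut' c hc1 hc2 (by linarith)
    have h9 : c ≠ A₂.m ∧ -c ≠ A₂.m :=
      ⟨fun h => hc'.1 (h ▸ A₂.m_mem), fun h => hc'.2 (h ▸ A₂.m_mem)⟩
    clear hcut hcut' hp hpe hC h6 h7
    simp only [PM.eq_iff, PM.lt_iff, PM.coe_neg, ne_eq] at *
    omega
  · left
    push Not at hem
    refine ⟨heA, hem.1, hem.2, ?_⟩
    rintro ⟨h1, h2, h3⟩
    have h4 := (hp.2 (-e) h2 h3).1 h1
    rw [coord_neg, hpe] at h4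
    have hm0 : A₂.m.1 < 0 := by
      simp only [PM.eq_iff, PM.lt_iff, PM.coe_neg, ne_eq] at *
      omega
    have h5 := shard_nonpos_of_mem hp h₂ hm0
    have h6 : p.1 A₂.m = 0 := by linarith
    have k1 := coord_neg p A₂.M
    have k2 := coord_neg p A₂.m
    have h7 := hp.1
    rcases lt_or_gt_of_ne hfull with h8 | h8
    · have h9 := hcut' (-A₂.M) (by simp only [PM.lt_iff, PM.coe_neg] at *; omega)
        (by simp only [PM.lt_iff, PM.coe_neg] at *; omega) (by linarith) hem.1.symm
      rcases h9.1 with h10 | h10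
      · exact hem.1 (PM.eq_neg_comm.mp h10)
      · exact hem.2 (PM.eq_neg_comm.mp h10)
    · have h9 := hcut' (-A₂.m) (by simp only [PM.lt_iff, PM.coe_neg] at *; omega) h8 (by linarith)
        hem.2.symm
      rcases h9.1 with h10 | h10
      · exact hem.1 (PM.eq_neg_comm.mp h10)
      · exact hem.2 (PM.eq_neg_comm.mp h10)

/-- Both subsets record sides relative to the same level, so they agree on (m₁, M₁). In `r2_of_arr`
the levels are opposite, and membership of c becomes nonmembership of -c. -/
theorem r1_of_arr {p : BSpace n} (hp1 : p ∈ A₁.inner) (hp2 : p ∈ A₂.shard)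
    (hm : p.1 A₁.m = p.1 A₂.m) (h : ∀ c, A₁.m < c → c < A₁.M → A₂.m < c ∧ c < A₂.M) :
    r1 A₁ A₂ := by
  ext c
  simp only [Set.mem_inter_iff, Set.mem_Ioo, Finset.mem_coe]
  refine and_congr_left fun ⟨hc1, hc2⟩ => ?_
  obtain ⟨h1, h2⟩ := h c hc1 hc2
  have h3 := inner_ne hp1 hc1 hc2
  rw [← inner_lt_iff hp1 hc1 hc2, hm] at *
  constructor
  · intro h4
    by_contra h5
    exact absurd ((hp2.2 c h1 h2).2 h5) (not_le.mpr h4)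
  · intro h4
    exact lt_of_le_of_ne ((hp2.2 c h1 h2).1 h4) h3

theorem r2_of_arr {p : BSpace n} (hp1 : p ∈ A₁.inner) (hp2 : p ∈ A₂.shard)
    (hm : p.1 A₁.m = -p.1 A₂.m) (h : ∀ c, A₁.m < c → c < A₁.M → A₂.m < -c ∧ -c < A₂.M) :
    r2 A₁ A₂ := by
  ext c
  simp only [Set.mem_inter_iff, Set.mem_Ioo, Finset.mem_coe, Set.mem_ofPred_eq]
  refine and_congr_left fun ⟨hc1, hc2⟩ => ?_
  obtain ⟨h1, h2⟩ := h c hc1 hc2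
  have h3 := inner_ne hp1 hc1 hc2
  have h6 := hp2.2 (-c) h1 h2
  rw [coord_neg] at h6
  rw [← inner_lt_iff hp1 hc1 hc2, hm] at *
  constructor
  · intro h4 h5
    linarith [h6.1 h5]
  · intro h4
    exact lt_of_le_of_ne (by linarith [h6.2 h4]) h3

end Necessity

/-! ### Points of a shard on a prescribed cut -/

section Sufficiency

variable {A : SignedSubset n}

theorem ind_singleton (a c : PM n) [DecidableEq (PM n)] :
    (ind {a}).1 c = (if c = a then 1 else 0) - (if c = -a then 1 else 0) := by
  have : -c = a ↔ c = -a := by rw [eq_comm, PM.eq_neg_comm]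
  simp only [ind_apply, Set.mem_singleton_iff, this]

theorem blockVec_apply (c : PM n) : A.blockVec.1 c = 1 - (A.block c : ℝ) := rfl

/-- A point of the shard of a full signed subset on the cut at `e` and on no other cut. -/
theorem exists_point_full (hfull : A.M = -A.m) {e : PM n} (he1 : A.m < e)
    (he2 : e < A.M) : ∃ p : BSpace n, p.1 A.m = 0 ∧ p.1 e = 0 ∧
      ∀ c, A.m < c → c < A.M → c ≠ e → c ≠ -e →
        (c ∈ A.carrier → p.1 c < 0) ∧ (c ∉ A.carrier → 0 < p.1 c) := by
  classical
  rcases A.full_or with ⟨-, hf⟩ | hf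
  swap
  · exact absurd hfull hf.1
  have hbm := A.block_eq_two.mpr A.m_mem
  have hm := A.m.neg_ne_self
  have hee := e.neg_ne_self
  -- The block vector is -1 on A and 1 on -A; the two corrections bring m and e to 0.
  refine ⟨A.blockVec + (1 : ℝ) • ind {A.m} + ((A.block e : ℝ) - 1) • ind {e}, ?_, ?_, ?_⟩
  · simp only [add_coord, smul_coord, ind_singleton, blockVec_apply, hbm]
    have h1 : A.m ≠ e := he1.ne
    have h2 : A.m ≠ -e := by
      simp only [PM.eq_iff, PM.lt_iff, PM.coe_neg, ne_eq] at *; omega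
    simp [h1, h2, hm.symm]
    norm_num
  · simp only [add_coord, smul_coord, ind_singleton, blockVec_apply]
    have h1 : e ≠ A.m := he1.ne'
    have h2 : e ≠ -A.m := by rw [← hfull]; exact he2.ne
    simp [h1, h2, hee.symm]
  · intro c hc1 hc2 hce hce'
    have h1 : c ≠ A.m := hc1.ne'
    have h2 : c ≠ -A.m := by rw [← hfull]; exact hc2.ne
    simp only [add_coord, smul_coord, ind_singleton, blockVec_apply, h1, h2, hce, hce', if_false,
      sub_self, mul_zero, add_zero]
    constructor
    · intro h
      rw [A.block_eq_two.mpr h]; norm_num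
    · intro h
      rw [A.block_eq_zero.mpr ((hf c).resolve_left h)]; norm_num

/-- A point of the shard of `A` on the cut at `e` and on no other cut. -/
theorem exists_point (hA : A.m < A.M) (hfull : A.M ≠ -A.m) {e : PM n} (he1 : A.m < e)
    (he2 : e < A.M) (hF : condF A e) : ∃ p : BSpace n, p.1 A.M = p.1 A.m ∧ p.1 e = p.1 A.m ∧
      ∀ c, A.m < c → c < A.M → c ≠ e →
        (c ∈ A.carrier → p.1 c < p.1 A.m) ∧ (c ∉ A.carrier → p.1 A.m < p.1 c) := by
  classical
  rcases A.full_or with hf | ⟨-, hMm, hM, hM', hC⟩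
  · exact absurd hf.1 hfull
  have hMpos := A.M_pos hA
  have hbm := A.block_eq_two.mpr A.m_mem
  have hbM : A.block A.M = 1 := by
    have h1 := A.block_le A.M
    have h2 := A.block_eq_two.not.mpr hM
    have h3 := A.block_eq_zero.not.mpr hM'
    omega
  have hm := A.m.neg_ne_self
  have hMn := A.M.neg_ne_self
  have hee := e.neg_ne_self
  have hmM : A.m ≠ -A.M := fun h => hfull (PM.eq_neg_comm.mp h)
  -- off the cut, the base vector takes the values `±2` on `±A` and `0` or `1` elsewhere
  have hbase : ∀ (s : ℝ), e ≠ -A.M → e ≠ -A.m → 2 * (1 - (A.block e : ℝ)) + s = -1 →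
      (-e ∈ A.carrier → A.m < -e → -e < A.M → False) →
      ∃ p : BSpace n, p.1 A.M = p.1 A.m ∧ p.1 e = p.1 A.m ∧
      ∀ c, A.m < c → c < A.M → c ≠ e →
        (c ∈ A.carrier → p.1 c < p.1 A.m) ∧ (c ∉ A.carrier → p.1 A.m < p.1 c) := by
    intro s heM hem hs hcon
    have hme : A.m ≠ -e := fun h => hem (PM.eq_neg_comm.mp h)
    have hMe : A.M ≠ -e := fun h => heM (PM.eq_neg_comm.mp h)
    -- The common level is -1: m is raised from -2, M lowered from 0, and s adjusts e. Between m and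
    -- M and away from e and -e, members of A stay at -2 and the rest are at least 0. The value at
    -- -e is 1, which is why `hcon` is needed.
    let p : BSpace n := (2 : ℝ) • A.blockVec + (-1 : ℝ) • ind {A.M} + (1 : ℝ) • ind {A.m} + s • ind {e}
    have hp : ∀ c, p.1 c = 2 * (1 - (A.block c : ℝ)) +
        -1 * ((if c = A.M then 1 else 0) - (if c = -A.M then 1 else 0)) +
        1 * ((if c = A.m then 1 else 0) - (if c = -A.m then 1 else 0)) +
        s * ((if c = e then 1 else 0) - (if c = -e then 1 else 0)) := by
      intro c
      simp only [p, add_coord, smul_coord, ind_singleton, blockVec_apply]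
    have hpm : p.1 A.m = -1 := by
      rw [hp, hbm]
      simp [hA.ne, hmM, hm.symm, he1.ne, hme]
      norm_num
    have hpM : p.1 A.M = -1 := by
      rw [hp, hbM]
      simp [hA.ne', hfull, hMn.symm, he2.ne', hMe]
    have hpe : p.1 e = -1 := by
      rw [hp]
      simp only [he1.ne', hem, he2.ne, heM, hee.symm, if_true, if_false]
      linarith
    refine ⟨p, by rw [hpm, hpM], by rw [hpm, hpe], fun c hc1 hc2 hce => ?_⟩
    rw [hpm]
    by_cases hce' : c = -e
    · have h1 : p.1 c = 1 := by rw [hce', coord_neg, hpe]; norm_num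
      rw [h1]
      subst hce'
      exact ⟨fun h => (hcon h hc1 hc2).elim, fun _ => by norm_num⟩
    · rw [hp c]
      simp only [hc1.ne', hc2.ne, hce, hce', if_false, sub_self, mul_zero, add_zero, zero_sub]
      constructor
      · intro h
        have h1 : c ≠ -A.M := by rintro rfl; exact hM' h
        have h2 : c ≠ -A.m := by rintro rfl; exact A.neg_m_not_mem h
        rw [A.block_eq_two.mpr h]
        simp only [h1, h2, if_false]
        norm_num
      · intro h
        by_cases h2 : c = -A.m
        · have h3 : A.block c = 0 := by
            rw [block_eq_zero, h2, PM.neg_neg]; exact A.m_mem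
          have h4 : ¬ -A.m = -A.M := fun h => hMm (PM.neg_inj.mp h).symm
          rw [h3, h2]
          simp only [h4, if_true, if_false]
          norm_num
        · have h3 : (A.block c : ℝ) ≤ 1 := by
            have h4 := A.block_le c
            have h5 := A.block_eq_two.not.mpr h
            exact_mod_cast (by omega : A.block c ≤ 1)
          simp only [h2, if_false]
          split_ifs <;> linarith
  rcases hF with hF | ⟨heA, heM, hem, hF⟩ | ⟨he, hF⟩
  · refine hbase 1 ?_ ?_ ?_ fun h _ _ => A.signed e hF h
    · rintro rfl; exact hM' hF
    · rintro rfl; exact A.neg_m_not_mem hF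
    · rw [A.block_eq_two.mpr hF]; norm_num
  · exact hbase (-1 - 2 * (1 - (A.block e : ℝ))) heM hem (by ring) fun h1 h2 h3 => hF ⟨h1, h2, h3⟩
  -- Now e is -M or -m, so the level must be 0. Adding `ind s` lifts the elements of (±A)ᶜ in (m, M)
  -- other than -M from 0 to 1; by (f) no c and -c are both lifted.
  · let s : Set (PM n) := {c | c ∈ A.pmCompl ∧ A.m < c ∧ c < A.M ∧ c ≠ -A.M}
    have hs : ∀ c, c ∈ s ↔ c ∈ A.pmCompl ∧ A.m < c ∧ c < A.M ∧ c ≠ -A.M := fun c => Iff.rfl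
    let p : BSpace n := A.blockVec + (1 : ℝ) • ind {A.m} + ind s
    have hp : ∀ c, p.1 c = (1 - (A.block c : ℝ)) +
        1 * ((if c = A.m then 1 else 0) - (if c = -A.m then 1 else 0)) +
        ((if c ∈ s then 1 else 0) - (if -c ∈ s then 1 else 0)) := by
      intro c
      simp only [p, add_coord, smul_coord, ind_singleton, blockVec_apply]
      rw [ind_apply]
    have hsA : ∀ c, c ∈ A.carrier → c ∉ s ∧ -c ∉ s := by
      intro c hc
      refine ⟨fun h => (A.mem_pmCompl.mp h.1).1 hc, fun h => (A.mem_pmCompl.mp h.1).2 ?_⟩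
      rwa [PM.neg_neg]
    have hpm : p.1 A.m = 0 := by
      rw [hp, hbm]
      simp only [hsA _ A.m_mem, hm.symm, if_true, if_false]
      norm_num
    have hpM : p.1 A.M = 0 := by
      rw [hp, hbM]
      have h1 : A.M ∉ s := fun h => lt_irrefl _ h.2.2.1
      have h2 : -A.M ∉ s := fun h => h.2.2.2 rfl
      simp only [h1, h2, hMm, hfull, if_false]
      norm_num
    refine ⟨p, by rw [hpM, hpm], ?_, fun c hc1 hc2 hce => ?_⟩
    · rw [hpm]
      rcases he with rfl | rfl <;> rw [coord_neg]
      · rw [hpM, neg_zero]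
      · rw [hpm, neg_zero]
    · rw [hpm, hp]
      have hcm : c ≠ -A.m := by
        rintro rfl
        simp only [PM.eq_iff, PM.lt_iff, PM.coe_neg, ne_eq] at *
        omega
      have hcM : c ≠ -A.M := by
        rintro rfl
        simp only [PM.eq_iff, PM.lt_iff, PM.coe_neg, ne_eq] at *
        omega
      simp only [hc1.ne', hcm, if_false]
      constructor
      · intro h
        rw [A.block_eq_two.mpr h]
        simp only [hsA c h, if_false]
        norm_num
      · intro h
        by_cases h1 : -c ∈ A.carrier
        · have h2 := hsA _ h1
          rw [PM.neg_neg] at h2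
          rw [A.block_eq_zero.mpr h1]
          simp only [h2, if_false]
          norm_num
        · have h2 : A.block c = 1 := by
            have h3 := A.block_le c
            have h4 := A.block_eq_two.not.mpr h
            have h5 := A.block_eq_zero.not.mpr h1
            omega
          have h3 : c ∈ A.pmCompl := A.mem_pmCompl.mpr ⟨h, h1⟩
          have h4 : c ∈ s := ⟨h3, hc1, hc2, hcM⟩
          have h5 : -c ∉ s := by
            rintro ⟨-, h5, h6, -⟩
            have : c ∈ (A.pmCompl : Set (PM n)) ∩ Set.Ioo A.m A.M ∩ Set.Ioo (-A.M) (-A.m) := by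
              refine ⟨⟨h3, hc1, hc2⟩, ?_, ?_⟩
              · rw [← PM.neg_lt_neg, PM.neg_neg]; exact h6
              · rw [← PM.neg_lt_neg, PM.neg_neg]; exact h5
            rw [hF] at this
            exact this
          rw [h2]
          simp only [h4, h5, if_true, if_false]
          norm_num

end Sufficiency

/-! ### Equivalence of arrows with the six conditions -/

variable {A₁ A₂ : SignedSubset n}

theorem inner_of_r1 (hr : r1 A₁ A₂) {p : BSpace n} (hM : p.1 A₁.M = p.1 A₁.m)
    (hm : p.1 A₁.m = p.1 A₂.m) (h : ∀ c, A₁.m < c → c < A₁.M →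
      (c ∈ A₂.carrier → p.1 c < p.1 A₂.m) ∧ (c ∉ A₂.carrier → p.1 A₂.m < p.1 c)) :
    p ∈ A₁.inner := by
  refine ⟨hM, fun c h1 h2 => ?_⟩
  have h3 : c ∈ A₁.carrier ↔ c ∈ A₂.carrier := by
    have := Set.ext_iff.mp hr c
    simpa [h1, h2] using this
  rw [h3, hm]
  exact h c h1 h2

theorem inner_of_r2 (hr : r2 A₁ A₂) {p : BSpace n} (hM : p.1 A₁.M = p.1 A₁.m)
    (hm : p.1 A₁.m = -p.1 A₂.m) (h : ∀ c, A₁.m < c → c < A₁.M →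
      (-c ∈ A₂.carrier → p.1 (-c) < p.1 A₂.m) ∧ (-c ∉ A₂.carrier → p.1 A₂.m < p.1 (-c))) :
    p ∈ A₁.inner := by
  refine ⟨hM, fun c h1 h2 => ?_⟩
  have h3 : c ∈ A₁.carrier ↔ -c ∉ A₂.carrier := by
    have := Set.ext_iff.mp hr c
    simpa [h1, h2] using this
  have h4 := h c h1 h2
  rw [coord_neg] at h4
  rw [h3, hm, not_not]
  exact ⟨fun h5 => by linarith [h4.2 h5], fun h5 => by linarith [h4.1 h5]⟩

/-- The level is 0, so the cut at -e passes through the point as well; it is implied because x_M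
vanishes on the intersection of the hyperplanes. -/
theorem arr_of_full (hfull : A₂.M = -A₂.m) {e : PM n} (he1 : A₂.m < e) (he2 : e < A₂.M)
    (hU : A₁.hyper ⊓ A₂.hyper ≤ hyp A₂.M e)
    (hin : ∀ p : BSpace n, p.1 A₂.m = 0 → p.1 e = 0 →
      (∀ c, A₂.m < c → c < A₂.M → c ≠ e → c ≠ -e →
        (c ∈ A₂.carrier → p.1 c < 0) ∧ (c ∉ A₂.carrier → 0 < p.1 c)) → p ∈ A₁.inner) :
    Arr A₁ A₂ := by
  obtain ⟨p, hp1, hp2, hp3⟩ := exists_point_full hfull he1 he2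
  have hM : p.1 A₂.M = p.1 A₂.m := by rw [hfull, coord_neg, hp1, neg_zero]
  refine ⟨p, hin p hp1 hp2 hp3, ⟨hM, fun c h1 h2 => ?_⟩, ⟨e, he1, he2, hU⟩, fun c h1 h2 h3 => ?_⟩
  · rw [hp1]
    by_cases h4 : c = e
    · rw [h4, hp2]; simp
    by_cases h5 : c = -e
    · rw [h5, coord_neg, hp2]; simp
    · exact ⟨fun h => ((hp3 c h1 h2 h4 h5).1 h).le, fun h => ((hp3 c h1 h2 h4 h5).2 h).le⟩
  · by_cases h4 : c = e
    · rwa [h4]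
    by_cases h5 : c = -e
    · intro x hx
      have h6 : x.1 A₂.M = x.1 e := hU hx
      have h7 : x.1 A₂.M = x.1 A₂.m := hx.2
      have h8 := congrArg x.1 hfull
      rw [coord_neg] at h8
      change x.1 A₂.M = x.1 c
      rw [h5, coord_neg]
      linarith
    · by_cases h : c ∈ A₂.carrier
      · exact absurd (h3.trans hp1) ((hp3 c h1 h2 h4 h5).1 h).ne
      · exact absurd (h3.trans hp1) ((hp3 c h1 h2 h4 h5).2 h).ne'

theorem arr_of_condF (h₂ : A₂.m < A₂.M) (hfull : A₂.M ≠ -A₂.m) {e : PM n} (he1 : A₂.m < e)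
    (he2 : e < A₂.M) (hF : condF A₂ e) (hU : A₁.hyper ⊓ A₂.hyper ≤ hyp A₂.M e)
    (hin : ∀ p : BSpace n, p.1 A₂.M = p.1 A₂.m → p.1 e = p.1 A₂.m →
      (∀ c, A₂.m < c → c < A₂.M → c ≠ e →
        (c ∈ A₂.carrier → p.1 c < p.1 A₂.m) ∧ (c ∉ A₂.carrier → p.1 A₂.m < p.1 c)) →
      p ∈ A₁.inner) :
    Arr A₁ A₂ := by
  obtain ⟨p, hp1, hp2, hp3⟩ := exists_point h₂ hfull he1 he2 hF
  refine ⟨p, hin p hp1 hp2 hp3, ⟨hp1, fun c h1 h2 => ?_⟩, ⟨e, he1, he2, hU⟩, fun c h1 h2 h3 => ?_⟩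
  · by_cases h4 : c = e
    · rw [h4, hp2]; simp
    · exact ⟨fun h => ((hp3 c h1 h2 h4).1 h).le, fun h => ((hp3 c h1 h2 h4).2 h).le⟩
  · by_cases h4 : c = e
    · rwa [h4]
    · by_cases h : c ∈ A₂.carrier
      · exact absurd h3 ((hp3 c h1 h2 h4).1 h).ne
      · exact absurd h3 ((hp3 c h1 h2 h4).2 h).ne'

/-- The right hand side of the description of the arrows. -/
def ArrowCond (A₁ A₂ : SignedSubset n) : Prop :=
  (q1 A₁ A₂ ∧ r1 A₁ A₂) ∨
  (q2 A₁ A₂ ∧ r1 A₁ A₂) ∨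
  (q3 A₁ A₂ ∧ condF A₂ A₁.m ∧ r1 A₁ A₂) ∨
  (q4 A₁ A₂ ∧ condF A₂ A₁.M ∧ r1 A₁ A₂) ∨
  (q5 A₁ A₂ ∧ condF A₂ (-A₁.m) ∧ r2 A₁ A₂) ∨
  (q6 A₁ A₂ ∧ condF A₂ (-A₁.M) ∧ r2 A₁ A₂)

/-- This supplies M - m as the grading that excludes directed cycles. -/
theorem ArrowCond.length_lt (h₂ : A₂.m < A₂.M) (h : ArrowCond A₁ A₂) :
    A₁.M.1 - A₁.m.1 < A₂.M.1 - A₂.m.1 := by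
  have hM := A₂.M_pos h₂
  rcases h with ⟨h, -⟩ | ⟨h, -⟩ | ⟨h, -⟩ | ⟨h, -⟩ | ⟨h, -⟩ | ⟨h, -⟩
  · unfold q1 at h
    simp only [PM.eq_iff, PM.lt_iff, PM.coe_neg] at *
    omega
  · unfold q2 at h
    simp only [PM.eq_iff, PM.lt_iff, PM.coe_neg] at *
    omega
  · unfold q3 at h
    simp only [PM.eq_iff, PM.lt_iff, PM.coe_neg, ne_eq] at *
    omega
  · unfold q4 at h
    simp only [PM.eq_iff, PM.lt_iff, PM.coe_neg, ne_eq] at *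
    omega
  · unfold q5 at h
    simp only [PM.eq_iff, PM.lt_iff, PM.coe_neg, ne_eq] at *
    omega
  · unfold q6 at h
    simp only [PM.eq_iff, PM.lt_iff, PM.coe_neg, ne_eq] at *
    omega

/-- The cut is taken at M₁ and m₁ in the first two cases and at the argument of (f) in the others;
(r1) or (r2) places the constructed point in the interior of the first shard. -/
theorem arr_of_arrowCond (h₁ : A₁.m < A₁.M) (h₂ : A₂.m < A₂.M) (h : ArrowCond A₁ A₂) : Arr A₁ A₂ := by
  rcases h with ⟨⟨q, q', q''⟩, hr⟩ | ⟨⟨q, q', q'', q3⟩, hr⟩ | ⟨⟨q, q', q'', q3⟩, hF, hr⟩ |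
    ⟨⟨q, q', q'', q3⟩, hF, hr⟩ | ⟨⟨q, q', q'', q3⟩, hF, hr⟩ | ⟨⟨q, q', q'', q3⟩, hF, hr⟩
  · refine arr_of_full q'' (e := A₁.M) ?_ q' ?_ fun p hm he h => ?_
    · simp only [PM.eq_iff, PM.lt_iff, PM.coe_neg] at *; omega
    · rintro x ⟨h1, h2⟩
      change x.1 A₁.M = x.1 A₁.m at h1
      change x.1 A₂.M = x.1 A₂.m at h2
      change x.1 A₂.M = x.1 A₁.M
      have e1 := congrArg x.1 q
      have e2 := congrArg x.1 q''
      rw [coord_neg] at e1 e2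
      linarith
    · have e1 := congrArg p.1 q
      rw [coord_neg] at e1
      refine inner_of_r1 hr (by linarith) (by linarith) fun c h1 h2 => ?_
      rw [hm]
      refine h c ?_ ?_ ?_ ?_
      all_goals simp only [PM.eq_iff, PM.lt_iff, PM.coe_neg, ne_eq] at *; omega
  · refine arr_of_full q.symm (e := A₁.m) ?_ (q'.symm ▸ q'') ?_ fun p hm he h => ?_
    · simp only [PM.eq_iff, PM.lt_iff, PM.coe_neg] at *; omega
    · rintro x ⟨h1, h2⟩
      change x.1 A₁.M = x.1 A₁.m at h1
      change x.1 A₂.M = x.1 A₁.m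
      rw [q', h1]
    · have e1 := congrArg p.1 q
      rw [coord_neg, q'] at e1
      refine inner_of_r1 hr (by linarith) (by linarith) fun c h1 h2 => ?_
      rw [hm]
      refine h c ?_ ?_ ?_ ?_
      all_goals simp only [PM.eq_iff, PM.lt_iff, PM.coe_neg, ne_eq] at *; omega
  · refine arr_of_condF h₂ (fun h => q3 (PM.eq_neg_comm.mp h)) q'' (q.symm ▸ q') hF ?_
      fun p hM he h => ?_
    · rintro x ⟨h1, h2⟩
      change x.1 A₁.M = x.1 A₁.m at h1
      change x.1 A₂.M = x.1 A₁.m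
      rw [q, h1]
    · refine inner_of_r1 hr (by rw [← q, hM, he]) he fun c h1 h2 => ?_
      exact h c (q''.trans h1) (q.symm ▸ h2) h1.ne'
  · refine arr_of_condF h₂ (fun h => q3 (PM.eq_neg_comm.mp h)) (q'' ▸ q') q hF ?_
      fun p hM he h => ?_
    · rintro x ⟨h1, h2⟩
      change x.1 A₁.M = x.1 A₁.m at h1
      change x.1 A₂.M = x.1 A₂.m at h2
      change x.1 A₂.M = x.1 A₁.M
      rw [h1, h2, q'']
    · refine inner_of_r1 hr (by rw [he, q'']) (by rw [q'']) fun c h1 h2 => ?_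
      exact h c (q'' ▸ h1) (h2.trans q) h2.ne
  · refine arr_of_condF h₂ (fun h => q3 (PM.eq_neg_comm.mp h).symm) ?_ ?_ hF ?_
      fun p hM he h => ?_
    · simp only [PM.eq_iff, PM.lt_iff, PM.coe_neg] at *; omega
    · simp only [PM.eq_iff, PM.lt_iff, PM.coe_neg] at *; omega
    · rintro x ⟨h1, h2⟩
      change x.1 A₁.M = x.1 A₁.m at h1
      change x.1 A₂.M = x.1 A₂.m at h2
      change x.1 A₂.M = x.1 (-A₁.m)
      have e1 := congrArg x.1 q
      rw [coord_neg] at e1 ⊢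
      linarith
    · have e1 := congrArg p.1 q
      rw [coord_neg] at e1 he
      refine inner_of_r2 hr (by linarith) (by linarith) fun c h1 h2 => h _ ?_ ?_ ?_
      all_goals simp only [PM.eq_iff, PM.lt_iff, PM.coe_neg, ne_eq] at *; omega
  · refine arr_of_condF h₂ (fun h => q3 (PM.eq_neg_comm.mp h).symm) ?_ ?_ hF ?_
      fun p hM he h => ?_
    · simp only [PM.eq_iff, PM.lt_iff, PM.coe_neg] at *; omega
    · simp only [PM.eq_iff, PM.lt_iff, PM.coe_neg] at *; omega
    · rintro x ⟨h1, h2⟩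
      change x.1 A₁.M = x.1 A₁.m at h1
      change x.1 A₂.M = x.1 A₂.m at h2
      change x.1 A₂.M = x.1 (-A₁.M)
      have e1 := congrArg x.1 q''
      rw [coord_neg] at e1 ⊢
      linarith
    · have e1 := congrArg p.1 q''
      rw [coord_neg] at e1 he
      refine inner_of_r2 hr (by linarith) (by linarith) fun c h1 h2 => h _ ?_ ?_ ?_
      all_goals simp only [PM.eq_iff, PM.lt_iff, PM.coe_neg, ne_eq] at *; omega

theorem Arr.arrowCond (h₁ : A₁.m < A₁.M) (h₂ : A₂.m < A₂.M) (h : Arr A₁ A₂) :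
    ArrowCond A₁ A₂ := by
  have hne := h.hyper_ne
  obtain ⟨p, hp1, hp2, ⟨e, he1, he2, he3⟩, hcut⟩ := h
  have hpe : p.1 e = p.1 A₂.m := by
    have h3 : p.1 A₂.M = p.1 e := he3 ⟨hp1.1, hp2.1⟩
    rw [← h3, hp2.1]
  have hM := hp2.1
  have hU := inf_hyper_eq h₁ h₂ hne he1 he2 he3
  rcases names_of_arr h₁ h₂ hne he1 he2 he3 hp1 hp2.1 hpe with ⟨hf, h⟩ | ⟨hf, h⟩
  · have hm : p.1 A₂.m = 0 := by
      rw [hf, coord_neg] at hM; linarith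
    rcases h with ⟨hMM, hme, hpos⟩ | ⟨hMe, hmM⟩
    · refine Or.inr (Or.inl ⟨⟨hf.symm, hMM.symm, h₁, hpos⟩, r1_of_arr hp1 hp2 ?_ ?_⟩)
      · rcases hme with hme | hme <;> rw [hme]
        · exact hpe
        · rw [coord_neg, hpe, hm, neg_zero]
      · intro c h3 h4
        simp only [PM.eq_iff, PM.lt_iff, PM.coe_neg] at *
        omega
    · refine Or.inl ⟨⟨?_, ?_, hf⟩, r1_of_arr hp1 hp2 ?_ ?_⟩
      · rw [hmM, PM.neg_neg]
      · simp only [PM.eq_iff, PM.lt_iff, PM.coe_neg] at *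
        omega
      · rw [hmM, coord_neg]
        rcases hMe with hMe | hMe <;> rw [hMe]
        · rw [hpe, hm, neg_zero]
        · rw [coord_neg, neg_neg, hpe]
      · intro c h3 h4
        simp only [PM.eq_iff, PM.lt_iff, PM.coe_neg] at *
        omega
  · have hF : condF A₂ e := condF_of_arr h₂ hf he1 he2 hp2 hpe (by rwa [hU] at hcut)
    have hf' : A₂.m ≠ -A₂.M := fun h => hf (PM.eq_neg_comm.mp h)
    refine Or.inr (Or.inr ?_)
    rcases h with ⟨h3, h4⟩ | ⟨h3, h4⟩ | ⟨h3, h4⟩ | ⟨h3, h4⟩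
    · refine Or.inl ⟨⟨h3.symm, h₁, h4 ▸ he1, hf'⟩, h4 ▸ hF, r1_of_arr hp1 hp2 (h4 ▸ hpe) ?_⟩
      exact fun c h5 h6 => ⟨he1.trans (h4 ▸ h5), h3 ▸ h6⟩
    · have h5 : -A₁.M = e := by rw [h3, PM.neg_neg]
      refine Or.inr (Or.inr (Or.inr ⟨⟨?_, h₁, h4, hf'.symm⟩, h5 ▸ hF, r2_of_arr hp1 hp2 ?_ ?_⟩))
      · rw [h3]; exact PM.neg_lt_neg.mpr he1
      · rw [h4, coord_neg, hM]
      · intro c h6 h7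
        simp only [PM.eq_iff, PM.lt_iff, PM.coe_neg] at *
        omega
    · refine Or.inr (Or.inl ⟨⟨h3 ▸ he2, h₁, h4, hf'⟩, h3 ▸ hF, r1_of_arr hp1 hp2 (by rw [h4]) ?_⟩)
      exact fun c h5 h6 => ⟨h4 ▸ h5, (h3 ▸ h6 : c < e).trans he2⟩
    · have h5 : -A₁.m = e := by rw [h4, PM.neg_neg]
      refine Or.inr (Or.inr (Or.inl ⟨⟨h3.symm, h₁, ?_, hf'.symm⟩, h5 ▸ hF,
        r2_of_arr hp1 hp2 ?_ ?_⟩))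
      · rw [h4]; exact PM.neg_lt_neg.mpr he2
      · rw [h4, coord_neg, hpe]
      · intro c h6 h7
        simp only [PM.eq_iff, PM.lt_iff, PM.coe_neg] at *
        omega

theorem arr_iff (h₁ : A₁.m < A₁.M) (h₂ : A₂.m < A₂.M) : Arr A₁ A₂ ↔ ArrowCond A₁ A₂ :=
  ⟨fun h => h.arrowCond h₁ h₂, arr_of_arrowCond h₁ h₂⟩

end SignedSubset

/-! ### Bijections with join-irreducible elements and shards, and transfer to the shard digraph -/

namespace Adm

open SignedSubset

variable (n : ℕ)

/-- Admissible signed subsets encode the join-irreducible elements. -/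
noncomputable def joinIrrEquiv : Adm n ≃ {w : SignedPerm n // IsJoinIrr w} :=
  Equiv.ofBijective (fun A => ⟨A.1.gamma, isJoinIrr_gamma A.2⟩)
    ⟨fun A A' h => Subtype.ext (gamma_injective A.2 A'.2 (Subtype.ext_iff.mp h)), fun w => by
      obtain ⟨A, hA, h⟩ := exists_gamma_of_isJoinIrr w.2
      exact ⟨⟨A, hA⟩, Subtype.ext h⟩⟩

/-- Admissible signed subsets encode the shards. -/
noncomputable def shardEquiv : Adm n ≃ ShardsB n :=
  Equiv.ofBijective (fun A => ⟨A.1.shard, isShard_iff.mpr ⟨A.1, A.2, rfl⟩⟩)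
    ⟨fun A A' h => Subtype.ext (shard_injective A.2 A'.2 (Subtype.ext_iff.mp h)), fun T => by
      obtain ⟨A, hA, h⟩ := isShard_iff.mp T.2
      exact ⟨⟨A, hA⟩, Subtype.ext h.symm⟩⟩

/-- The weak order with its covers labelled by shards. -/
noncomputable def weakEdgeSystem : EdgeSystem (SignedPerm n) (Adm n) :=
  edgeSystem (fun A => A.1.M.1 - A.1.m.1) fun A B h => ((arr_iff A.2 B.2).mp h).length_lt B.2

variable {n}

theorem shArrowB_iff (A B : Adm n) :
    ShArrowB (shardEquiv n A) (shardEquiv n B) ↔ Arr A.1 B.1 :=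
  shArrow_iff A.2 B.2

theorem transGen_iff (A B : Adm n) :
    Relation.TransGen ShArrowB (shardEquiv n A) (shardEquiv n B) ↔
      Relation.TransGen (fun A B : Adm n => Arr A.1 B.1) A B := by
  constructor
  · intro h
    have := Relation.TransGen.lift (p := fun A B : Adm n => Arr A.1 B.1) (shardEquiv n).symm
      (fun T T' h => by
        change Arr _ _
        rw [← shArrowB_iff, Equiv.apply_symm_apply, Equiv.apply_symm_apply]
        exact h) _ _ h
    rw [Function.onFun, Equiv.symm_apply_apply, Equiv.symm_apply_apply] at this
    exact this
  · exact Relation.TransGen.lift (shardEquiv n) (fun A B h => (shArrowB_iff A B).mpr h) _ _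

end Adm

end ShardB

theorem theorem7p3 (n : ℕ) :
    ∃ (γ : {A : ShardB.SignedSubset n // A.m < A.M} ≃
          {w : ShardB.SignedPerm n // ShardB.IsJoinIrr w})
      (σ : {w : ShardB.SignedPerm n // ShardB.IsJoinIrr w} ≃ ShardB.ShardsB n)
      (Φ : ShardB.ShardsB n ≃
          {Θ : ShardB.Con (ShardB.SignedPerm n) // ShardB.IsJoinIrr Θ}),
      -- the join-irreducible element encoded by a signed subset
      (∀ (A : {A : ShardB.SignedSubset n // A.m < A.M}) (w : ShardB.SignedPerm n),
        A.1.Lists w ↔ w = (γ A).1) ∧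
      -- the shard associated to a join-irreducible element
      (∀ (w : {w : ShardB.SignedPerm n // ShardB.IsJoinIrr w}) (T : ShardB.ShardsB n),
        ShardB.IsMinUpperRegion (ShardB.arrB n) (ShardB.baseB n) T.1 (ShardB.regionB w.1) ↔
          T = σ w) ∧
      -- the arrows of the shard digraph
      (∀ A₁ A₂ : {A : ShardB.SignedSubset n // A.m < A.M},
        ShardB.ShArrowB (σ (γ A₁)) (σ (γ A₂)) ↔
          (ShardB.q1 A₁.1 A₂.1 ∧ ShardB.r1 A₁.1 A₂.1) ∨
          (ShardB.q2 A₁.1 A₂.1 ∧ ShardB.r1 A₁.1 A₂.1) ∨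
          (ShardB.q3 A₁.1 A₂.1 ∧ ShardB.condF A₂.1 A₁.1.m ∧ ShardB.r1 A₁.1 A₂.1) ∨
          (ShardB.q4 A₁.1 A₂.1 ∧ ShardB.condF A₂.1 A₁.1.M ∧ ShardB.r1 A₁.1 A₂.1) ∨
          (ShardB.q5 A₁.1 A₂.1 ∧ ShardB.condF A₂.1 (-A₁.1.m) ∧ ShardB.r2 A₁.1 A₂.1) ∨
          (ShardB.q6 A₁.1 A₂.1 ∧ ShardB.condF A₂.1 (-A₁.1.M) ∧ ShardB.r2 A₁.1 A₂.1)) ∧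
      -- the transitive closure of the shard digraph is the poset of join-irreducible congruences
      (∀ w : {w : ShardB.SignedPerm n // ShardB.IsJoinIrr w},
        IsLeast {Θ : ShardB.Con (ShardB.SignedPerm n) | ShardB.Contracts Θ w.1} (Φ (σ w)).1) ∧
      (∀ T₁ T₂ : ShardB.ShardsB n,
        Φ T₂ < Φ T₁ ↔ Relation.TransGen ShardB.ShArrowB T₁ T₂) := by
  open ShardB in
  refine ⟨Adm.joinIrrEquiv n, (Adm.joinIrrEquiv n).symm.trans (Adm.shardEquiv n),
    (Adm.shardEquiv n).symm.trans (Adm.weakEdgeSystem n).principalEquiv,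
    fun A w => SignedSubset.lists_iff, fun w T => ?_, fun A₁ A₂ => ?_, fun w => ?_, fun T₁ T₂ => ?_⟩
  · obtain ⟨A, rfl⟩ := (Adm.joinIrrEquiv n).surjective w
    obtain ⟨A', rfl⟩ := (Adm.shardEquiv n).surjective T
    rw [Equiv.trans_apply, Equiv.symm_apply_apply, (Adm.shardEquiv n).apply_eq_iff_eq]
    exact (SignedSubset.isMinUpperRegion_iff A.2 A'.2).trans Subtype.ext_iff.symm
  · rw [Equiv.trans_apply, Equiv.trans_apply, Equiv.symm_apply_apply, Equiv.symm_apply_apply]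
    exact (Adm.shArrowB_iff A₁ A₂).trans (SignedSubset.arr_iff A₁.2 A₂.2)
  · obtain ⟨A, rfl⟩ := (Adm.joinIrrEquiv n).surjective w
    rw [Equiv.trans_apply, Equiv.trans_apply, Equiv.symm_apply_apply, Equiv.symm_apply_apply]
    exact (Adm.weakEdgeSystem n).isLeast_principal A
  · obtain ⟨A₁, rfl⟩ := (Adm.shardEquiv n).surjective T₁
    obtain ⟨A₂, rfl⟩ := (Adm.shardEquiv n).surjective T₂
    rw [Equiv.trans_apply, Equiv.trans_apply, Equiv.symm_apply_apply, Equiv.symm_apply_apply,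
      Adm.transGen_iff]
    exact (Adm.weakEdgeSystem n).principal_lt_principal
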